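/- The machine is a word RAM with $w$-bit words whose unit-cost instructions are: loading a constant, copying, addition, subtraction and multiplication modulo $2^w$, bit-shifts, reading or writing a word of the input memory or of the working memory at a computed address, jumps conditioned on comparisons, and sending a word to a write-only output stream. The *sorted standard representation* of a graph on the vertices $1,\dots,n$ is the array $A$ consisting of $A[0]=n$; a table $A[1],\dots,A[n]$ in which $A[v]$ is the index in $A$ at which the adjacency array of vertex $v$ starts; $A[n+1]$, the total length of the adjacency arrays; and then the adjacency arrays of the vertices $1,2,\dots,n$ one after another, the adjacency array of $v$ listing the (out-)neighbours of $v$ in ascending order. (In an undirected graph every edge occurs at both endpoints.) **Theorem.** There are a single program, using a constant number of words of working memory, and a constant $C$, such that the following holds for all $n$, $m$, $w$, for every directed graph (without parallel edges) and for every simple undirected graph with vertex set $\{1,\dots,n\}$ and $m$ edges, and for every start vertex $s$. The sorted standard representation consists of $N=n+m+2$ words if the graph is directed and of $N=n+2m+2$ words if it is undirected. If $N<2^w$, the input memory consists of exactly this representation, and $s$ is given in the working memory, then the program halts after at most $C(n+m)$ steps, using no memory besides the input memory and the working memory; it outputs the pairs $(v,d)$ of a vertex $v$ reachable from $s$ and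 its distance $d$ from $s$, every reachable vertex exactly once and in an order in which the distances are non-decreasing; and when it halts, the input memory again contains the sorted standard representation of the graph. -/

import Mathlib

/-! ### The word RAM

A machine word is a `BitVec w`. The machine has an input memory, which is a list of words whose
length never changes, and a working memory consisting of `k + 1` words (the registers),
where `k` is fixed together with the program. Output goes to a write-only stream. -/

/-- The instructions of a word RAM whose working memory consists of the registers `0, …, k`.
In arithmetic, shift and load instructions the first argument is the destination, and all arithmetic
is modulo `2 ^ w`; `A` is the input memory. -/
inductive Instr (k : ℕ) where
  /-- `d := c`; the numeral `c` is reduced modulo `2 ^ w` -/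
  | const (d : Fin (k + 1)) (c : ℕ)
  | copy (d a : Fin (k + 1))
  | add (d a b : Fin (k + 1))
  | sub (d a b : Fin (k + 1))
  | mul (d a b : Fin (k + 1))
  | shl (d a b : Fin (k + 1))
  | shr (d a b : Fin (k + 1))
  /-- `d := A[a]` -/
  | load (d a : Fin (k + 1))
  /-- `A[a] := b` -/
  | store (a b : Fin (k + 1))
  /-- `d := R[a]`, where `R` is the working memory itself -/
  | loadWork (d a : Fin (k + 1))
  /-- `R[a] := b` -/
  | storeWork (a b : Fin (k + 1))
  | jump (target : ℕ)
  /-- jump if `a = b` -/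
  | jeq (a b : Fin (k + 1)) (target : ℕ)
  /-- jump if `a < b`, as unsigned numbers -/
  | jlt (a b : Fin (k + 1)) (target : ℕ)
  /-- send the word in register `a` to the output stream -/
  | output (a : Fin (k + 1))
  | halt

/-- A program is a finite sequence of instructions; it depends neither on the input nor on `w`. -/
abbrev Program (k : ℕ) := List (Instr k)

/-- A configuration: instruction counter, working memory, input memory, output so far. -/
@[ext] structure Config (k w : ℕ) where
  pc : ℕ
  regs : Fin (k + 1) → BitVec w
  mem : List (BitVec w)
  out : List (BitVec w)

namespace Config

variable {k w : ℕ}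

/-- Write `x` to register `d` and go to the next instruction. -/
def setReg (c : Config k w) (d : Fin (k + 1)) (x : BitVec w) : Config k w :=
  { c with pc := c.pc + 1, regs := Function.update c.regs d x }

/-- Go to `target` if the condition holds, and to the next instruction otherwise. -/
def branch (c : Config k w) (p : Prop) [Decidable p] (target : ℕ) : Config k w :=
  { c with pc := if p then target else c.pc + 1 }

/-- The effect of one instruction. There is no next configuration after `halt`, nor when an address
outside the respective memory is used. -/
def exec (c : Config k w) : Instr k → Option (Config k w)
  | .const d x => some (c.setReg d (BitVec.ofNat w x))
  | .copy d a => some (c.setReg d (c.regs a))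
  | .add d a b => some (c.setReg d (c.regs a + c.regs b))
  | .sub d a b => some (c.setReg d (c.regs a - c.regs b))
  | .mul d a b => some (c.setReg d (c.regs a * c.regs b))
  | .shl d a b => some (c.setReg d (c.regs a <<< (c.regs b).toNat))
  | .shr d a b => some (c.setReg d (c.regs a >>> (c.regs b).toNat))
  | .load d a => (c.mem[(c.regs a).toNat]?).map (c.setReg d)
  | .store a b =>
      if (c.regs a).toNat < c.mem.length then
        some { c with pc := c.pc + 1, mem := c.mem.set (c.regs a).toNat (c.regs b) }
      else none
  | .loadWork d a =>
      if h : (c.regs a).toNat < k + 1 then some (c.setReg d (c.regs ⟨(c.regs a).toNat, h⟩)) else none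
  | .storeWork a b =>
      if h : (c.regs a).toNat < k + 1 then some (c.setReg ⟨(c.regs a).toNat, h⟩ (c.regs b)) else none
  | .jump target => some { c with pc := target }
  | .jeq a b target => some (c.branch (c.regs a = c.regs b) target)
  | .jlt a b target => some (c.branch ((c.regs a).toNat < (c.regs b).toNat) target)
  | .output a => some { c with pc := c.pc + 1, out := c.out ++ [c.regs a] }
  | .halt => none

end Config

namespace Program

variable {k w : ℕ}

/-- One step of the program; it takes one unit of time. -/
def step (prog : Program k) (c : Config k w) : Option (Config k w) :=
  (prog[c.pc]?).bind c.exec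

/-- The configuration after exactly `t` steps, if there is one. -/
def run (prog : Program k) : ℕ → Config k w → Option (Config k w)
  | 0, c => some c
  | t + 1, c => (prog.step c).bind (prog.run t)

/-- The initial configuration: the input memory is `mem`, register `0` holds the word `x`, all other
registers hold `0`, nothing has been output. -/
def init (k : ℕ) (mem : List (BitVec w)) (x : BitVec w) : Config k w where
  pc := 0
  regs := Function.update (fun _ => 0) 0 x
  mem := mem
  out := []

/-- Started with input memory `mem` and parameter `x`, the program reaches a `halt` instruction
within `T` steps; at that moment the input memory has its original content again and the words
sent to the output stream are `out`. -/
def HaltsRestoring (prog : Program k) (mem : List (BitVec w)) (x : BitVec w)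
    (out : List (BitVec w)) (T : ℕ) : Prop :=
  ∃ t ≤ T, ∃ c, prog.run t (init k mem x) = some c ∧ prog[c.pc]? = some .halt ∧
    c.mem = mem ∧ c.out = out

end Program

/-! ### The sorted standard representation

The vertex `v : Fin n` of a graph is called `v + 1` in the representation, so that the names of the
vertices are `1, …, n`. -/

/-- The adjacency array of `v`: the names of the (out-)neighbours of `v` in ascending order. -/
def adjArray {n : ℕ} (adj : Fin n → Fin n → Prop) [DecidableRel adj] (v : Fin n) : List ℕ :=
  ((List.finRange n).filter fun u => adj v u).map fun u => u.val + 1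

/-- The position of the adjacency array of `v`. -/
def arrayStart {n : ℕ} (adj : Fin n → Fin n → Prop) [DecidableRel adj] (v : Fin n) : ℕ :=
  n + 2 + ∑ u : Fin n with u < v, (adjArray adj u).length

/-- The sorted standard representation: the number `n` of vertices, the table of pointers, the total
length of the adjacency arrays, and the adjacency arrays of the vertices `1, …, n` in this order. -/
def sortedRep {n : ℕ} (adj : Fin n → Fin n → Prop) [DecidableRel adj] : List ℕ :=
  [n] ++ (List.finRange n).map (arrayStart adj) ++ [∑ v : Fin n, (adjArray adj v).length] ++
    (List.finRange n).flatMap (adjArray adj)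

/-- The representation as a sequence of `w`-bit words. -/
def repWords (w : ℕ) {n : ℕ} (adj : Fin n → Fin n → Prop) [DecidableRel adj] :
    List (BitVec w) :=
  (sortedRep adj).map (BitVec.ofNat w)

/-- The word for the name of the vertex `v`. -/
def vertexWord (w : ℕ) {n : ℕ} (v : Fin n) : BitVec w := BitVec.ofNat w (v.val + 1)

/-! ### Breadth-first search -/

/-- The number of edges of a directed graph. -/
def Digraph.numEdges {n : ℕ} (G : Digraph (Fin n)) [DecidableRel G.Adj] : ℕ :=
  (Finset.univ.filter fun e : Fin n × Fin n => G.Adj e.1 e.2).card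

/-- There is a directed walk with `d` edges from `s` to the given vertex. -/
inductive Digraph.HasWalk {V : Type*} (G : Digraph V) (s : V) : ℕ → V → Prop
  | nil : Digraph.HasWalk G s 0 s
  | snoc {d : ℕ} {u v : V} : Digraph.HasWalk G s d u → G.Adj u v → Digraph.HasWalk G s (d + 1) v

/-- `v` is reachable from `s` and the distance from `s` to `v` is `d`. -/
def Digraph.HasDist {V : Type*} (G : Digraph V) (s v : V) (d : ℕ) : Prop :=
  IsLeast {i | G.HasWalk s i v} d

/-- `v` is reachable from `s` and the distance from `s` to `v` is `d`. -/
def SimpleGraph.HasDist {V : Type*} (G : SimpleGraph V) (s v : V) (d : ℕ) : Prop :=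
  G.Reachable s v ∧ G.dist s v = d

/-- A list of pairs of a vertex and a round number is the result of a breadth-first search, where
`hasDist v d` says that `v` is reachable from the start vertex at distance `d`: every reachable
vertex occurs exactly once, together with its distance, no other vertex occurs, and the
distances ascend. -/
structure IsBFS {V : Type*} (hasDist : V → ℕ → Prop) (l : List (V × ℕ)) : Prop where
  nodup : (l.map Prod.fst).Nodup
  mem_iff : ∀ v d, (v, d) ∈ l ↔ hasDist v d
  ascending : l.Pairwise fun a b => a.2 ≤ b.2

/-- The pairs as they are sent to the output stream: name of the vertex, then round number. -/
def outputWords (w : ℕ) {n : ℕ} (l : List (Fin n × ℕ)) : List (BitVec w) :=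
  l.flatMap fun p => [vertexWord w p.1, BitVec.ofNat w p.2]

/-!
Breadth-first search can be done in place because the sorted representation is redundant. Two kinds
of redundancy are used to free cells of the pointer table.

Let `N` be the number of cells, `P v` the start of the adjacency array of `v`, and `8 ^ h ≤ N`. The
vertices are divided into groups `X, …, X + 3`, which own the four cells of their pointers. If the
adjacency arrays of a group have total length less than `2 ^ h`, then the offsets of the last three
arrays relative to `P X` are fields of `h` bits, and all of them fit into one word. Otherwise one of
the arrays has length at least `2 ^ (h - 2)`, and then the three pointers are stored in the order of
its entries: since the array is ascending, a pair of neighbouring entries represents a bit by being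
swapped or not, and sorting the pairs undoes this. Reading a pointer takes `O(h)` time in the second
case, which is within `O(2 ^ h)`, the length of the arrays. In both cases the cells `X + 1` and
`X + 3` become available (`Ctx.GroupEnc`, `encodeGroup_spec`, `getStart_spec`, `decodeGroup_spec`):
the word in `X + 3` contains the colours of the four vertices, and the word in `X + 1` links the
group into one of two stacks, for the current and for the next distance. The vertices that are not
in groups (at most three, or all vertices if `N < 8 ^ 10`) are served by the working memory.

The search treats groups as the items of the two stacks. Gray vertices at even and odd distances
have different colours, so a popped group knows which of its members are to be processed now, and it
is pushed to the other stack if gray members remain. The invariant is split into the meaning of the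
memory (`Ctx.Rep`), the abstract state of the search (`Ctx.Search`) and the stacks (`Ctx.Stacks`).
Every pop makes at least one vertex black, so the running time is bounded by the increase of
`Ctx.potential`, in which a black vertex counts with its degree and the size of its group; as groups
have four members, the total is `O(N)` (`Ctx.potential_le`).

The program is written in a small structured language on natural numbers with a clock (`Cmd`), whose
weakest preconditions (`wp`) demand the absence of overflows and of accesses outside the memory. It
is compiled to the word RAM, and `Cmd.code_sound` transfers specifications to the machine.
-/

namespace InPlaceBFS

/-! ### A structured language over the word RAM -/

/-- The number of words of working memory that are used as an array. It is `8 ^ 10`, so that `h ≥ 10`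
for the largest `h` with `8 ^ h ≤ N` as soon as `N ≥ workSize`; see `Ctx.six_l_le`. -/
def workSize : ℕ := 1073741824

/-- The program variables; each of them lives in a register of its own. Throughout, `s` is the start
vertex, `n`, `N`, `m`, `h` and `l` are as in `Ctx`, `X` is a group, `j` the number of a vertex in it,
`u` a vertex that is possibly discovered and `g` its group, `d` and `par` the distance and the colour
of newly discovered vertices, `cp` the colour of the vertices to be processed, `cur` and `nxt` the
tops of the two stacks. -/
inductive Var
  | s | n | N | m | h | l | X | i | j | p | q | e | u | g | t | c | a | z
  | p1 | p2 | p3 | d | par | cp | cur | nxt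
  deriving DecidableEq

/-- The number of a variable. -/
def Var.idx : Var → ℕ
  | .s => 0 | .n => 1 | .N => 2 | .m => 3 | .h => 4 | .l => 5 | .X => 6 | .i => 7 | .j => 8
  | .p => 9 | .q => 10 | .e => 11 | .u => 12 | .g => 13 | .t => 14 | .c => 15 | .a => 16
  | .z => 17 | .p1 => 18 | .p2 => 19 | .p3 => 20 | .d => 21 | .par => 22 | .cp => 23
  | .cur => 24 | .nxt => 25

theorem Var.idx_lt (v : Var) : v.idx < 32 := by cases v <;> decide

theorem Var.idx_injective : Function.Injective Var.idx := by
  intro v v' hv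
  cases v <;> cases v' <;> first | rfl | exact absurd hv (by decide)

/-- The binary operations on words. -/
inductive Op
  | add | sub | mul | shl | shr

/-- The value of an operation on natural numbers. -/
def Op.eval : Op → ℕ → ℕ → ℕ
  | .add, x, y => x + y
  | .sub, x, y => x - y
  | .mul, x, y => x * y
  | .shl, x, y => x * 2 ^ y
  | .shr, x, y => x / 2 ^ y

/-- Sufficient conditions for the operation on words below `B` to agree with the operation on
natural numbers. -/
def Op.Ok (B : ℕ) : Op → ℕ → ℕ → Prop
  | .add, x, y => x + y < B
  | .sub, x, y => y ≤ x
  | .mul, x, y => x * y < B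
  | .shl, x, y => x * 2 ^ y < B
  | .shr, _, _ => True

/-- Arithmetic expressions: `ld e` reads the input memory and `ldw e` the array in the working
memory. -/
inductive Expr
  | lit (c : ℕ)
  | var (x : Var)
  | bin (o : Op) (e f : Expr)
  | ld (e : Expr)
  | ldw (e : Expr)

namespace Expr

instance : Add Expr := ⟨.bin .add⟩
instance : Sub Expr := ⟨.bin .sub⟩
instance : Mul Expr := ⟨.bin .mul⟩
instance : HShiftLeft Expr Expr Expr := ⟨.bin .shl⟩
instance : HShiftRight Expr Expr Expr := ⟨.bin .shr⟩

end Expr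

/-- The states of a structured program. All words are natural numbers; `time` bounds from above the
number of machine steps made so far. -/
structure St where
  r : Var → ℕ
  mem : ℕ → ℕ
  work : ℕ → ℕ
  out : List ℕ
  time : ℕ

/-- Let time pass. -/
def St.tick (σ : St) (t : ℕ) : St := { σ with time := σ.time + t }

/-- Assign a value to a variable. -/
def St.setr (σ : St) (x : Var) (v : ℕ) : St := { σ with r := Function.update σ.r x v }

/-- The value of an expression. -/
def Expr.eval (σ : St) : Expr → ℕ
  | .lit c => c
  | .var x => σ.r x
  | .bin o e f => o.eval (e.eval σ) (f.eval σ)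
  | .ld e => σ.mem (e.eval σ)
  | .ldw e => σ.work (e.eval σ)

/-- No overflow and no access outside of the memory occurs in the evaluation of the expression on a
machine with words below `B` and an input memory of length `len`. -/
def Expr.Ok (B len : ℕ) (σ : St) : Expr → Prop
  | .lit c => c < B
  | .var _ => True
  | .bin o e f => e.Ok B len σ ∧ f.Ok B len σ ∧ o.Ok B (e.eval σ) (f.eval σ)
  | .ld e => e.Ok B len σ ∧ e.eval σ < len
  | .ldw e => e.Ok B len σ ∧ e.eval σ < workSize

/-- The number of instructions for an expression. -/
def Expr.cost : Expr → ℕ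
  | .lit _ => 1
  | .var _ => 1
  | .bin _ e f => e.cost + f.cost + 1
  | .ld e => e.cost + 1
  | .ldw e => e.cost + 1

/-- The number of temporary registers for an expression. -/
def Expr.depth : Expr → ℕ
  | .lit _ => 1
  | .var _ => 1
  | .bin _ e f => max e.depth (f.depth + 1)
  | .ld e => e.depth
  | .ldw e => e.depth

/-- Conditions of branches and loops. -/
inductive Cond
  | lt (e f : Expr)
  | eq (e f : Expr)

/-- The condition holds. -/
def Cond.Holds (σ : St) : Cond → Prop
  | .lt e f => e.eval σ < f.eval σ
  | .eq e f => e.eval σ = f.eval σ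

/-- The condition can be evaluated without overflow and illegal access. -/
def Cond.Ok (B len : ℕ) (σ : St) : Cond → Prop
  | .lt e f => e.Ok B len σ ∧ f.Ok B len σ
  | .eq e f => e.Ok B len σ ∧ f.Ok B len σ

/-- The number of instructions for a condition, including the conditional jump. -/
def Cond.cost : Cond → ℕ
  | .lt e f => e.cost + f.cost + 1
  | .eq e f => e.cost + f.cost + 1

/-- The number of temporary registers for a condition. -/
def Cond.depth : Cond → ℕ
  | .lt e f => max e.depth (f.depth + 1)
  | .eq e f => max e.depth (f.depth + 1)

/-- Structured programs. -/
inductive Cmd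
  | skip
  | assign (x : Var) (e : Expr)
  | store (a e : Expr)
  | storew (a e : Expr)
  | out (e : Expr)
  | seq (a b : Cmd)
  | ite (c : Cond) (a b : Cmd)
  | loop (c : Cond) (a : Cmd)

infixr:30 " ;; " => Cmd.seq
infix:40 " ::= " => Cmd.assign

/-- The weakest precondition of a loop that makes at most the given number of iterations; `W` is
the weakest precondition of its body. -/
def wpLoop (B len : ℕ) (c : Cond) (W : (St → Prop) → St → Prop) (Q : St → Prop) : ℕ → St → Prop
  | 0, _ => False
  | f + 1, σ => c.Ok B len σ ∧
      (c.Holds σ → W (wpLoop B len c W Q f) (σ.tick (c.cost + 2))) ∧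
      (¬ c.Holds σ → Q (σ.tick (c.cost + 2)))

/-- The weakest precondition for total correctness of a structured program. The clock advances at
least by the number of instructions that the compiled program executes. -/
def wp (B len : ℕ) : Cmd → (St → Prop) → St → Prop
  | .skip, Q, σ => Q σ
  | .assign x e, Q, σ => e.Ok B len σ ∧ Q ((σ.setr x (e.eval σ)).tick (e.cost + 1))
  | .store a e, Q, σ => (a.Ok B len σ ∧ e.Ok B len σ ∧ a.eval σ < len) ∧
      Q ({ σ with mem := Function.update σ.mem (a.eval σ) (e.eval σ) }.tick (a.cost + e.cost + 1))
  | .storew a e, Q, σ => (a.Ok B len σ ∧ e.Ok B len σ ∧ a.eval σ < workSize) ∧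
      Q ({ σ with work := Function.update σ.work (a.eval σ) (e.eval σ) }.tick
        (a.cost + e.cost + 1))
  | .out e, Q, σ => e.Ok B len σ ∧ Q ({ σ with out := σ.out ++ [e.eval σ] }.tick (e.cost + 1))
  | .seq a b, Q, σ => wp B len a (wp B len b Q) σ
  | .ite c a b, Q, σ => c.Ok B len σ ∧
      (c.Holds σ → wp B len a Q (σ.tick (c.cost + 1))) ∧
      (¬ c.Holds σ → wp B len b Q (σ.tick (c.cost + 1)))
  | .loop c a, Q, σ => ∃ f, wpLoop B len c (wp B len a) Q f σ

theorem wpLoop_mono {B len : ℕ} {c : Cond} {W : (St → Prop) → St → Prop}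
    (hW : ∀ {Q Q' : St → Prop}, (∀ σ, Q σ → Q' σ) → ∀ σ, W Q σ → W Q' σ)
    {Q Q' : St → Prop} (hQ : ∀ σ, Q σ → Q' σ) :
    ∀ f σ, wpLoop B len c W Q f σ → wpLoop B len c W Q' f σ
  | 0, _, h => h
  | f + 1, _, h => ⟨h.1, fun hc => hW (wpLoop_mono hW hQ f) _ (h.2.1 hc), fun hc => hQ _ (h.2.2 hc)⟩

theorem wp_mono {B len : ℕ} (c : Cmd) {Q Q' : St → Prop} (hQ : ∀ σ, Q σ → Q' σ) :
    ∀ σ, wp B len c Q σ → wp B len c Q' σ := by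
  induction c generalizing Q Q' with
  | skip => exact hQ
  | assign x e => exact fun σ h => ⟨h.1, hQ _ h.2⟩
  | store a e => exact fun σ h => ⟨h.1, hQ _ h.2⟩
  | storew a e => exact fun σ h => ⟨h.1, hQ _ h.2⟩
  | out e => exact fun σ h => ⟨h.1, hQ _ h.2⟩
  | seq a b iha ihb => exact iha (ihb hQ)
  | ite c a b iha ihb =>
    exact fun σ h => ⟨h.1, fun hc => iha hQ _ (h.2.1 hc), fun hc => ihb hQ _ (h.2.2 hc)⟩
  | loop c a iha =>
    rintro σ ⟨f, h⟩
    exact ⟨f, wpLoop_mono (fun hq => iha hq) hQ f σ h⟩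

/-- The loop rule, with an invariant `I` and a variant `μ`. -/
theorem wp_loop {B len : ℕ} {c : Cond} {a : Cmd} {Q : St → Prop} (I : St → Prop) (μ : St → ℕ)
    (hI : ∀ σ, I σ → c.Ok B len σ ∧
      (c.Holds σ → wp B len a (fun σ' => I σ' ∧ μ σ' < μ σ) (σ.tick (c.cost + 2))) ∧
      (¬ c.Holds σ → Q (σ.tick (c.cost + 2))))
    (σ : St) (hσ : I σ) : wp B len (.loop c a) Q σ := by
  have key : ∀ f σ, I σ → μ σ < f → wpLoop B len c (wp B len a) Q f σ := by
    intro f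
    induction f with
    | zero => intro σ _ h; omega
    | succ f ih =>
      intro σ hσ hf
      obtain ⟨h1, h2, h3⟩ := hI σ hσ
      exact ⟨h1, fun hc => wp_mono a (fun σ' h' => ih σ' h'.1 (by omega)) _ (h2 hc), h3⟩
  exact ⟨_, key _ σ hσ (Nat.lt_succ_self _)⟩

/-! ### Compilation -/

/-- The number of the last register. -/
abbrev lastReg : ℕ := workSize + 64

/-- The register of a variable. -/
def reg (x : Var) : Fin (lastReg + 1) :=
  ⟨workSize + x.idx, by have := x.idx_lt; unfold lastReg; omega⟩

/-- The `t`-th temporary register, for `t < 32`. -/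
def tmp (t : ℕ) : Fin (lastReg + 1) := ⟨workSize + 32 + min t 31, by unfold lastReg; omega⟩

/-- A word of the array in the working memory. -/
def cell (j : ℕ) (h : j < workSize) : Fin (lastReg + 1) := ⟨j, by unfold lastReg; omega⟩

/-- The instruction for an operation. -/
def Op.instr : Op → (d a b : Fin (lastReg + 1)) → Instr lastReg
  | .add => .add
  | .sub => .sub
  | .mul => .mul
  | .shl => .shl
  | .shr => .shr

/-- Code that computes an expression into the `t`-th temporary register. -/
def Expr.code : Expr → ℕ → Program lastReg
  | .lit c, t => [.const (tmp t) c]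
  | .var x, t => [.copy (tmp t) (reg x)]
  | .bin o e f, t => e.code t ++ (f.code (t + 1) ++ [o.instr (tmp t) (tmp t) (tmp (t + 1))])
  | .ld e, t => e.code t ++ [.load (tmp t) (tmp t)]
  | .ldw e, t => e.code t ++ [.loadWork (tmp t) (tmp t)]

/-- Code that jumps to the target if the condition holds. -/
def Cond.code (target : ℕ) : Cond → Program lastReg
  | .lt e f => e.code 0 ++ (f.code 1 ++ [.jlt (tmp 0) (tmp 1) target])
  | .eq e f => e.code 0 ++ (f.code 1 ++ [.jeq (tmp 0) (tmp 1) target])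

/-- The number of instructions of a structured program. -/
def Cmd.size : Cmd → ℕ
  | .skip => 0
  | .assign _ e => e.cost + 1
  | .store a e => a.cost + e.cost + 1
  | .storew a e => a.cost + e.cost + 1
  | .out e => e.cost + 1
  | .seq a b => a.size + b.size
  | .ite c a b => c.cost + b.size + 1 + a.size
  | .loop c a => c.cost + 1 + a.size + 1

/-- The number of temporary registers for a structured program. -/
def Cmd.depth : Cmd → ℕ
  | .skip => 0
  | .assign _ e => e.depth
  | .store a e => max a.depth (e.depth + 1)
  | .storew a e => max a.depth (e.depth + 1)
  | .out e => e.depth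
  | .seq a b => max a.depth b.depth
  | .ite c a b => max c.depth (max a.depth b.depth)
  | .loop c a => max c.depth a.depth

/-- The code of a structured program, to be placed at position `p`. -/
def Cmd.code : Cmd → ℕ → Program lastReg
  | .skip, _ => []
  | .assign x e, _ => e.code 0 ++ [.copy (reg x) (tmp 0)]
  | .store a e, _ => a.code 0 ++ (e.code 1 ++ [.store (tmp 0) (tmp 1)])
  | .storew a e, _ => a.code 0 ++ (e.code 1 ++ [.storeWork (tmp 0) (tmp 1)])
  | .out e, _ => e.code 0 ++ [.output (tmp 0)]
  | .seq a b, p => a.code p ++ b.code (p + a.size)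
  | .ite c a b, p => c.code (p + c.cost + b.size + 1) ++ (b.code (p + c.cost) ++
      ([.jump (p + c.cost + b.size + 1 + a.size)] ++ a.code (p + c.cost + b.size + 1)))
  | .loop c a, p => c.code (p + c.cost + 1) ++ ([.jump (p + c.cost + 1 + a.size + 1)] ++
      (a.code (p + c.cost + 1) ++ [.jump p]))

theorem Expr.length_code (e : Expr) (t : ℕ) : (e.code t).length = e.cost := by
  induction e generalizing t <;> simp_all [Expr.code, Expr.cost]
  omega

theorem Expr.depth_pos (e : Expr) : 0 < e.depth := by
  induction e <;> simp_all [Expr.depth]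

theorem Cond.length_code (c : Cond) (t : ℕ) : (c.code t).length = c.cost := by
  cases c <;> simp [Cond.code, Cond.cost, Expr.length_code] <;> omega

theorem Cmd.length_code (c : Cmd) (p : ℕ) : (c.code p).length = c.size := by
  induction c generalizing p <;>
    simp_all [Cmd.code, Cmd.size, Expr.length_code, Cond.length_code] <;> omega

/-- The program contains the given code at position `p`. -/
def CodeAt (prog : Program lastReg) (p : ℕ) (code : Program lastReg) : Prop :=
  ∀ i < code.length, prog[p + i]? = code[i]?

theorem CodeAt.left {prog : Program lastReg} {p : ℕ} {a b : Program lastReg}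
    (h : CodeAt prog p (a ++ b)) : CodeAt prog p a := fun i hi => by
  rw [h i (by simp; omega), List.getElem?_append_left hi]

theorem CodeAt.right {prog : Program lastReg} {p : ℕ} {a b : Program lastReg}
    (h : CodeAt prog p (a ++ b)) : CodeAt prog (p + a.length) b := fun i hi => by
  rw [Nat.add_assoc, h (a.length + i) (by simp; omega),
    List.getElem?_append_right (Nat.le_add_right _ _), Nat.add_sub_cancel_left]

/-- The configuration of the machine agrees with the state of the structured program. -/
structure Sim {w : ℕ} (len : ℕ) (σ : St) (c : Config lastReg w) : Prop where
  reg : ∀ x, (c.regs (reg x)).toNat = σ.r x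
  work : ∀ j (h : j < workSize), (c.regs (cell j h)).toNat = σ.work j
  length : c.mem.length = len
  mem : ∀ i (h : i < c.mem.length), c.mem[i].toNat = σ.mem i
  out : c.out = σ.out.map (BitVec.ofNat w)

theorem reg_ne_tmp (x : Var) (t : ℕ) : reg x ≠ tmp t := by
  intro h
  have := x.idx_lt
  have h := congrArg Fin.val h
  simp only [reg, tmp] at h
  omega

theorem cell_ne_tmp (j : ℕ) (hj : j < workSize) (t : ℕ) : cell j hj ≠ tmp t := by
  intro h
  have h := congrArg Fin.val h
  simp only [cell, tmp] at h
  omega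

theorem cell_ne_reg (j : ℕ) (hj : j < workSize) (x : Var) : cell j hj ≠ reg x := by
  intro h
  have h := congrArg Fin.val h
  simp only [cell, reg] at h
  omega

theorem tmp_ne_tmp {t t' : ℕ} (h : t < 32) (h' : t' < 32) (hne : t ≠ t') : tmp t ≠ tmp t' := by
  intro h
  have h := congrArg Fin.val h
  simp only [tmp] at h
  omega

theorem reg_injective : Function.Injective reg := by
  intro x y h
  have h := congrArg Fin.val h
  simp only [reg] at h
  exact Var.idx_injective (by omega)

theorem Sim.setTmp {w len : ℕ} {σ : St} {c : Config lastReg w} (h : Sim len σ c) (t : ℕ)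
    (x : BitVec w) : Sim len σ (c.setReg (tmp t) x) where
  reg y := by simpa [Config.setReg, Function.update_of_ne (reg_ne_tmp y t)] using h.reg y
  work j hj := by
    simpa [Config.setReg, Function.update_of_ne (cell_ne_tmp j hj t)] using h.work j hj
  length := h.length
  mem := h.mem
  out := h.out

section Run

variable {w : ℕ} {prog : Program lastReg}

theorem run_add (s t : ℕ) (c : Config lastReg w) :
    prog.run (s + t) c = (prog.run s c).bind (prog.run t) := by
  induction s generalizing c with
  | zero => simp [Program.run]
  | succ s ih =>
    rw [Nat.succ_add]
    simp only [Program.run]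
    cases prog.step c with
    | none => rfl
    | some c' => simp [ih]

/-- The program gets from the first configuration to the second one in `t` steps. -/
def Reach (prog : Program lastReg) (t : ℕ) (c c' : Config lastReg w) : Prop :=
  prog.run t c = some c'

theorem Reach.refl (c : Config lastReg w) : Reach prog 0 c c := rfl

theorem Reach.trans {s t : ℕ} {c c' c'' : Config lastReg w} (h : Reach prog s c c')
    (h' : Reach prog t c' c'') : Reach prog (s + t) c c'' := by
  unfold Reach at *
  rw [run_add, h]
  exact h'

theorem Reach.step {c c' : Config lastReg w} {i : Instr lastReg} {p : ℕ}
    (hc : CodeAt prog p [i]) (hp : c.pc = p) (h : c.exec i = some c') : Reach prog 1 c c' := by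
  have h0 := hc 0 (by simp)
  simp only [Nat.add_zero, List.getElem?_cons_zero] at h0
  simp [Reach, Program.run, Program.step, hp, h0, h]

end Run

theorem toNat_op {w : ℕ} (o : Op) (c : Config lastReg w) (d a b : Fin (lastReg + 1)) {x y : ℕ}
    (ha : (c.regs a).toNat = x) (hb : (c.regs b).toNat = y) (hok : o.Ok (2 ^ w) x y) :
    ∃ v : BitVec w, c.exec (o.instr d a b) = some (c.setReg d v) ∧ v.toNat = o.eval x y := by
  subst ha hb
  cases o <;> refine ⟨_, rfl, ?_⟩ <;> simp only [Op.Ok, Op.eval] at *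
  · rw [BitVec.toNat_add, Nat.mod_eq_of_lt hok]
  · rw [BitVec.toNat_sub_of_le hok]
  · rw [BitVec.toNat_mul, Nat.mod_eq_of_lt hok]
  · rw [BitVec.toNat_shiftLeft, Nat.shiftLeft_eq, Nat.mod_eq_of_lt hok]
  · rw [BitVec.toNat_ushiftRight, Nat.shiftRight_eq_div_pow]

theorem Expr.code_sound {w len : ℕ} {prog : Program lastReg} {σ : St} (e : Expr) :
    ∀ (t p : ℕ) (c : Config lastReg w), t + e.depth ≤ 32 → Sim len σ c → e.Ok (2 ^ w) len σ →
      c.pc = p → CodeAt prog p (e.code t) →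
      ∃ c', Reach prog e.cost c c' ∧ Sim len σ c' ∧ c'.pc = p + e.cost ∧
        (c'.regs (tmp t)).toNat = e.eval σ ∧ ∀ i < t, c'.regs (tmp i) = c.regs (tmp i) := by
  induction e with
  | lit k =>
    intro t p c ht hS hok hp hc
    simp only [Expr.depth] at ht
    refine ⟨_, Reach.step hc hp rfl, hS.setTmp t _, by simp [Config.setReg, hp, Expr.cost], ?_, ?_⟩
    · simp only [Config.setReg, Function.update_self, Expr.eval, BitVec.toNat_ofNat]
      exact Nat.mod_eq_of_lt hok
    · intro i hi
      exact Function.update_of_ne (tmp_ne_tmp (by omega) (by omega) (by omega)) _ _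
  | var x =>
    intro t p c ht hS hok hp hc
    simp only [Expr.depth] at ht
    refine ⟨_, Reach.step hc hp rfl, hS.setTmp t _, by simp [Config.setReg, hp, Expr.cost], ?_, ?_⟩
    · simpa only [Config.setReg, Function.update_self, Expr.eval] using hS.reg x
    · intro i hi
      exact Function.update_of_ne (tmp_ne_tmp (by omega) (by omega) (by omega)) _ _
  | bin o e f ihe ihf =>
    intro t p c ht hS hok hp hc
    simp only [Expr.depth] at ht
    simp only [Expr.Ok] at hok
    simp only [Expr.code] at hc
    obtain ⟨c1, r1, s1, p1, v1, k1⟩ := ihe t p c (by omega) hS hok.1 hp hc.left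
    have hc' := hc.right
    rw [Expr.length_code] at hc'
    obtain ⟨c2, r2, s2, p2, v2, k2⟩ := ihf (t + 1) _ c1 (by omega) s1 hok.2.1 p1 hc'.left
    have hc'' := hc'.right
    rw [Expr.length_code] at hc''
    obtain ⟨v, hv, hv'⟩ := toNat_op o c2 (tmp t) (tmp t) (tmp (t + 1))
      (by rw [k2 t (by omega)]; exact v1) v2 hok.2.2
    refine ⟨_, (r1.trans r2).trans (Reach.step hc'' p2 hv), s2.setTmp t _, ?_, ?_, ?_⟩
    · simp [Config.setReg, p2, Expr.cost]; omega
    · simpa [Config.setReg, Expr.eval] using hv'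
    · intro i hi
      rw [← k1 i hi, ← k2 i (by omega)]
      exact Function.update_of_ne (tmp_ne_tmp (by omega) (by omega) (by omega)) _ _
  | ld e ihe =>
    intro t p c ht hS hok hp hc
    have hpos := e.depth_pos
    simp only [Expr.depth] at ht
    simp only [Expr.Ok] at hok
    simp only [Expr.code] at hc
    obtain ⟨c1, r1, s1, p1, v1, k1⟩ := ihe t p c (by omega) hS hok.1 hp hc.left
    have hc' := hc.right
    rw [Expr.length_code] at hc'
    have hlt : e.eval σ < c1.mem.length := by rw [s1.length]; exact hok.2
    refine ⟨c1.setReg (tmp t) c1.mem[e.eval σ], r1.trans (Reach.step hc' p1 ?_),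
      s1.setTmp t _, ?_, ?_, ?_⟩
    · simp [Config.exec, v1, List.getElem?_eq_getElem hlt]
    · simp [Config.setReg, p1, Expr.cost]; omega
    · simpa [Config.setReg, Expr.eval] using s1.mem _ hlt
    · intro i hi
      rw [← k1 i hi]
      exact Function.update_of_ne (tmp_ne_tmp (by omega) (by omega) (by omega)) _ _
  | ldw e ihe =>
    intro t p c ht hS hok hp hc
    have hpos := e.depth_pos
    simp only [Expr.depth] at ht
    simp only [Expr.Ok] at hok
    simp only [Expr.code] at hc
    obtain ⟨c1, r1, s1, p1, v1, k1⟩ := ihe t p c (by omega) hS hok.1 hp hc.left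
    have hc' := hc.right
    rw [Expr.length_code] at hc'
    refine ⟨c1.setReg (tmp t) (c1.regs (cell (e.eval σ) hok.2)), r1.trans (Reach.step hc' p1 ?_),
      s1.setTmp t _, ?_, ?_, ?_⟩
    · have : e.eval σ < lastReg + 1 := by have := hok.2; unfold lastReg; omega
      simp only [Config.exec, v1, this, dif_pos]
      rfl
    · simp [Config.setReg, p1, Expr.cost]; omega
    · simpa [Config.setReg, Expr.eval] using s1.work _ hok.2
    · intro i hi
      rw [← k1 i hi]
      exact Function.update_of_ne (tmp_ne_tmp (by omega) (by omega) (by omega)) _ _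

/-- The code of a pair of expressions puts their values into the first two temporary registers. -/
theorem Expr.code_sound_two {w len : ℕ} {prog : Program lastReg} {σ : St} (e f : Expr)
    {p : ℕ} {c : Config lastReg w} {rest : Program lastReg}
    (hd : max e.depth (f.depth + 1) ≤ 32) (hS : Sim len σ c) (he : e.Ok (2 ^ w) len σ)
    (hf : f.Ok (2 ^ w) len σ) (hp : c.pc = p)
    (hc : CodeAt prog p (e.code 0 ++ (f.code 1 ++ rest))) :
    ∃ c', Reach prog (e.cost + f.cost) c c' ∧ Sim len σ c' ∧ c'.pc = p + e.cost + f.cost ∧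
      (c'.regs (tmp 0)).toNat = e.eval σ ∧ (c'.regs (tmp 1)).toNat = f.eval σ ∧
      CodeAt prog (p + e.cost + f.cost) rest := by
  obtain ⟨c1, r1, s1, p1, v1, k1⟩ := e.code_sound 0 p c (by omega) hS he hp hc.left
  have hc' := hc.right
  rw [Expr.length_code] at hc'
  obtain ⟨c2, r2, s2, p2, v2, k2⟩ := f.code_sound 1 _ c1 (by omega) s1 hf p1 hc'.left
  have hc'' := hc'.right
  rw [Expr.length_code] at hc''
  exact ⟨c2, r1.trans r2, s2, p2, by rw [k2 0 (by omega)]; exact v1, v2, hc''⟩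

theorem Sim.congr {w len : ℕ} {σ : St} {c : Config lastReg w} (h : Sim len σ c)
    (pc : ℕ) (t : ℕ) : Sim len (σ.tick t) { c with pc := pc } where
  reg := h.reg
  work := h.work
  length := h.length
  mem := h.mem
  out := h.out

open Classical in
theorem Cond.code_sound {w len : ℕ} {prog : Program lastReg} {σ : St} (e : Cond)
    {p target : ℕ} {c : Config lastReg w} (hd : e.depth ≤ 32) (hS : Sim len σ c)
    (hok : e.Ok (2 ^ w) len σ) (hp : c.pc = p) (hc : CodeAt prog p (e.code target)) (t : ℕ) :
    ∃ c', Reach prog e.cost c c' ∧ Sim len (σ.tick t) c' ∧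
      c'.pc = if e.Holds σ then target else p + e.cost := by
  cases e with
  | lt e f =>
    obtain ⟨c1, r1, s1, p1, v1, v2, hc'⟩ := e.code_sound_two f hd hS hok.1 hok.2 hp hc
    refine ⟨_, r1.trans (Reach.step hc' p1 rfl), s1.congr _ t, ?_⟩
    simp only [v1, v2, Cond.Holds, Config.branch, p1, Cond.cost, ← Nat.add_assoc]
  | eq e f =>
    obtain ⟨c1, r1, s1, p1, v1, v2, hc'⟩ := e.code_sound_two f hd hS hok.1 hok.2 hp hc
    refine ⟨_, r1.trans (Reach.step hc' p1 rfl), s1.congr _ t, ?_⟩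
    simp only [Config.branch, ← BitVec.toNat_inj, v1, v2, Cond.Holds, p1, Cond.cost,
      ← Nat.add_assoc]

/-- From a configuration that agrees with `σ`, the machine reaches position `p` in a configuration
that agrees with a state satisfying `Q`, and the clock of that state has advanced far enough. -/
def Sound {w : ℕ} (prog : Program lastReg) (len : ℕ) (σ : St) (c : Config lastReg w) (p : ℕ)
    (Q : St → Prop) : Prop :=
  ∃ t c' σ', Reach prog t c c' ∧ Sim len σ' c' ∧ c'.pc = p ∧ Q σ' ∧ σ.time + t ≤ σ'.time

theorem Sound.trans {w : ℕ} {prog : Program lastReg} {len : ℕ} {σ σ₁ : St}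
    {c c₁ : Config lastReg w} {p t : ℕ} {Q : St → Prop}
    (h : Reach prog t c c₁) (ht : σ.time + t ≤ σ₁.time) (h' : Sound prog len σ₁ c₁ p Q) :
    Sound prog len σ c p Q := by
  obtain ⟨t', c', σ', r', s', p', q', b'⟩ := h'
  exact ⟨_, c', σ', h.trans r', s', p', q', by omega⟩

/-- Compiled structured programs do what their weakest preconditions promise. -/
theorem Cmd.code_sound {w len : ℕ} {prog : Program lastReg} (a : Cmd) :
    ∀ (p : ℕ) (c : Config lastReg w) (σ : St) (Q : St → Prop), a.depth ≤ 32 → Sim len σ c →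
      c.pc = p → CodeAt prog p (a.code p) → wp (2 ^ w) len a Q σ →
      Sound prog len σ c (p + a.size) Q := by
  induction a with
  | skip =>
    intro p c σ Q _ hS hp _ hQ
    exact ⟨0, c, σ, Reach.refl c, hS, by simp [hp, Cmd.size], hQ, le_rfl⟩
  | assign x e =>
    intro p c σ Q hd hS hp hc hQ
    obtain ⟨c1, r1, s1, p1, v1, -⟩ := e.code_sound 0 p c (by simpa [Cmd.depth] using hd) hS hQ.1 hp
      hc.left
    have hc' := hc.right
    rw [Expr.length_code] at hc'
    refine ⟨_, _, _, r1.trans (Reach.step hc' p1 rfl), ?_, ?_, hQ.2, ?_⟩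
    · constructor
      · intro y
        by_cases hy : y = x
        · subst hy; simp [Config.setReg, St.setr, St.tick, v1]
        · have : reg y ≠ reg x := fun h => hy (reg_injective h)
          simp [Config.setReg, St.setr, St.tick, Function.update_of_ne hy,
            Function.update_of_ne this, s1.reg]
      · intro j hj
        simpa [Config.setReg, St.setr, St.tick, Function.update_of_ne (cell_ne_reg j hj x)]
          using s1.work j hj
      · exact s1.length
      · exact s1.mem
      · exact s1.out
    · simp [Config.setReg, p1, Cmd.size]; omega
    · simp [St.setr, St.tick]
  | store a e =>
    intro p c σ Q hd hS hp hc hQ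
    obtain ⟨⟨h1, h2, h3⟩, hQ⟩ := hQ
    obtain ⟨c1, r1, s1, p1, v1, v2, hc'⟩ := a.code_sound_two e hd hS h1 h2 hp hc
    refine ⟨_, { c1 with pc := c1.pc + 1, mem := c1.mem.set (a.eval σ) (c1.regs (tmp 1)) }, _,
      r1.trans (Reach.step hc' p1 ?_), ?_, ?_, hQ, ?_⟩
    · simp [Config.exec, v1, s1.length, h3]
    · refine ⟨s1.reg, s1.work, by simp [s1.length], ?_, s1.out⟩
      intro i hi
      simp only [List.length_set] at hi
      by_cases h : i = a.eval σ
      · subst h; simp [v2, St.tick]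
      · simp [St.tick, Function.update_of_ne h, List.getElem_set_ne (Ne.symm h), s1.mem]
    · simp [p1, Cmd.size]; omega
    · simp [St.tick]
  | storew a e =>
    intro p c σ Q hd hS hp hc hQ
    obtain ⟨⟨h1, h2, h3⟩, hQ⟩ := hQ
    obtain ⟨c1, r1, s1, p1, v1, v2, hc'⟩ := a.code_sound_two e hd hS h1 h2 hp hc
    refine ⟨_, c1.setReg (cell (a.eval σ) h3) (c1.regs (tmp 1)), _,
      r1.trans (Reach.step hc' p1 ?_), ?_, ?_, hQ, ?_⟩
    · have : a.eval σ < lastReg + 1 := by unfold lastReg; omega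
      simp only [Config.exec, v1, this, dif_pos]
      rfl
    · refine ⟨?_, ?_, s1.length, s1.mem, s1.out⟩
      · intro y
        simpa [Config.setReg, St.tick, Function.update_of_ne (cell_ne_reg _ h3 y).symm]
          using s1.reg y
      · intro j hj
        by_cases h : j = a.eval σ
        · subst h; simp [Config.setReg, v2, St.tick]
        · have : cell j hj ≠ cell _ h3 := fun h' => h (by simpa [cell] using h')
          simpa [Config.setReg, St.tick, Function.update_of_ne h, Function.update_of_ne this]
            using s1.work j hj
    · simp [Config.setReg, p1, Cmd.size]; omega
    · simp [St.tick]
  | out e =>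
    intro p c σ Q hd hS hp hc hQ
    obtain ⟨c1, r1, s1, p1, v1, -⟩ := e.code_sound 0 p c (by simpa [Cmd.depth] using hd) hS hQ.1 hp
      hc.left
    have hc' := hc.right
    rw [Expr.length_code] at hc'
    refine ⟨_, _, _, r1.trans (Reach.step hc' p1 rfl), ?_, ?_, hQ.2, ?_⟩
    · refine ⟨s1.reg, s1.work, s1.length, s1.mem, ?_⟩
      simp [St.tick, s1.out, ← v1]
    · simp [p1, Cmd.size]; omega
    · simp [St.tick]
  | seq a b iha ihb =>
    intro p c σ Q hd hS hp hc hQ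
    simp only [Cmd.depth] at hd
    obtain ⟨t1, c1, σ1, r1, s1, p1, q1, b1⟩ := iha p c σ _ (by omega) hS hp hc.left hQ
    have hc' := hc.right
    rw [Cmd.length_code] at hc'
    have := ihb _ c1 σ1 Q (by omega) s1 p1 hc' q1
    rw [Cmd.size, ← Nat.add_assoc]
    exact this.trans r1 b1
  | ite e a b iha ihb =>
    intro p c σ Q hd hS hp hc hQ
    simp only [Cmd.depth] at hd
    obtain ⟨hok, hQ1, hQ2⟩ := hQ
    obtain ⟨c1, r1, s1, p1⟩ := e.code_sound (by omega) hS hok hp hc.left (e.cost + 1)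
    have hc1 := hc.right
    rw [Cond.length_code] at hc1
    have hc2 := hc1.right
    rw [Cmd.length_code] at hc2
    have hc3 := hc2.right
    by_cases h : e.Holds σ
    · rw [if_pos h] at p1
      have := iha _ c1 _ Q (by omega) s1 p1 hc3 (hQ1 h)
      refine Sound.trans (σ₁ := σ.tick (e.cost + 1)) r1 (by simp only [St.tick]; omega) ?_
      convert this using 1
      simp only [Cmd.size]; omega
    · rw [if_neg h] at p1
      obtain ⟨t2, c2, σ2, r2, s2, p2, q2, b2⟩ :=
        ihb _ c1 _ Q (by omega) s1 p1 hc1.left (hQ2 h)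
      refine ⟨_, _, σ2, (r1.trans r2).trans (Reach.step hc2.left p2 rfl), s2.congr _ 0, ?_, q2, ?_⟩
      · simp only [Cmd.size]; omega
      · simp only [St.tick] at b2; omega
  | loop e a iha =>
    intro p c σ Q hd hS hp hc hQ
    simp only [Cmd.depth] at hd
    obtain ⟨f, hQ⟩ := hQ
    have hc1 := hc.right
    rw [Cond.length_code] at hc1
    have hc2 := hc1.right
    simp only [List.length_cons, List.length_nil, Nat.zero_add] at hc2
    have hc3 := hc2.right
    rw [Cmd.length_code] at hc3
    induction f generalizing c σ with
    | zero => exact hQ.elim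
    | succ f ih =>
      obtain ⟨hok, hQ1, hQ2⟩ := hQ
      obtain ⟨c1, r1, s1, p1⟩ := e.code_sound (by omega) hS hok hp hc.left (e.cost + 2)
      by_cases h : e.Holds σ
      · rw [if_pos h] at p1
        obtain ⟨t2, c2, σ2, r2, s2, p2, q2, b2⟩ :=
          iha _ c1 _ _ (by omega) s1 p1 hc2.left (hQ1 h)
        have r3 : Reach prog 1 c2 { c2 with pc := p } := Reach.step hc3 p2 rfl
        have := ih { c2 with pc := p } σ2 (s2.congr p 0) rfl q2
        refine Sound.trans ((r1.trans r2).trans r3) ?_ this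
        simp only [St.tick] at b2; omega
      · rw [if_neg h] at p1
        refine ⟨_, _, _, r1.trans (Reach.step hc1.left p1 rfl), s1.congr _ 0, ?_, hQ2 h, ?_⟩
        · simp only [Cmd.size]; omega
        · simp only [St.tick]; omega

/-! ### The program -/

open InPlaceBFS.Expr InPlaceBFS.Cmd InPlaceBFS.Cond

/-- Write the number `z` into the `l` pairs of cells from `a` on, the most significant bit first:
a pair is swapped if the bit is `1`. -/
def writeBits : Cmd :=
  .c ::= var .l ;;
  loop (lt (lit 0) (var .c)) (
    .c ::= var .c - lit 1 ;;
    .t ::= var .z >>> var .c ;;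
    ite (lt (lit 0) (var .t - (var .t >>> lit 1 <<< lit 1))) (
      .t ::= ld (var .a) ;;
      store (var .a) (ld (var .a + lit 1)) ;;
      store (var .a + lit 1) (var .t)) skip ;;
    .a ::= var .a + lit 2)

/-- Read the number stored in the `l` pairs of cells from `a` on into `p`. -/
def readBits : Cmd :=
  .c ::= var .l ;;
  .p ::= lit 0 ;;
  loop (lt (lit 0) (var .c)) (
    .c ::= var .c - lit 1 ;;
    .p ::= var .p + var .p ;;
    ite (lt (ld (var .a + lit 1)) (ld (var .a))) (.p ::= var .p + lit 1) skip ;;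
    .a ::= var .a + lit 2)

/-- Sort each of the `c` pairs of cells from `a` on. -/
def sortPairs : Cmd :=
  loop (lt (lit 0) (var .c)) (
    .c ::= var .c - lit 1 ;;
    ite (lt (ld (var .a + lit 1)) (ld (var .a))) (
      .t ::= ld (var .a) ;;
      store (var .a) (ld (var .a + lit 1)) ;;
      store (var .a + lit 1) (var .t)) skip ;;
    .a ::= var .a + lit 2)

/-- Choose among the adjacency arrays of four vertices, which start at `p`, `p1`, `p2` and `p3`, one
of length at least `2 ^ (h - 2)`. -/
def chooseArray : Cmd :=
  .t ::= lit 1 <<< (var .h - lit 2) ;;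
  ite (lt (var .p1 - var .p) (var .t))
    (ite (lt (var .p2 - var .p1) (var .t))
      (ite (lt (var .p3 - var .p2) (var .t))
        (.q ::= var .p3)
        (.q ::= var .p2))
      (.q ::= var .p1))
    (.q ::= var .p)

/-- Encode the group of the four vertices `X, …, X + 3`. -/
def encodeGroup : Cmd :=
  .p ::= ld (var .X) ;;
  .p1 ::= ld (var .X + lit 1) ;;
  .p2 ::= ld (var .X + lit 2) ;;
  .p3 ::= ld (var .X + lit 3) ;;
  .e ::= ld (var .X + lit 4) ;;
  ite (lt (var .e - var .p) (lit 1 <<< var .h)) (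
    store (var .X + lit 2) ((var .p1 - var .p) + ((var .p2 - var .p) <<< var .h) +
      ((var .p3 - var .p) <<< (var .h + var .h))) ;;
    store (var .X + lit 3) (lit 0)) (
    chooseArray ;;
    store (var .X + lit 2) (var .q) ;;
    store (var .X + lit 3) (lit 1) ;;
    .a ::= var .q ;;
    .z ::= var .p1 ;;
    writeBits ;;
    .z ::= var .p2 ;;
    writeBits ;;
    .z ::= var .p3 ;;
    writeBits)

/-- Compute into `p` the position of the adjacency array of the vertex `X + i`, for `i ≤ 4` and an
encoded group `X, …, X + 3`. -/
def getStart : Cmd :=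
  ite (eq (var .i) (lit 0)) (.p ::= ld (var .X))
  (ite (eq (var .i) (lit 4)) (.p ::= ld (var .X + lit 4))
  (.t ::= ld (var .X + lit 3) ;;
  ite (eq (var .t - (var .t >>> lit 1 <<< lit 1)) (lit 0)) (
    .t ::= ld (var .X + lit 2) >>> (var .h * (var .i - lit 1)) ;;
    .p ::= ld (var .X) + (var .t - (var .t >>> var .h <<< var .h))) (
    .a ::= ld (var .X + lit 2) + (var .l + var .l) * (var .i - lit 1) ;;
    readBits)))

/-- Undo `encodeGroup`. -/
def decodeGroup : Cmd :=
  .i ::= lit 1 ;; getStart ;; .p1 ::= var .p ;;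
  .i ::= lit 2 ;; getStart ;; .p2 ::= var .p ;;
  .i ::= lit 3 ;; getStart ;; .p3 ::= var .p ;;
  .t ::= ld (var .X + lit 3) ;;
  ite (eq (var .t - (var .t >>> lit 1 <<< lit 1)) (lit 0)) skip (
    .a ::= ld (var .X + lit 2) ;;
    .c ::= var .l + var .l + var .l ;;
    sortPairs) ;;
  store (var .X + lit 1) (var .p1) ;;
  store (var .X + lit 2) (var .p2) ;;
  store (var .X + lit 3) (var .p3)

/-- If the vertex `u` is white, then give it the colour `par`, put its group on the stack `nxt`
unless the group contains other gray vertices, and output `u` and `d`. The cell `g + 3` contains the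
word `encCols`, in which the number of gray vertices has the factor `512`; the word of the working
memory for a vertex outside of groups is `0` if the vertex is white, and otherwise the link of the
stack plus `1`. -/
def discover : Cmd :=
  ite (lt (var .m) (var .u)) (
    .t ::= var .u - var .m - lit 1 ;;
    ite (eq (ldw (var .t)) (lit 0)) (
      storew (var .t) (var .nxt + lit 1) ;;
      .nxt ::= var .u ;;
      out (var .u) ;;
      out (var .d)) skip) (
    .g ::= ((var .u - lit 1) >>> lit 2 <<< lit 2) + lit 1 ;;
    .t ::= (var .u - var .g) + (var .u - var .g) + lit 1 ;;
    .c ::= ld (var .g + lit 3) ;;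
    .a ::= var .c >>> var .t ;;
    ite (eq (var .a - (var .a >>> lit 2 <<< lit 2)) (lit 0)) (
      store (var .g + lit 3) (var .c + lit 512 + (var .par <<< var .t)) ;;
      ite (lt (var .c) (lit 512)) (
        store (var .g + lit 1) (var .nxt) ;;
        .nxt ::= var .g) skip ;;
      out (var .u) ;;
      out (var .d)) skip)

/-- Discover all vertices whose names are stored in the cells from `q` to `e - 1`. -/
def scan : Cmd :=
  loop (lt (var .q) (var .e)) (
    .u ::= ld (var .q) ;;
    discover ;;
    .q ::= var .q + lit 1)

/-- If the vertex `X + j` has the colour `cp`, then discover its neighbours and give it the colour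
`1`, so that the group has one gray vertex less. -/
def processMember : Cmd :=
  .t ::= ld (var .X + lit 3) >>> (var .j + var .j + lit 1) ;;
  ite (eq (var .t - (var .t >>> lit 2 <<< lit 2)) (var .cp)) (
    .i ::= var .j ;;
    getStart ;;
    .q ::= var .p ;;
    .i ::= var .j + lit 1 ;;
    getStart ;;
    .e ::= var .p ;;
    scan ;;
    store (var .X + lit 3) (ld (var .X + lit 3) -
      (lit 512 + ((var .cp - lit 1) <<< (var .j + var .j + lit 1))))) skip

/-- Pop a group from the stack `cur` and process its members of colour `cp`. The group is put on the
stack `nxt` if it still has gray members. -/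
def pop : Cmd :=
  .X ::= var .cur ;;
  ite (lt (var .m) (var .X)) (
    .cur ::= ldw (var .X - var .m - lit 1) - lit 1 ;;
    .q ::= ld (var .X) ;;
    .e ::= ld (var .X + lit 1) ;;
    scan) (
    .cur ::= ld (var .X + lit 1) ;;
    .j ::= lit 0 ;;
    loop (lt (var .j) (lit 4)) (
      processMember ;;
      .j ::= var .j + lit 1) ;;
    ite (lt (ld (var .X + lit 3)) (lit 512)) skip (
      store (var .X + lit 1) (var .nxt) ;;
      .nxt ::= var .X))

/-- Breadth-first search from the vertex `s` in the encoded graph. The vertices at the distance `d`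
that is output have the colour `par`; the colours `2` and `3` alternate. -/
def search : Cmd :=
  .d ::= lit 0 ;;
  .par ::= lit 2 ;;
  .cp ::= lit 3 ;;
  .nxt ::= lit 0 ;;
  .u ::= var .s ;;
  discover ;;
  loop (lt (lit 0) (var .nxt)) (
    .cur ::= var .nxt ;;
    .nxt ::= lit 0 ;;
    .t ::= var .par ;;
    .par ::= var .cp ;;
    .cp ::= var .t ;;
    .d ::= var .d + lit 1 ;;
    loop (lt (lit 0) (var .cur)) pop)

/-- Compute the sizes; `m` is the number of vertices in groups, and `h` is the largest number with
`8 ^ h ≤ N`. The cell `n + 1` receives the end of the last adjacency array. Words may be so short that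
larger literals do not fit into them, hence the repeated shifts by `3`. -/
def setup : Cmd :=
  .s ::= ldw (lit 0) ;;
  storew (lit 0) (lit 0) ;;
  .n ::= ld (lit 0) ;;
  .N ::= var .n + ld (var .n + lit 1) + lit 2 ;;
  store (var .n + lit 1) (var .N) ;;
  .m ::= lit 0 ;;
  ite (lt (lit 0) (var .N >>> lit 3 >>> lit 3 >>> lit 3 >>> lit 3 >>> lit 3 >>> lit 3 >>> lit 3
      >>> lit 3 >>> lit 3 >>> lit 3)) (
    .m ::= var .n >>> lit 2 <<< lit 2 ;;
    .h ::= lit 0 ;;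
    .t ::= var .N >>> lit 3 ;;
    loop (lt (lit 0) (var .t)) (
      .h ::= var .h + lit 1 ;;
      .t ::= var .t >>> lit 3) ;;
    .l ::= var .h + var .h + var .h + lit 3) skip

/-- Apply a program to all groups. -/
def forGroups (body : Cmd) : Cmd :=
  .X ::= lit 1 ;;
  loop (lt (var .X) (var .m)) (
    body ;;
    .X ::= var .X + lit 4)

/-- The complete program without the final `halt`. -/
def main : Cmd :=
  setup ;;
  forGroups encodeGroup ;;
  search ;;
  forGroups decodeGroup ;;
  store (var .n + lit 1) (var .N - var .n - lit 2)

theorem depth_main : main.depth ≤ 32 := by decide +kernel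

/-! ### Words stored in the order of pairs -/

section WpRules

variable {B len : ℕ} {Q : St → Prop} {σ : St}

@[simp] theorem wp_skip : wp B len .skip Q σ ↔ Q σ := Iff.rfl

@[simp] theorem wp_assign {x : Var} {e : Expr} : wp B len (.assign x e) Q σ ↔
    e.Ok B len σ ∧ Q ((σ.setr x (e.eval σ)).tick (e.cost + 1)) := Iff.rfl

@[simp] theorem wp_store {a e : Expr} : wp B len (.store a e) Q σ ↔
    (a.Ok B len σ ∧ e.Ok B len σ ∧ a.eval σ < len) ∧
      Q ({ σ with mem := Function.update σ.mem (a.eval σ) (e.eval σ) }.tick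
        (a.cost + e.cost + 1)) := Iff.rfl

@[simp] theorem wp_storew {a e : Expr} : wp B len (.storew a e) Q σ ↔
    (a.Ok B len σ ∧ e.Ok B len σ ∧ a.eval σ < workSize) ∧
      Q ({ σ with work := Function.update σ.work (a.eval σ) (e.eval σ) }.tick
        (a.cost + e.cost + 1)) := Iff.rfl

@[simp] theorem wp_out {e : Expr} : wp B len (.out e) Q σ ↔
    e.Ok B len σ ∧ Q ({ σ with out := σ.out ++ [e.eval σ] }.tick (e.cost + 1)) := Iff.rfl

@[simp] theorem wp_seq {a b : Cmd} : wp B len (.seq a b) Q σ ↔ wp B len a (wp B len b Q) σ :=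
  Iff.rfl

@[simp] theorem wp_ite {c : Cond} {a b : Cmd} : wp B len (.ite c a b) Q σ ↔ c.Ok B len σ ∧
      (c.Holds σ → wp B len a Q (σ.tick (c.cost + 1))) ∧
      (¬ c.Holds σ → wp B len b Q (σ.tick (c.cost + 1))) := Iff.rfl

attribute [simp] Cond.Holds Cond.Ok Cond.cost St.setr St.tick

@[simp] theorem ok_lit {c : ℕ} : (lit c).Ok B len σ ↔ c < B := Iff.rfl
@[simp] theorem ok_var {x : Var} : (var x).Ok B len σ := trivial
@[simp] theorem ok_ld {e : Expr} : (ld e).Ok B len σ ↔ e.Ok B len σ ∧ e.eval σ < len := Iff.rfl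
@[simp] theorem ok_ldw {e : Expr} :
    (ldw e).Ok B len σ ↔ e.Ok B len σ ∧ e.eval σ < workSize := Iff.rfl
@[simp] theorem ok_add {e f : Expr} : (e + f).Ok B len σ ↔
    e.Ok B len σ ∧ f.Ok B len σ ∧ e.eval σ + f.eval σ < B := Iff.rfl
@[simp] theorem ok_sub {e f : Expr} : (e - f).Ok B len σ ↔
    e.Ok B len σ ∧ f.Ok B len σ ∧ f.eval σ ≤ e.eval σ := Iff.rfl
@[simp] theorem ok_mul {e f : Expr} : (e * f).Ok B len σ ↔
    e.Ok B len σ ∧ f.Ok B len σ ∧ e.eval σ * f.eval σ < B := Iff.rfl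
@[simp] theorem ok_shl {e f : Expr} : (e <<< f).Ok B len σ ↔
    e.Ok B len σ ∧ f.Ok B len σ ∧ e.eval σ * 2 ^ f.eval σ < B := Iff.rfl
@[simp] theorem ok_shr {e f : Expr} : (e >>> f).Ok B len σ ↔
    e.Ok B len σ ∧ f.Ok B len σ := by
  refine ⟨fun h => ⟨h.1, h.2.1⟩, fun h => ⟨h.1, h.2, trivial⟩⟩

@[simp] theorem eval_lit {c : ℕ} : (lit c).eval σ = c := rfl
@[simp] theorem eval_var {x : Var} : (var x).eval σ = σ.r x := rfl
@[simp] theorem eval_ld {e : Expr} : (ld e).eval σ = σ.mem (e.eval σ) := rfl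
@[simp] theorem eval_ldw {e : Expr} : (ldw e).eval σ = σ.work (e.eval σ) := rfl
@[simp] theorem eval_add {e f : Expr} : (e + f).eval σ = e.eval σ + f.eval σ := rfl
@[simp] theorem eval_sub {e f : Expr} : (e - f).eval σ = e.eval σ - f.eval σ := rfl
@[simp] theorem eval_mul {e f : Expr} : (e * f).eval σ = e.eval σ * f.eval σ := rfl
@[simp] theorem eval_shl {e f : Expr} : (e <<< f).eval σ = e.eval σ * 2 ^ f.eval σ := rfl
@[simp] theorem eval_shr {e f : Expr} : (e >>> f).eval σ = e.eval σ / 2 ^ f.eval σ := rfl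

@[simp] theorem cost_lit {c : ℕ} : (lit c).cost = 1 := rfl
@[simp] theorem cost_var {x : Var} : (var x).cost = 1 := rfl
@[simp] theorem cost_ld {e : Expr} : (ld e).cost = e.cost + 1 := rfl
@[simp] theorem cost_ldw {e : Expr} : (ldw e).cost = e.cost + 1 := rfl
@[simp] theorem cost_add {e f : Expr} : (e + f).cost = e.cost + f.cost + 1 := rfl
@[simp] theorem cost_sub {e f : Expr} : (e - f).cost = e.cost + f.cost + 1 := rfl
@[simp] theorem cost_mul {e f : Expr} : (e * f).cost = e.cost + f.cost + 1 := rfl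
@[simp] theorem cost_shl {e f : Expr} : (e <<< f).cost = e.cost + f.cost + 1 := rfl
@[simp] theorem cost_shr {e f : Expr} : (e >>> f).cost = e.cost + f.cost + 1 := rfl

end WpRules

/-- The `cnt` pairs of cells from `a` on of the memory `mem` contain the corresponding pairs of `A`,
and the pairs that have been swapped are the `1`s in the binary representation of `z` with `cnt`
digits. -/
def PairEnc (A mem : ℕ → ℕ) (a cnt z : ℕ) : Prop :=
  ∀ i < cnt, if z / 2 ^ (cnt - 1 - i) % 2 = 1 then
      mem (a + 2 * i) = A (a + 2 * i + 1) ∧ mem (a + 2 * i + 1) = A (a + 2 * i)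
    else mem (a + 2 * i) = A (a + 2 * i) ∧ mem (a + 2 * i + 1) = A (a + 2 * i + 1)

/-- The truncation of a number to a multiple of `2 ^ k` by shifts. -/
theorem sub_div_mul_eq_mod (x k : ℕ) : x - x / 2 ^ k * 2 ^ k = x % 2 ^ k := by
  have := Nat.div_add_mod' x (2 ^ k)
  omega

theorem div_mul_le (x k : ℕ) : x / 2 ^ k * 2 ^ k ≤ x := Nat.div_mul_le_self _ _

/-- As for the other programs below, the specification is stated for an arbitrary postcondition `Q`
that follows from a description of the final state: the variables that may have changed, the new
contents of the memory, and the time. -/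
theorem writeBits_spec {B len : ℕ} {A : ℕ → ℕ} {Q : St → Prop} {σ : St} {a z l : ℕ}
    (hB : 2 < B) (hlen : len < B) (hl : σ.r .l = l) (ha : σ.r .a = a) (hz : σ.r .z = z)
    (hzB : z < B) (hal : a + 2 * l ≤ len)
    (hA : ∀ i, a ≤ i → i < a + 2 * l → σ.mem i = A i)
    (hQ : ∀ σ' : St, (∀ v, v ∉ [Var.c, .t, .a] → σ'.r v = σ.r v) → σ'.r .a = a + 2 * l →
      PairEnc A σ'.mem a l z → (∀ i, i < a ∨ a + 2 * l ≤ i → σ'.mem i = σ.mem i) →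
      σ'.work = σ.work → σ'.out = σ.out → σ'.time ≤ σ.time + 60 * (l + 1) → Q σ') :
    wp B len writeBits Q σ := by
  simp only [writeBits, wp_seq, wp_assign]
  refine ⟨by simp, ?_⟩
  refine wp_loop (fun τ => (∀ v, v ∉ [Var.c, .t, .a] → τ.r v = σ.r v) ∧ τ.r .c ≤ l ∧
      τ.r .a = a + 2 * (l - τ.r .c) ∧
      (∀ i < l - τ.r .c, if z / 2 ^ (l - 1 - i) % 2 = 1 then
        τ.mem (a + 2 * i) = A (a + 2 * i + 1) ∧ τ.mem (a + 2 * i + 1) = A (a + 2 * i)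
      else τ.mem (a + 2 * i) = A (a + 2 * i) ∧ τ.mem (a + 2 * i + 1) = A (a + 2 * i + 1)) ∧
      (∀ i, i < a ∨ a + 2 * (l - τ.r .c) ≤ i → τ.mem i = σ.mem i) ∧
      τ.work = σ.work ∧ τ.out = σ.out ∧ τ.time + 60 * τ.r .c ≤ σ.time + 60 * l + 2)
    (fun τ => τ.r .c) ?_ _ ?_
  · rintro τ ⟨hr, hc, hτa, henc, hmem, hw, ho, ht⟩
    refine ⟨by simp; omega, fun hcond => ?_, fun hcond => ?_⟩
    · obtain ⟨c, hc'⟩ : ∃ c, τ.r .c = c + 1 := ⟨τ.r .c - 1, by simp at hcond; omega⟩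
      have hτz : τ.r .z = z := by rw [hr _ (by decide), hz]
      have hzc : z / 2 ^ c ≤ z := Nat.div_le_self _ _
      have hzm := div_mul_le (z / 2 ^ c) 1
      rw [hc'] at hτa hc ht henc hmem
      have hm1 : τ.mem (a + 2 * (l - (c + 1))) = A (a + 2 * (l - (c + 1))) := by
        rw [hmem _ (by omega), hA _ (by omega) (by omega)]
      have hm2 : τ.mem (a + 2 * (l - (c + 1)) + 1) = A (a + 2 * (l - (c + 1)) + 1) := by
        rw [hmem _ (by omega), hA _ (by omega) (by omega)]
      have hidx : l - 1 - (l - (c + 1)) = c := by omega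
      have hlc : l - c = l - (c + 1) + 1 := by omega
      generalize hI : (fun σ' : St => (_ : Prop)) = I
      generalize hk : l - (c + 1) = k at *
      simp only [pow_one] at hzm
      simp [hc', hτa, hτz]
      refine ⟨by omega, by omega, ?_, ?_⟩
      · intro hbit
        refine ⟨by omega, by omega, by omega, by omega, ?_⟩
        rw [← hI]
        simp [hlc, hc', hw, ho]
        refine ⟨?_, by omega, by omega, ?_, ?_, by omega⟩
        · intro v h1 h2 h3
          simp [h1, h2, h3, hr]
        · intro i hi
          rcases Nat.lt_or_ge i k with h | h
          · have := henc i h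
            simpa [Function.update_apply, show i ≠ k by omega, show 2 * i ≠ 2 * k + 1 by omega,
              show a + 2 * i + 1 ≠ a + 2 * k by omega, show a + 2 * i ≠ a + 2 * k + 1 by omega]
              using this
          · obtain rfl : i = k := by omega
            rw [if_pos (by rw [hidx]; omega)]
            simp [hm1, hm2]
        · intro i hi
          rw [Function.update_of_ne (by omega), Function.update_of_ne (by omega)]
          exact hmem i (by omega)
      · intro hbit
        refine ⟨by omega, ?_⟩
        rw [← hI]
        simp [hlc, hc', hw, ho]
        refine ⟨?_, by omega, by omega, ?_, ?_, by omega⟩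
        · intro v h1 h2 h3
          simp [h1, h2, h3, hr]
        · intro i hi
          rcases Nat.lt_or_ge i k with h | h
          · exact henc i h
          · obtain rfl : i = k := by omega
            rw [if_neg (by rw [hidx]; omega)]
            exact ⟨hm1, hm2⟩
        · intro i hi
          exact hmem i (by omega)
    · simp at hcond
      rw [hcond] at hτa henc hmem ht
      exact hQ _ hr hτa henc hmem hw ho (by simp; omega)
  · simp [hl, ha]
    refine ⟨?_, by omega⟩
    intro v h1 h2 h3
    simp [h1]

theorem readBits_spec {B len : ℕ} {A : ℕ → ℕ} {Q : St → Prop} {σ : St} {a z l : ℕ}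
    (hB : 2 < B) (hlen : len < B) (hl : σ.r .l = l) (ha : σ.r .a = a)
    (hzB : z < B) (hzl : z < 2 ^ l) (hal : a + 2 * l ≤ len)
    (henc : PairEnc A σ.mem a l z)
    (hA : ∀ i < l, A (a + 2 * i) < A (a + 2 * i + 1))
    (hQ : ∀ σ' : St, (∀ v, v ∉ [Var.c, .p, .a] → σ'.r v = σ.r v) → σ'.r .p = z →
      σ'.mem = σ.mem → σ'.work = σ.work → σ'.out = σ.out → σ'.time ≤ σ.time + 60 * (l + 1) → Q σ') :
    wp B len readBits Q σ := by
  simp only [readBits, wp_seq, wp_assign]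
  refine ⟨by simp, by simp; omega, ?_⟩
  refine wp_loop (fun τ => (∀ v, v ∉ [Var.c, .p, .a] → τ.r v = σ.r v) ∧ τ.r .c ≤ l ∧
      τ.r .a = a + 2 * (l - τ.r .c) ∧ τ.r .p = z / 2 ^ (τ.r .c) ∧ τ.mem = σ.mem ∧
      τ.work = σ.work ∧ τ.out = σ.out ∧ τ.time + 60 * τ.r .c ≤ σ.time + 60 * l + 4)
    (fun τ => τ.r .c) ?_ _ ?_
  · rintro τ ⟨hr, hc, hτa, hp, hmem, hw, ho, ht⟩
    refine ⟨by simp; omega, fun hcond => ?_, fun hcond => ?_⟩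
    · obtain ⟨c, hc'⟩ : ∃ c, τ.r .c = c + 1 := ⟨τ.r .c - 1, by simp at hcond; omega⟩
      have hzc : z / 2 ^ c ≤ z := Nat.div_le_self _ _
      rw [hc'] at hτa hc ht hp
      have hdiv : z / 2 ^ (c + 1) = z / 2 ^ c / 2 := by
        rw [pow_succ, Nat.div_div_eq_div_mul]
      have hidx : l - 1 - (l - (c + 1)) = c := by omega
      have hlc : l - c = l - (c + 1) + 1 := by omega
      have hk := henc (l - (c + 1)) (by omega)
      have hlt := hA (l - (c + 1)) (by omega)
      rw [hidx] at hk
      generalize hI : (fun σ' : St => (_ : Prop)) = I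
      generalize l - (c + 1) = k at *
      simp [hc', hτa, hp, hmem, hdiv]
      refine ⟨by omega, by omega, by omega, ?_, ?_⟩
      · intro hbit
        have hz1 : z / 2 ^ c / 2 + z / 2 ^ c / 2 + 1 = z / 2 ^ c := by
          split_ifs at hk <;> omega
        refine ⟨by omega, by omega, ?_⟩
        rw [← hI]
        simp [hlc, hc', hw, ho, hz1]
        refine ⟨?_, by omega, by omega, by omega⟩
        intro v h1 h2 h3
        simp [h1, h2, h3, hr]
      · intro hbit
        have hz1 : z / 2 ^ c / 2 + z / 2 ^ c / 2 = z / 2 ^ c := by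
          split_ifs at hk <;> omega
        refine ⟨by omega, ?_⟩
        rw [← hI]
        simp [hlc, hc', hw, ho, hz1]
        refine ⟨?_, by omega, by omega, by omega⟩
        intro v h1 h2 h3
        simp [h1, h2, h3, hr]
    · simp at hcond
      rw [hcond] at hp ht
      exact hQ _ hr (by simpa using hp) hmem hw ho (by simp; omega)
  · simp [hl, ha, Nat.div_eq_of_lt hzl]
    refine ⟨?_, by omega⟩
    intro v h1 h2 h3
    simp [h1, h2]

theorem sortPairs_spec {B len : ℕ} {A : ℕ → ℕ} {Q : St → Prop} {σ : St} {a l : ℕ}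
    (hB : 2 < B) (hlen : len < B) (hl : σ.r .c = l) (ha : σ.r .a = a)
    (hal : a + 2 * l ≤ len)
    (hmem : ∀ i < l, (σ.mem (a + 2 * i) = A (a + 2 * i) ∧ σ.mem (a + 2 * i + 1) = A (a + 2 * i + 1))
      ∨ (σ.mem (a + 2 * i) = A (a + 2 * i + 1) ∧ σ.mem (a + 2 * i + 1) = A (a + 2 * i)))
    (hA : ∀ i < l, A (a + 2 * i) < A (a + 2 * i + 1))
    (hQ : ∀ σ' : St, (∀ v, v ∉ [Var.c, .t, .a] → σ'.r v = σ.r v) →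
      (∀ i, a ≤ i → i < a + 2 * l → σ'.mem i = A i) →
      (∀ i, i < a ∨ a + 2 * l ≤ i → σ'.mem i = σ.mem i) →
      σ'.work = σ.work → σ'.out = σ.out → σ'.time ≤ σ.time + 60 * (l + 1) → Q σ') :
    wp B len sortPairs Q σ := by
  refine wp_loop (fun τ => (∀ v, v ∉ [Var.c, .t, .a] → τ.r v = σ.r v) ∧ τ.r .c ≤ l ∧
      τ.r .a = a + 2 * (l - τ.r .c) ∧
      (∀ i, a ≤ i → i < a + 2 * (l - τ.r .c) → τ.mem i = A i) ∧
      (∀ i, i < a ∨ a + 2 * (l - τ.r .c) ≤ i → τ.mem i = σ.mem i) ∧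
      τ.work = σ.work ∧ τ.out = σ.out ∧ τ.time + 60 * τ.r .c ≤ σ.time + 60 * l)
    (fun τ => τ.r .c) ?_ _ ?_
  · rintro τ ⟨hr, hc, hτa, hdone, hrest, hw, ho, ht⟩
    refine ⟨by simp; omega, fun hcond => ?_, fun hcond => ?_⟩
    · obtain ⟨c, hc'⟩ : ∃ c, τ.r .c = c + 1 := ⟨τ.r .c - 1, by simp at hcond; omega⟩
      rw [hc'] at hτa hc ht hdone hrest
      have hlc : l - c = l - (c + 1) + 1 := by omega
      have hk := hmem (l - (c + 1)) (by omega)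
      have hlt := hA (l - (c + 1)) (by omega)
      rw [← hrest _ (by omega), ← hrest _ (by omega)] at hk
      generalize hI : (fun σ' : St => (_ : Prop)) = I
      generalize l - (c + 1) = k at *
      simp [hc', hτa]
      refine ⟨by omega, by omega, ?_, ?_⟩
      · intro hbit
        have hk : τ.mem (a + 2 * k) = A (a + 2 * k + 1) ∧
            τ.mem (a + 2 * k + 1) = A (a + 2 * k) := by
          omega
        refine ⟨by omega, by omega, by omega, by omega, ?_⟩
        rw [← hI]
        simp [hlc, hc', hw, ho]
        refine ⟨?_, by omega, by omega, ?_, ?_, by omega⟩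
        · intro v h1 h2 h3
          simp [h1, h2, h3, hr]
        · intro i hi hi'
          simp only [Function.update_apply]
          split_ifs with h1 h2
          · rw [h1, hk.1]
          · rw [h2, hk.2]
          · exact hdone i hi (by omega)
        · intro i hi
          rw [Function.update_of_ne (by omega), Function.update_of_ne (by omega)]
          exact hrest i (by omega)
      · intro hbit
        have hk : τ.mem (a + 2 * k) = A (a + 2 * k) ∧
            τ.mem (a + 2 * k + 1) = A (a + 2 * k + 1) := by
          omega
        refine ⟨by omega, ?_⟩
        rw [← hI]
        simp [hlc, hc', hw, ho]
        refine ⟨?_, by omega, by omega, ?_, ?_, by omega⟩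
        · intro v h1 h2 h3
          simp [h1, h2, h3, hr]
        · intro i hi hi'
          rcases Nat.lt_or_ge i (a + 2 * k) with h | h
          · exact hdone i hi h
          · obtain rfl | rfl : i = a + 2 * k ∨ i = a + 2 * k + 1 := by omega
            · exact hk.1
            · exact hk.2
        · intro i hi
          exact hrest i (by omega)
    · simp at hcond
      rw [hcond] at hτa hdone hrest ht
      exact hQ _ hr hdone hrest hw ho (by simp; omega)
  · simp [hl, ha]
    intro i hi hi'
    omega

/-! ### Groups of vertices -/

/-- A graph with the vertices `1, …, n` in standard representation: `A` is the content of the input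
memory, which has `N` cells, the adjacency array of `v` occupies the cells from `P v` to
`P (v + 1) - 1`, and machine words are numbers below `B`. -/
structure Input where
  (n N B : ℕ)
  (A P : ℕ → ℕ)
  n_pos : 1 ≤ n
  N_lt : N < B
  head : A 0 = n
  table : ∀ v, 1 ≤ v → v ≤ n → A v = P v
  total : A (n + 1) + (n + 2) = N
  first : P 1 = n + 2
  last : P (n + 1) = N
  mono : ∀ v, 1 ≤ v → v ≤ n → P v ≤ P (v + 1)
  asc : ∀ v i, 1 ≤ v → v ≤ n → P v ≤ i → i + 1 < P (v + 1) → A i < A (i + 1)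
  range : ∀ i, n + 2 ≤ i → i < N → 1 ≤ A i ∧ A i ≤ n

/-- The graph with the vertices `1, …, n`. -/
def Input.graph (I : Input) : Digraph ℕ where
  Adj v u := (1 ≤ v ∧ v ≤ I.n) ∧ ∃ i, I.P v ≤ i ∧ i < I.P (v + 1) ∧ I.A i = u

/-- A graph together with the parameters of the program: the first `m` vertices are in groups, and
`h` is the width of a bit field of a group. -/
structure Ctx extends Input where
  (m h : ℕ)
  m_mod : m % 4 = 0
  m_le : m ≤ n
  n_lt : n < m + workSize
  large : 0 < m → 2 ^ (3 * h) ≤ N ∧ N < 2 ^ (3 * h + 3) ∧ 10 ≤ h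

namespace Ctx

variable (K : Ctx)

/-- The number of bits of a number that is at most `N`. -/
def l : ℕ := 3 * K.h + 3

/-- The total length of the adjacency arrays of a group. -/
def L (X : ℕ) : ℕ := K.P (X + 4) - K.P X

/-- The number `1` if the group is encoded with the help of a long adjacency array, and `0` if its
adjacency arrays are so short that the pointers to them fit into one word. -/
def slow (X : ℕ) : ℕ := if K.L X < 2 ^ K.h then 0 else 1

theorem P_le {u v : ℕ} (hu : 1 ≤ u) (huv : u ≤ v) (hv : v ≤ K.n + 1) : K.P u ≤ K.P v := by
  induction v, huv using Nat.le_induction with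
  | base => exact le_rfl
  | succ v h ih => exact (ih (by omega)).trans (K.mono v (by omega) (by omega))

theorem le_P {v : ℕ} (h1 : 1 ≤ v) (h2 : v ≤ K.n + 1) : K.n + 2 ≤ K.P v := by
  have := K.P_le le_rfl h1 h2
  rwa [K.first] at this

theorem P_le_N {v : ℕ} (h1 : 1 ≤ v) (h2 : v ≤ K.n + 1) : K.P v ≤ K.N := by
  have := K.P_le h1 h2 le_rfl
  rwa [K.last] at this

theorem asc_pairs {v a c : ℕ} (h1 : 1 ≤ v) (h2 : v ≤ K.n) (ha : K.P v ≤ a)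
    (hc : a + 2 * c ≤ K.P (v + 1)) : ∀ i < c, K.A (a + 2 * i) < K.A (a + 2 * i + 1) :=
  fun i hi => K.asc v _ h1 h2 (by omega) (by omega)

/-- An array of length `2 ^ (h - 2)` has enough pairs of entries for three pointers. -/
theorem six_l_le (hm : 0 < K.m) : 6 * K.l ≤ 2 ^ (K.h - 2) := by
  obtain ⟨-, -, h⟩ := K.large hm
  unfold l
  generalize K.h = k at *
  induction k, h using Nat.le_induction with
  | base => norm_num
  | succ k hk ih =>
    rw [show k + 1 - 2 = k - 2 + 1 by omega, pow_succ]
    omega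

theorem four_mul_pow (hm : 0 < K.m) : 2 ^ K.h = 4 * 2 ^ (K.h - 2) := by
  obtain ⟨-, -, h⟩ := K.large hm
  obtain ⟨k, hk⟩ := Nat.exists_eq_add_of_le h
  rw [hk, show 10 + k = 8 + k + 2 by omega, pow_add]
  simp [mul_comm]

theorem pow_le (hm : 0 < K.m) : 2 ^ K.h * (2 ^ K.h * 2 ^ K.h) ≤ K.N := by
  obtain ⟨h, -, -⟩ := K.large hm
  refine le_trans (le_of_eq ?_) h
  rw [← pow_add, ← pow_add]
  congr 1
  omega

theorem le_pow (hm : 0 < K.m) : 1024 ≤ 2 ^ K.h := by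
  obtain ⟨-, -, h⟩ := K.large hm
  calc 1024 = 2 ^ 10 := by norm_num
    _ ≤ 2 ^ K.h := Nat.pow_le_pow_right (by norm_num) h

theorem big_N (hm : 0 < K.m) : 1024 * K.h < K.N ∧ 1048576 ≤ K.N := by
  have h1 := K.pow_le hm
  have h2 := K.le_pow hm
  have h3 : K.h < 2 ^ K.h := Nat.lt_two_pow_self
  have h4 : 1024 * 1024 ≤ 2 ^ K.h * 2 ^ K.h := Nat.mul_le_mul h2 h2
  refine ⟨?_, by nlinarith⟩
  nlinarith

theorem pow_lt (hm : 0 < K.m) : 2 ^ K.h < K.B := by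
  have h1 := K.pow_le hm
  have h2 := K.le_pow hm
  have h3 := K.N_lt
  have h4 : 1 ≤ 2 ^ K.h * 2 ^ K.h := Nat.mul_pos (by omega) (by omega)
  nlinarith

theorem fields_lt (hm : 0 < K.m) {x y z : ℕ} (hx : x < 2 ^ K.h) (hy : y < 2 ^ K.h)
    (hz : z < 2 ^ K.h) : x + y * 2 ^ K.h + z * 2 ^ (K.h + K.h) < K.B := by
  refine lt_of_lt_of_le ?_ ((K.pow_le hm).trans K.N_lt.le)
  rw [pow_add]
  generalize 2 ^ K.h = b at *
  have h1 : (y + 1) * b ≤ b * b := Nat.mul_le_mul_right _ hy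
  have h2 : (z + 1) * (b * b) ≤ b * (b * b) := Nat.mul_le_mul_right _ hz
  rw [add_mul] at h1 h2
  omega

/-- The static part of the encoding of the group `X, …, X + 3`. In a fast group, the pointers to the
last three adjacency arrays are bit fields of the cell `X + 2`; in a slow group, this cell points to
an adjacency array in whose order they are stored. -/
structure GroupEnc (mem : ℕ → ℕ) (X : ℕ) : Prop where
  base : mem X = K.P X
  fast : K.L X < 2 ^ K.h → mem (X + 2) = (K.P (X + 1) - K.P X) + (K.P (X + 2) - K.P X) * 2 ^ K.h +
      (K.P (X + 3) - K.P X) * 2 ^ (K.h + K.h) ∧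
    ∀ i, K.P X ≤ i → i < K.P (X + 4) → mem i = K.A i
  slow : ¬ K.L X < 2 ^ K.h → ∃ k < 4, mem (X + 2) = K.P (X + k) ∧
    K.P (X + k) + 6 * K.l ≤ K.P (X + k + 1) ∧
    PairEnc K.A mem (K.P (X + k)) K.l (K.P (X + 1)) ∧
    PairEnc K.A mem (K.P (X + k) + 2 * K.l) K.l (K.P (X + 2)) ∧
    PairEnc K.A mem (K.P (X + k) + 4 * K.l) K.l (K.P (X + 3)) ∧
    ∀ i, K.P X ≤ i → i < K.P (X + 4) → i < K.P (X + k) ∨ K.P (X + k) + 6 * K.l ≤ i →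
      mem i = K.A i

end Ctx

theorem PairEnc.congr {A mem mem' : ℕ → ℕ} {a cnt z : ℕ} (h : PairEnc A mem a cnt z)
    (hm : ∀ i, a ≤ i → i < a + 2 * cnt → mem' i = mem i) : PairEnc A mem' a cnt z := by
  intro i hi
  rw [hm _ (by omega) (by omega), hm _ (by omega) (by omega)]
  exact h i hi

/-- A group is one of the quadruples of consecutive vertices into which `1, …, m` is divided. -/
def Ctx.IsGroup (K : Ctx) (X : ℕ) : Prop := X % 4 = 1 ∧ X < K.m

/-- One of four arrays of total length at least `2 ^ h` has length at least `2 ^ (h - 2)`. -/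
theorem chooseArray_spec (K : Ctx) {X : ℕ} (hX : K.IsGroup X) {Q : St → Prop} {σ : St}
    (hh : σ.r .h = K.h) (hp : σ.r .p = K.P X) (hp1 : σ.r .p1 = K.P (X + 1))
    (hp2 : σ.r .p2 = K.P (X + 2)) (hp3 : σ.r .p3 = K.P (X + 3))
    (hL : ¬ K.L X < 2 ^ K.h)
    (hQ : ∀ σ' : St, (∀ v, v ∉ [Var.t, .q] → σ'.r v = σ.r v) →
      (∃ k < 4, σ'.r .q = K.P (X + k) ∧ K.P (X + k) + 6 * K.l ≤ K.P (X + k + 1)) →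
      σ'.mem = σ.mem → σ'.work = σ.work → σ'.out = σ.out → σ'.time ≤ σ.time + 60 → Q σ') :
    wp K.B K.N chooseArray Q σ := by
  obtain ⟨hX1, hX2⟩ := hX
  have hm : 0 < K.m := by omega
  have hm4 := K.m_mod
  have hmn := K.m_le
  have h6 := K.six_l_le hm
  have h4 := K.four_mul_pow hm
  have hN := K.big_N hm
  have hNB := K.N_lt
  have hp0 := K.pow_le hm
  have hh10 := (K.large hm).2.2
  have q0 := K.mono X (by omega) (by omega)
  have q1 := K.mono (X + 1) (by omega) (by omega)
  have q2 := K.mono (X + 2) (by omega) (by omega)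
  have q3 := K.mono (X + 3) (by omega) (by omega)
  have hle : 2 ^ (K.h - 2) < K.B := by
    have := K.le_pow hm
    nlinarith
  unfold Ctx.L at hL
  simp only [add_assoc, Nat.reduceAdd] at q1 q2 q3 hL
  simp [chooseArray, hh, hp, hp1, hp2, hp3]
  refine ⟨by omega, by omega, fun c1 => ⟨by omega, fun c2 => ⟨by omega, fun c3 => ?_, fun c3 => ?_⟩,
    fun c2 => ?_⟩, fun c1 => ?_⟩
  · refine hQ _ (by intro v hv; simp at hv; simp [hv]) ⟨3, ?_⟩ rfl rfl rfl (by simp)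
    simp [add_assoc]; omega
  · refine hQ _ (by intro v hv; simp at hv; simp [hv]) ⟨2, ?_⟩ rfl rfl rfl (by simp)
    simp [add_assoc]; omega
  · refine hQ _ (by intro v hv; simp at hv; simp [hv]) ⟨1, ?_⟩ rfl rfl rfl (by simp)
    simp [add_assoc]; omega
  · refine hQ _ (by intro v hv; simp at hv; simp [hv]) ⟨0, ?_⟩ rfl rfl rfl (by simp)
    simp; omega

theorem encodeGroup_spec (K : Ctx) {X : ℕ} (hX : K.IsGroup X) {Q : St → Prop} {σ : St}
    (hX' : σ.r .X = X) (hh : σ.r .h = K.h) (hl : σ.r .l = K.l)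
    (hT : ∀ i ≤ 4, σ.mem (X + i) = K.P (X + i))
    (hA : ∀ i, K.P X ≤ i → i < K.P (X + 4) → σ.mem i = K.A i)
    (hQ : ∀ σ' : St, (∀ v, v ∉ [Var.p, .p1, .p2, .p3, .e, .t, .q, .a, .z, .c] → σ'.r v = σ.r v) →
      K.GroupEnc σ'.mem X → σ'.mem (X + 3) = K.slow X →
      (∀ i, i ≠ X + 2 → i ≠ X + 3 → (i < K.P X ∨ K.P (X + 4) ≤ i) → σ'.mem i = σ.mem i) →
      σ'.work = σ.work → σ'.out = σ.out → σ'.time ≤ σ.time + 1000 * (1 + K.L X) → Q σ') :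
    wp K.B K.N encodeGroup Q σ := by
  have hXg := hX
  obtain ⟨hX1, hX2⟩ := hX
  have hm : 0 < K.m := by omega
  have hm4 := K.m_mod
  have hmn := K.m_le
  have hN := K.big_N hm
  have hNB := K.N_lt
  have hp0 := K.pow_le hm
  have hp10 := K.le_pow hm
  have q0 := K.mono X (by omega) (by omega)
  have q1 := K.mono (X + 1) (by omega) (by omega)
  have q2 := K.mono (X + 2) (by omega) (by omega)
  have q3 := K.mono (X + 3) (by omega) (by omega)
  have q4 := K.P_le_N (v := X + 4) (by omega) (by omega)
  have q5 := K.le_P (v := X) (by omega) (by omega)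
  have t0 := hT 0 (by omega)
  have t1 := hT 1 (by omega)
  have t2 := hT 2 (by omega)
  have t3 := hT 3 (by omega)
  have t4 := hT 4 (by omega)
  have hLd : K.L X = K.P (X + 4) - K.P X := rfl
  simp only [add_assoc, Nat.reduceAdd, add_zero] at q1 q2 q3 t0
  have hpB := K.pow_lt hm
  simp [encodeGroup, hX', hh, t0, t1, t2, t3, t4]
  refine ⟨by omega, by omega, by omega, by omega, by omega, by omega, fun hL => ?_, fun hL => ?_⟩
  · have f1 := K.fields_lt hm (x := K.P (X + 1) - K.P X) (y := K.P (X + 2) - K.P X)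
      (z := K.P (X + 3) - K.P X) (by omega) (by omega) (by omega)
    repeat refine And.intro (by omega) ?_
    refine hQ _ ?_ ?_ ?_ ?_ ?_ ?_ ?_
    · intro v hv; simp at hv; simp [hv]
    · refine ⟨by simp [t0], fun _ => ⟨by simp, fun i hi hi' => ?_⟩,
        fun h => absurd (by rw [hLd]; exact hL) h⟩
      simp only []
      rw [Function.update_of_ne (by omega), Function.update_of_ne (by omega)]
      exact hA i hi hi'
    · simp [Ctx.slow, hLd, hL]
    · intro i h1 h2 h3
      simp [h1, h2]
    · rfl
    · rfl
    · simp; omega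
  · have h6 := K.six_l_le hm
    have h4 := K.four_mul_pow hm
    apply chooseArray_spec K hXg <;> simp [hh, Ctx.L, hL]
    intro σ1 r1 k hk hq1 hk1 m1 w1 o1 ti1
    have b0 := K.P_le (u := X) (v := X + k) (by omega) (by omega) (by omega)
    have b1 := K.P_le (u := X + k + 1) (v := X + 4) (by omega) (by omega) (by omega)
    have b2 := K.le_P (v := X + k) (by omega) (by omega)
    simp [r1, hX', hq1]
    repeat refine And.intro (by omega) ?_
    apply writeBits_spec (A := K.A) (a := K.P (X + k)) (l := K.l) (z := K.P (X + 1)) <;>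
      (try simp [r1, hl, m1]) <;> try omega
    · intro i hi hi'
      rw [Function.update_of_ne (by omega), Function.update_of_ne (by omega)]
      exact hA i (by omega) (by omega)
    intro σ2 r2 a2 e2 m2 w2 o2 ti2
    apply writeBits_spec (A := K.A) (a := K.P (X + k) + 2 * K.l) (l := K.l) (z := K.P (X + 2)) <;>
      (try simp [r2, r1, a2, hl]) <;> try omega
    · intro i hi hi'
      rw [m2 i (by omega), Function.update_of_ne (by omega), Function.update_of_ne (by omega)]
      exact hA i (by omega) (by omega)
    intro σ3 r3 a3 e3 m3 w3 o3 ti3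
    apply writeBits_spec (A := K.A) (a := K.P (X + k) + 2 * K.l + 2 * K.l) (l := K.l)
      (z := K.P (X + 3)) <;> (try simp [r3, r2, r1, a3, hl]) <;> try omega
    · intro i hi hi'
      rw [m3 i (by omega), m2 i (by omega), Function.update_of_ne (by omega),
        Function.update_of_ne (by omega)]
      exact hA i (by omega) (by omega)
    intro σ4 r4 a4 e4 m4 w4 o4 ti4
    have hout : ∀ i, i < K.P (X + k) ∨ K.P (X + k) + 6 * K.l ≤ i →
        σ4.mem i = Function.update (Function.update σ.mem (X + 2) (K.P (X + k))) (X + 3) 1 i := by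
      intro i hi
      rw [m4 i (by omega), m3 i (by omega), m2 i (by omega)]
    refine hQ _ ?_ ?_ ?_ ?_ ?_ ?_ ?_
    · intro v hv
      simp at hv
      simp [r4, r3, r2, r1, hv]
    · refine ⟨?_, fun h => absurd h (by rw [hLd]; omega), fun _ => ⟨k, hk, ?_, hk1, ?_, ?_, ?_, ?_⟩⟩
      · rw [hout _ (by omega)]
        simp [t0]
      · rw [hout _ (by omega)]
        simp
      · exact e2.congr fun i hi hi' => by rw [m4 i (by omega), m3 i (by omega)]
      · exact e3.congr fun i hi hi' => by rw [m4 i (by omega)]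
      · rwa [show K.P (X + k) + 4 * K.l = K.P (X + k) + 2 * K.l + 2 * K.l by omega]
      · intro i hi hi' h
        rw [hout i h, Function.update_of_ne (by omega), Function.update_of_ne (by omega)]
        exact hA i hi hi'
    · rw [hout _ (by omega)]
      simp [Ctx.slow, hLd, hL]
    · intro i h1 h2 h3
      rw [hout i (by omega)]
      simp [h1, h2]
    · rw [w4, w3, w2, w1]
    · rw [o4, o3, o2, o1]
    · rw [hLd]; omega

theorem field_extract {b x y z : ℕ} (hx : x < b) (hy : y < b) (hz : z < b) :
    (x + y * b + z * (b * b)) % b = x ∧ (x + y * b + z * (b * b)) / b % b = y ∧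
      (x + y * b + z * (b * b)) / (b * b) % b = z := by
  have hb : 0 < b := by omega
  have h1 : x + y * b + z * (b * b) = x + b * (y + b * z) := by ring
  have h2 : (x + y * b + z * (b * b)) / b = y + b * z := by
    rw [h1, Nat.add_mul_div_left _ _ hb, Nat.div_eq_of_lt hx, Nat.zero_add]
  refine ⟨?_, ?_, ?_⟩
  · rw [h1, Nat.add_mul_mod_self_left, Nat.mod_eq_of_lt hx]
  · rw [h2, Nat.add_mul_mod_self_left, Nat.mod_eq_of_lt hy]
  · rw [← Nat.div_div_eq_div_mul, h2, Nat.add_mul_div_left _ _ hb, Nat.div_eq_of_lt hy,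
      Nat.zero_add, Nat.mod_eq_of_lt hz]

theorem getStart_spec (K : Ctx) {X i : ℕ} (hX : K.IsGroup X) {Q : St → Prop} {σ : St}
    (hX' : σ.r .X = X) (hi : σ.r .i = i) (hh : σ.r .h = K.h) (hl : σ.r .l = K.l) (hi4 : i ≤ 4)
    (henc : K.GroupEnc σ.mem X) (hs : σ.mem (X + 3) % 2 = K.slow X)
    (hsB : σ.mem (X + 3) < K.B) (hnext : σ.mem (X + 4) = K.P (X + 4))
    (hQ : ∀ σ' : St, (∀ v, v ∉ [Var.p, .t, .a, .c] → σ'.r v = σ.r v) → σ'.r .p = K.P (X + i) →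
      σ'.mem = σ.mem → σ'.work = σ.work → σ'.out = σ.out →
      σ'.time ≤ σ.time + 200 * (1 + K.L X) → Q σ') :
    wp K.B K.N getStart Q σ := by
  have hXg := hX
  obtain ⟨hX1, hX2⟩ := hX
  have hm : 0 < K.m := by omega
  have hm4 := K.m_mod
  have hmn := K.m_le
  have hN := K.big_N hm
  have hNB := K.N_lt
  have hpB := K.pow_lt hm
  have hp10 := K.le_pow hm
  have q0 := K.mono X (by omega) (by omega)
  have q1 := K.mono (X + 1) (by omega) (by omega)
  have q2 := K.mono (X + 2) (by omega) (by omega)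
  have q3 := K.mono (X + 3) (by omega) (by omega)
  have q4 := K.P_le_N (v := X + 4) (by omega) (by omega)
  have q5 := K.le_P (v := X) (by omega) (by omega)
  have hLd : K.L X = K.P (X + 4) - K.P X := rfl
  simp only [add_assoc, Nat.reduceAdd] at q1 q2 q3
  simp [getStart, hX', hi, hh, hl, henc.base, hnext]
  refine ⟨by omega, ?_, ?_⟩
  · rintro rfl
    refine ⟨by omega, hQ _ ?_ ?_ rfl rfl rfl (by simp; omega)⟩
    · intro v hv; simp at hv; simp [hv]
    · simp
  intro hi0
  refine ⟨by omega, ?_, ?_⟩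
  · rintro rfl
    refine ⟨by omega, hQ _ ?_ ?_ rfl rfl rfl (by simp; omega)⟩
    · intro v hv; simp at hv; simp [hv]
    · simp
  intro hi4'
  have hmod := sub_div_mul_eq_mod (σ.mem (X + 3)) 1
  have hle := div_mul_le (σ.mem (X + 3)) 1
  simp only [pow_one] at hmod hle
  refine ⟨by omega, by omega, fun hfast => ?_, fun hslow => ?_⟩
  · have hf : K.L X < 2 ^ K.h := by
      by_contra h
      simp only [Ctx.slow, h, if_false] at hs
      omega
    have hb : 2 ^ (K.h + K.h) = 2 ^ K.h * 2 ^ K.h := pow_add _ _ _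
    obtain ⟨e1, e2, e3⟩ := field_extract (b := 2 ^ K.h) (x := K.P (X + 1) - K.P X)
      (y := K.P (X + 2) - K.P X) (z := K.P (X + 3) - K.P X) (by omega) (by omega) (by omega)
    rw [← hb, ← (henc.fast hf).1] at e1 e2 e3
    have key : σ.mem (X + 2) / 2 ^ (K.h * (i - 1)) % 2 ^ K.h = K.P (X + i) - K.P X := by
      obtain rfl | rfl | rfl : i = 1 ∨ i = 2 ∨ i = 3 := by omega
      · simpa using e1
      · simpa using e2
      · simpa [mul_two] using e3
    have hle := div_mul_le (σ.mem (X + 2) / 2 ^ (K.h * (i - 1))) K.h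
    have hlt : σ.mem (X + 2) / 2 ^ (K.h * (i - 1)) ≤ σ.mem (X + 2) := Nat.div_le_self _ _
    have hfl := K.fields_lt hm (x := K.P (X + 1) - K.P X) (y := K.P (X + 2) - K.P X)
      (z := K.P (X + 3) - K.P X) (by omega) (by omega) (by omega)
    rw [← (henc.fast hf).1] at hfl
    have hPi : K.P X ≤ K.P (X + i) ∧ K.P (X + i) ≤ K.N :=
      ⟨K.P_le (by omega) (by omega) (by omega), K.P_le_N (by omega) (by omega)⟩
    have hmi : K.h * (i - 1) < K.B := by
      have : K.h * (i - 1) ≤ K.h * 3 := Nat.mul_le_mul_left _ (by omega)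
      omega
    rw [sub_div_mul_eq_mod, key]
    repeat refine And.intro (by omega) ?_
    refine hQ _ ?_ ?_ rfl rfl rfl (by simp; omega)
    · intro v hv; simp at hv; simp [hv]
    · simp; omega
  · have hf : ¬ K.L X < 2 ^ K.h := by
      intro h
      simp only [Ctx.slow, h, if_true] at hs
      omega
    obtain ⟨k, hk, ha, hlen, p1, p2, p3, -⟩ := henc.slow hf
    have b0 := K.P_le (u := X) (v := X + k) (by omega) (by omega) (by omega)
    have b1 := K.P_le (u := X + k + 1) (v := X + 4) (by omega) (by omega) (by omega)
    have hPi : K.P (X + i) ≤ K.N := K.P_le_N (by omega) (by omega)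
    have hasc := K.asc_pairs (v := X + k) (a := K.P (X + k)) (c := 3 * K.l) (by omega) (by omega)
      le_rfl (by omega)
    have hpe : PairEnc K.A σ.mem (K.P (X + k) + (K.l + K.l) * (i - 1)) K.l (K.P (X + i)) := by
      obtain rfl | rfl | rfl : i = 1 ∨ i = 2 ∨ i = 3 := by omega
      · simpa using p1
      · simpa [← two_mul] using p2
      · convert p3 using 1
        omega
    have hml : (K.l + K.l) * (i - 1) + 2 * K.l ≤ 6 * K.l := by
      obtain rfl | rfl | rfl : i = 1 ∨ i = 2 ∨ i = 3 := by omega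
      all_goals omega
    have hlB : K.P (X + i) < 2 ^ K.l := by
      have := (K.large hm).2.1
      unfold Ctx.l
      omega
    have hdbl : (K.l + K.l) * (i - 1) = 2 * (K.l * (i - 1)) := by ring
    rw [ha]
    repeat refine And.intro (by omega) ?_
    apply readBits_spec (A := K.A) (a := K.P (X + k) + (K.l + K.l) * (i - 1)) (l := K.l)
      (z := K.P (X + i)) <;> (try simp [hl]) <;> try omega
    · intro j hj
      obtain ⟨c, hc, hc'⟩ : ∃ c, (K.l + K.l) * (i - 1) = 2 * c ∧ c + K.l ≤ 3 * K.l :=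
        ⟨K.l * (i - 1), hdbl, by omega⟩
      have := hasc (c + j) (by omega)
      rwa [hc, show K.P (X + k) + 2 * c + 2 * j = K.P (X + k) + 2 * (c + j) by ring]
    · intro σ1 r1 hp m1 w1 o1 t1
      refine hQ _ ?_ hp m1 w1 o1 (by omega)
      intro v hv; simp at hv; simp [r1, hv]

theorem PairEnc.pairs {A mem : ℕ → ℕ} {a cnt z : ℕ} (h : PairEnc A mem a cnt z) :
    ∀ i < cnt, (mem (a + 2 * i) = A (a + 2 * i) ∧ mem (a + 2 * i + 1) = A (a + 2 * i + 1)) ∨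
      (mem (a + 2 * i) = A (a + 2 * i + 1) ∧ mem (a + 2 * i + 1) = A (a + 2 * i)) := by
  intro i hi
  have := h i hi
  split_ifs at this
  · exact Or.inr this
  · exact Or.inl this

/-- Three consecutive words stored in the order of pairs only swap the members of pairs. -/
theorem pairs_of_three {A mem : ℕ → ℕ} {a l z z' z'' : ℕ} (h : PairEnc A mem a l z)
    (h' : PairEnc A mem (a + 2 * l) l z') (h'' : PairEnc A mem (a + 4 * l) l z'') :
    ∀ i < 3 * l, (mem (a + 2 * i) = A (a + 2 * i) ∧ mem (a + 2 * i + 1) = A (a + 2 * i + 1)) ∨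
      (mem (a + 2 * i) = A (a + 2 * i + 1) ∧ mem (a + 2 * i + 1) = A (a + 2 * i)) := by
  intro i hi
  rcases Nat.lt_or_ge i l with h1 | h1
  · exact h.pairs i h1
  rcases Nat.lt_or_ge i (2 * l) with h2 | h2
  · have := h'.pairs (i - l) (by omega)
    rwa [show a + 2 * l + 2 * (i - l) = a + 2 * i by omega] at this
  · have := h''.pairs (i - 2 * l) (by omega)
    rwa [show a + 4 * l + 2 * (i - 2 * l) = a + 2 * i by omega] at this

theorem decodeGroup_spec (K : Ctx) {X : ℕ} (hX : K.IsGroup X) {Q : St → Prop} {σ : St}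
    (hX' : σ.r .X = X) (hh : σ.r .h = K.h) (hl : σ.r .l = K.l)
    (henc : K.GroupEnc σ.mem X) (hs : σ.mem (X + 3) % 2 = K.slow X)
    (hsB : σ.mem (X + 3) < K.B) (hnext : σ.mem (X + 4) = K.P (X + 4))
    (hQ : ∀ σ' : St, (∀ v, v ∉ [Var.i, .p, .p1, .p2, .p3, .t, .a, .c] → σ'.r v = σ.r v) →
      (∀ i < 4, σ'.mem (X + i) = K.P (X + i)) →
      (∀ i, K.P X ≤ i → i < K.P (X + 4) → σ'.mem i = K.A i) →
      (∀ i, i < X ∨ X + 4 ≤ i → (i < K.P X ∨ K.P (X + 4) ≤ i) → σ'.mem i = σ.mem i) →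
      σ'.work = σ.work → σ'.out = σ.out → σ'.time ≤ σ.time + 1000 * (1 + K.L X) → Q σ') :
    wp K.B K.N decodeGroup Q σ := by
  have hXg := hX
  obtain ⟨hX1, hX2⟩ := hX
  have hm : 0 < K.m := by omega
  have hm4 := K.m_mod
  have hmn := K.m_le
  have hN := K.big_N hm
  have hNB := K.N_lt
  have q4 := K.P_le_N (v := X + 4) (by omega) (by omega)
  have q5 := K.le_P (v := X) (by omega) (by omega)
  have q6 := K.P_le (u := X) (v := X + 4) (by omega) (by omega) (by omega)
  have hLd : K.L X = K.P (X + 4) - K.P X := rfl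
  have hmod := sub_div_mul_eq_mod (σ.mem (X + 3)) 1
  have hle := div_mul_le (σ.mem (X + 3)) 1
  simp only [pow_one] at hmod hle
  simp [decodeGroup]
  refine ⟨by omega, ?_⟩
  apply getStart_spec K hXg (i := 1) <;> try simp [*]
  intro σ1 r1 v1 m1 w1 o1 t1
  refine ⟨by omega, ?_⟩
  apply getStart_spec K hXg (i := 2) <;> try simp [*]
  intro σ2 r2 v2 m2 w2 o2 t2
  refine ⟨by omega, ?_⟩
  apply getStart_spec K hXg (i := 3) <;> try simp [*]
  intro σ3 r3 v3 m3 w3 o3 t3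
  rw [← hLd] at t1 t2 t3
  simp [r3, r2, r1, hX', hl, m3, v3]
  have hl3 : K.l = 3 * K.h + 3 := rfl
  repeat refine And.intro (by omega) ?_
  refine ⟨?_, ?_⟩
  · intro hfast
    have hf : K.L X < 2 ^ K.h := by
      by_contra h
      simp only [Ctx.slow, h, if_false] at hs
      omega
    repeat refine And.intro (by omega) ?_
    refine hQ _ ?_ ?_ ?_ ?_ (by simp [*]) (by simp [*]) ?_
    · intro v hv; simp at hv; simp [r3, r2, r1, hv]
    · intro i hi
      obtain rfl | rfl | rfl | rfl : i = 0 ∨ i = 1 ∨ i = 2 ∨ i = 3 := by omega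
      all_goals simp [henc.base]
    · intro i hi hi'
      simp only []
      rw [Function.update_of_ne (by omega), Function.update_of_ne (by omega),
        Function.update_of_ne (by omega)]
      exact (henc.fast hf).2 i hi hi'
    · intro i hi hi'
      simp only []
      rw [Function.update_of_ne (by omega), Function.update_of_ne (by omega),
        Function.update_of_ne (by omega)]
    · simp; omega
  · intro hslow
    have hf : ¬ K.L X < 2 ^ K.h := by
      intro h
      simp only [Ctx.slow, h, if_true] at hs
      omega
    obtain ⟨k, hk, ha, hlen, e1, e2, e3, erest⟩ := henc.slow hf
    have b0 := K.P_le (u := X) (v := X + k) (by omega) (by omega) (by omega)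
    have b1 := K.P_le (u := X + k + 1) (v := X + 4) (by omega) (by omega) (by omega)
    have hasc := K.asc_pairs (v := X + k) (a := K.P (X + k)) (c := 3 * K.l) (by omega) (by omega)
      le_rfl (by omega)
    repeat refine And.intro (by omega) ?_
    apply sortPairs_spec (A := K.A) (a := K.P (X + k)) (l := 3 * K.l) <;>
      (try simp [*]) <;> try omega
    · exact pairs_of_three e1 e2 e3
    · exact hasc
    intro σ4 r4 s4 m4 w4 o4 t4
    simp [*]
    repeat refine And.intro (by omega) ?_
    refine hQ _ ?_ ?_ ?_ ?_ (by simp [*]) (by simp [*]) ?_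
    · intro v hv; simp at hv; simp [r4, r3, r2, r1, hv]
    · intro i hi
      obtain rfl | rfl | rfl | rfl : i = 0 ∨ i = 1 ∨ i = 2 ∨ i = 3 := by omega
      · simp only [add_zero]
        rw [Function.update_of_ne (by omega), Function.update_of_ne (by omega),
          Function.update_of_ne (by omega), m4 _ (by omega), henc.base]
      all_goals simp
    · intro i hi hi'
      simp only []
      rw [Function.update_of_ne (by omega), Function.update_of_ne (by omega),
        Function.update_of_ne (by omega)]
      by_cases h : i < K.P (X + k) ∨ K.P (X + k) + 6 * K.l ≤ i
      · rw [m4 i (by omega)]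
        exact erest i hi hi' h
      · exact s4 i (by omega) (by omega)
    · intro i hi hi'
      simp only []
      rw [Function.update_of_ne (by omega), Function.update_of_ne (by omega),
        Function.update_of_ne (by omega), m4 i (by omega)]
    · simp; omega

/-! ### Colours and stacks -/

/-- The word with the colours of the vertices of a group: one bit for the kind of the group, four
digits in base `4` and the number of gray vertices. -/
def encCols (s : ℕ) (col : ℕ → ℕ) (X : ℕ) : ℕ :=
  s + 2 * (col X + 4 * col (X + 1) + 16 * col (X + 2) + 64 * col (X + 3)) +
    512 * (col X / 2 + col (X + 1) / 2 + col (X + 2) / 2 + col (X + 3) / 2)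

section encCols

variable {s : ℕ} {col : ℕ → ℕ} {X j : ℕ}

theorem encCols_lt (hs : s < 2) (hc : ∀ v, col v < 4) : encCols s col X < 4096 := by
  have := hc X; have := hc (X + 1); have := hc (X + 2); have := hc (X + 3)
  unfold encCols
  omega

theorem encCols_mod_two (hs : s < 2) : encCols s col X % 2 = s := by
  unfold encCols
  omega

theorem encCols_digit (hs : s < 2) (hc : ∀ v, col v < 4) (hj : j < 4) :
    encCols s col X / 2 ^ (j + j + 1) % 4 = col (X + j) := by
  have := hc X; have := hc (X + 1); have := hc (X + 2); have := hc (X + 3)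
  have key : ∀ b r c k : ℕ, r < b → c < 4 → (r + b * (c + 4 * k)) / b % 4 = c := by
    intro b r c k hr hc
    rw [Nat.add_mul_div_left _ _ (by omega), Nat.div_eq_of_lt hr, Nat.zero_add,
      Nat.add_mul_mod_self_left, Nat.mod_eq_of_lt hc]
  unfold encCols
  generalize col X / 2 + col (X + 1) / 2 + col (X + 2) / 2 + col (X + 3) / 2 = g
  obtain rfl | rfl | rfl | rfl : j = 0 ∨ j = 1 ∨ j = 2 ∨ j = 3 := by omega
  · convert key 2 s (col X) (col (X + 1) + 4 * col (X + 2) + 16 * col (X + 3) + 64 * g) hs (hc _)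
      using 3 <;> ring
  · convert key 8 (s + 2 * col X) (col (X + 1)) (col (X + 2) + 4 * col (X + 3) + 16 * g)
      (by omega) (hc _) using 3 <;> ring
  · convert key 32 (s + 2 * (col X + 4 * col (X + 1))) (col (X + 2)) (col (X + 3) + 4 * g)
      (by omega) (hc _) using 3 <;> ring
  · convert key 128 (s + 2 * (col X + 4 * col (X + 1) + 16 * col (X + 2))) (col (X + 3)) g
      (by omega) (hc _) using 3 <;> ring

theorem encCols_gray (hj : j < 4) (hg : 2 ≤ col (X + j)) : 512 ≤ encCols s col X := by
  unfold encCols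
  obtain rfl | rfl | rfl | rfl : j = 0 ∨ j = 1 ∨ j = 2 ∨ j = 3 := by omega
  · rw [add_zero] at hg
    omega
  all_goals omega

theorem exists_gray (hs : s < 2) (hc : ∀ v, col v < 4) (h : 512 ≤ encCols s col X) :
    ∃ j < 4, 2 ≤ col (X + j) := by
  have := hc X; have := hc (X + 1); have := hc (X + 2); have := hc (X + 3)
  by_contra! hno
  have h0 := hno 0 (by omega); have h1 := hno 1 (by omega)
  have h2 := hno 2 (by omega); have h3 := hno 3 (by omega)
  simp only [add_zero] at h0
  unfold encCols at h
  omega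

theorem encCols_update {x : ℕ} (hj : j < 4) :
    encCols s (Function.update col (X + j) x) X + (col (X + j) * 2 ^ (j + j + 1) +
      512 * (col (X + j) / 2)) = encCols s col X + (x * 2 ^ (j + j + 1) + 512 * (x / 2)) := by
  unfold encCols
  obtain rfl | rfl | rfl | rfl : j = 0 ∨ j = 1 ∨ j = 2 ∨ j = 3 := by omega
  all_goals simp
  all_goals omega

end encCols

namespace Ctx

variable (K : Ctx)

theorem slow_lt (X : ℕ) : K.slow X < 2 := by
  unfold slow
  split_ifs <;> omega

/-- The names of groups and of vertices outside of groups, which are treated as groups of one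
vertex. -/
def IsId (X : ℕ) : Prop := K.IsGroup X ∨ K.m < X ∧ X ≤ K.n

/-- The group of a vertex. -/
def gid (v : ℕ) : ℕ := if v ≤ K.m then (v - 1) / 4 * 4 + 1 else v

theorem isId_gid {v : ℕ} (h1 : 1 ≤ v) (h2 : v ≤ K.n) : K.IsId (K.gid v) := by
  have := K.m_mod
  unfold gid IsId IsGroup
  split_ifs with h
  · left; omega
  · right; omega

theorem gid_add {X j : ℕ} (hX : K.IsGroup X) (hj : j < 4) : K.gid (X + j) = X := by
  have := K.m_mod
  unfold IsGroup at hX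
  unfold gid
  rw [if_pos (by omega)]
  omega

theorem eq_add_of_gid {v X : ℕ} (h1 : 1 ≤ v) (hX : K.IsGroup X)
    (h : K.gid v = X) : ∃ j < 4, v = X + j := by
  have := K.m_mod
  unfold IsGroup at hX
  unfold gid at h
  refine ⟨v - X, ?_⟩
  split_ifs at h <;> omega

theorem eq_of_gid {v X : ℕ} (h1 : 1 ≤ v) (hX : K.m < X) (h : K.gid v = X) : v = X := by
  have := K.m_mod
  unfold gid at h
  split_ifs at h <;> omega

/-- The group below the given one on a stack. -/
def link (σ : St) (X : ℕ) : ℕ := if X ≤ K.m then σ.mem (X + 1) else σ.work (X - K.m - 1) - 1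

/-- The state contains the encoded graph and the colours of the vertices: `0` for white vertices, `1`
for black vertices, which have been processed, and `2` and `3` for gray ones. In the working memory,
only white vertices are distinguished from the others. -/
structure Rep (σ : St) (col : ℕ → ℕ) : Prop where
  n : σ.r .n = K.n
  N : σ.r .N = K.N
  m : σ.r .m = K.m
  h : 0 < K.m → σ.r .h = K.h
  l : 0 < K.m → σ.r .l = K.l
  head : σ.mem 0 = K.n
  table : ∀ v, K.m < v → v ≤ K.n + 1 → σ.mem v = K.P v
  group : ∀ X, K.IsGroup X → K.GroupEnc σ.mem X
  cols : ∀ X, K.IsGroup X → σ.mem (X + 3) = encCols (K.slow X) col X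
  rest : ∀ i, K.P (K.m + 1) ≤ i → i < K.N → σ.mem i = K.A i
  work : ∀ v, K.m < v → v ≤ K.n → (σ.work (v - K.m - 1) = 0 ↔ col v = 0)
  col_lt : ∀ v, col v < 4

variable {K}

theorem GroupEnc.congr {mem mem' : ℕ → ℕ} {X : ℕ} (hX : K.IsGroup X) (h : K.GroupEnc mem X)
    (h0 : mem' X = mem X) (h2 : mem' (X + 2) = mem (X + 2))
    (hm : ∀ i, K.P X ≤ i → i < K.P (X + 4) → mem' i = mem i) : K.GroupEnc mem' X := by
  have hm4 := K.m_mod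
  have hmn := K.m_le
  obtain ⟨hX1, hX2⟩ := hX
  refine ⟨h0.trans h.base, fun hf => ?_, fun hf => ?_⟩
  · refine ⟨h2.trans (h.fast hf).1, fun i hi hi' => ?_⟩
    rw [hm i hi hi']
    exact (h.fast hf).2 i hi hi'
  · obtain ⟨k, hk, ha, hlen, e1, e2, e3, erest⟩ := h.slow hf
    have p1 := K.P_le (u := X) (v := X + k) (by omega) (by omega) (by omega)
    have p2 := K.P_le (u := X + k + 1) (v := X + 4) (by omega) (by omega) (by omega)
    refine ⟨k, hk, h2.trans ha, hlen, e1.congr fun i hi _ => hm i (by omega) (by omega),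
      e2.congr fun i hi _ => hm i (by omega) (by omega),
      e3.congr fun i hi _ => hm i (by omega) (by omega), fun i hi hi' h => ?_⟩
    rw [hm i hi hi']
    exact erest i hi hi' h

theorem Rep.congr {σ σ' : St} {col : ℕ → ℕ} (h : K.Rep σ col)
    (hr : ∀ v, v ∈ [Var.n, .N, .m, .h, .l] → σ'.r v = σ.r v) (hm : σ'.mem = σ.mem)
    (hw : σ'.work = σ.work) : K.Rep σ' col where
  n := by rw [hr _ (by decide), h.n]
  N := by rw [hr _ (by decide), h.N]
  m := by rw [hr _ (by decide), h.m]
  h := by rw [hr _ (by decide)]; exact h.h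
  l := by rw [hr _ (by decide)]; exact h.l
  head := by rw [hm]; exact h.head
  table := by rw [hm]; exact h.table
  group := by rw [hm]; exact h.group
  cols := by rw [hm]; exact h.cols
  rest := by rw [hm]; exact h.rest
  work := by rw [hw]; exact h.work
  col_lt := h.col_lt

/-- The effect of a change of the dynamic part of the encoding of a group. -/
theorem Rep.update_group {σ σ' : St} {col col' : ℕ → ℕ} {Y : ℕ} (h : K.Rep σ col)
    (hY : K.IsGroup Y) (hr : ∀ v, v ∈ [Var.n, .N, .m, .h, .l] → σ'.r v = σ.r v)
    (hm : ∀ i, i ≠ Y + 1 → i ≠ Y + 3 → σ'.mem i = σ.mem i)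
    (hw : σ'.work = σ.work) (hc : ∀ v, v < Y ∨ Y + 4 ≤ v → col' v = col v)
    (hc4 : ∀ v, col' v < 4) (hY3 : σ'.mem (Y + 3) = encCols (K.slow Y) col' Y) :
    K.Rep σ' col' where
  n := by rw [hr _ (by decide), h.n]
  N := by rw [hr _ (by decide), h.N]
  m := by rw [hr _ (by decide), h.m]
  h := by rw [hr _ (by decide)]; exact h.h
  l := by rw [hr _ (by decide)]; exact h.l
  head := by rw [hm _ (by omega) (by omega)]; exact h.head
  table v hv hv' := by
    have := K.m_mod
    unfold IsGroup at hY
    rw [hm _ (by omega) (by omega)]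
    exact h.table v hv hv'
  group X hX := by
    have := K.m_mod
    have := K.m_le
    have hX' := hX
    unfold IsGroup at hY hX'
    have := K.le_P (v := X) (by omega) (by omega)
    exact (h.group X hX).congr hX (hm _ (by omega) (by omega)) (hm _ (by omega) (by omega))
      fun i hi _ => hm _ (by omega) (by omega)
  cols X hX := by
    by_cases hXY : X = Y
    · rw [hXY]; exact hY3
    · have := K.m_mod
      have hX' := hX
      unfold IsGroup at hY hX'
      rw [hm _ (by omega) (by omega), h.cols X hX]
      unfold encCols
      rw [hc _ (by omega), hc _ (by omega), hc _ (by omega), hc _ (by omega)]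
  rest i hi hi' := by
    have := K.m_mod
    have := K.m_le
    have := K.le_P (v := K.m + 1) (by omega) (by omega)
    unfold IsGroup at hY
    rw [hm _ (by omega) (by omega)]
    exact h.rest i hi hi'
  work v hv hv' := by
    have := K.m_mod
    unfold IsGroup at hY
    rw [hw, hc v (by omega)]
    exact h.work v hv hv'
  col_lt := hc4

theorem Rep.next {σ : St} {col : ℕ → ℕ} {X : ℕ} (h : K.Rep σ col) (hX : K.IsGroup X) :
    σ.mem (X + 4) = K.P (X + 4) := by
  have := K.m_mod
  have := K.m_le
  have hX' := hX
  unfold IsGroup at hX'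
  by_cases hlt : X + 4 < K.m
  · exact (h.group (X + 4) ⟨by omega, hlt⟩).base
  · exact h.table _ (by omega) (by omega)

end Ctx

/-- Either `u` is not white and nothing happens (`hQ1`), or it becomes gray (`hQ2`). In the latter case
the stack changes only if the group of `u` had no gray vertex before. -/
theorem discover_spec (K : Ctx) {Q : St → Prop} {σ : St} {col : ℕ → ℕ} {u d par x : ℕ}
    (hR : K.Rep σ col) (hu : σ.r .u = u) (hu1 : 1 ≤ u) (hun : u ≤ K.n)
    (hd : σ.r .d = d) (hpar : σ.r .par = par) (hpar2 : par = 2 ∨ par = 3)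
    (hx : σ.r .nxt = x) (hxn : x ≤ K.n)
    (hQ1 : ∀ σ' : St, (∀ v, v ∉ [Var.t, .g, .c, .a] → σ'.r v = σ.r v) →
      σ'.time ≤ σ.time + 200 → col u ≠ 0 → σ'.mem = σ.mem → σ'.work = σ.work → σ'.out = σ.out →
      Q σ')
    (hQ2 : ∀ σ' : St, (∀ v, v ∉ [Var.t, .g, .c, .a, .nxt] → σ'.r v = σ.r v) →
      σ'.time ≤ σ.time + 200 → col u = 0 → K.Rep σ' (Function.update col u par) →
      σ'.out = σ.out ++ [u, d] → (∀ i, K.n + 2 ≤ i → σ'.mem i = σ.mem i) →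
      (∀ X, K.IsId X → X ≠ K.gid u → K.link σ' X = K.link σ X) →
      ((∃ v, 1 ≤ v ∧ v ≤ K.n ∧ K.gid v = K.gid u ∧ 2 ≤ col v) ∧ σ'.r .nxt = x ∧
        K.link σ' (K.gid u) = K.link σ (K.gid u) ∨
       (¬∃ v, 1 ≤ v ∧ v ≤ K.n ∧ K.gid v = K.gid u ∧ 2 ≤ col v) ∧ σ'.r .nxt = K.gid u ∧
        K.link σ' (K.gid u) = x) → Q σ') :
    wp K.B K.N discover Q σ := by
  have hmn := K.m_le
  have hm4 := K.m_mod
  have hNB := K.N_lt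
  have hPl := K.le_P (v := K.n + 1) (by omega) le_rfl
  rw [K.last] at hPl
  have hnl := K.n_lt
  have hcolp : ∀ v, Function.update col u par v < 4 := by
    intro v
    have := hR.col_lt v
    rw [Function.update_apply]
    split_ifs <;> omega
  simp [discover, hu, hR.m]
  constructor
  · intro hmu
    have hgid : K.gid u = u := by unfold Ctx.gid; rw [if_neg (by omega)]
    simp [hx, hd]
    repeat refine And.intro (by omega) ?_
    constructor
    · intro hw
      have hcu : col u = 0 := (hR.work u hmu hun).1 hw
      repeat refine And.intro (by omega) ?_
      refine hQ2 _ ?_ ?_ hcu ?_ rfl (fun _ _ => rfl) ?_ (Or.inr ⟨?_, ?_, ?_⟩)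
      · intro v hv; simp at hv; simp [hv]
      · simp
      · refine ⟨by simp [hR.n], by simp [hR.N], by simp [hR.m], by simpa using hR.h,
          by simpa using hR.l, hR.head, hR.table, hR.group, ?_, hR.rest, ?_, hcolp⟩
        · intro X hX
          simp only []
          rw [hR.cols X hX]
          unfold Ctx.IsGroup at hX
          unfold encCols
          repeat rw [Function.update_of_ne (by omega)]
        · intro v hv hv'
          simp only []
          by_cases h : v = u
          · subst h; simp; omega
          · rw [Function.update_of_ne (by omega), Function.update_of_ne h]
            exact hR.work v hv hv'
      · intro X hX hXu
        rw [hgid] at hXu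
        unfold Ctx.link
        split_ifs with h
        · rfl
        · simp only []
          rw [Function.update_of_ne (by omega)]
      · rintro ⟨v, h1, h2, h3, h4⟩
        rw [hgid] at h3
        have := K.eq_of_gid h1 hmu h3
        subst this
        omega
      · simp [hgid]
      · rw [hgid]
        unfold Ctx.link
        rw [if_neg (by omega)]
        simp
    · intro hw
      have hcu : col u ≠ 0 := fun h => hw ((hR.work u hmu hun).2 h)
      refine hQ1 _ ?_ ?_ hcu rfl rfl rfl
      · intro v hv; simp at hv; simp [hv]
      · simp
  · intro hmu
    have hm : 0 < K.m := by omega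
    obtain ⟨hN1, hN2⟩ := K.big_N hm
    have hY : K.IsGroup (K.gid u) := by
      rcases K.isId_gid hu1 hun with h | h
      · exact h
      · unfold Ctx.gid at h; rw [if_pos (by omega)] at h; omega
    have hgid : (u - 1) / 4 * 4 + 1 = K.gid u := by unfold Ctx.gid; rw [if_pos (by omega)]
    obtain ⟨j, hj, huj⟩ := K.eq_add_of_gid hu1 hY rfl
    generalize hYd : K.gid u = Y at *
    have hY' := hY
    obtain ⟨hY1, hY2⟩ := hY'
    have hs := K.slow_lt Y
    have hc3 := hR.cols Y hY
    have hlt := encCols_lt (X := Y) hs hR.col_lt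
    have hdig := encCols_digit (X := Y) hs hR.col_lt hj
    have hup := encCols_update (s := K.slow Y) (col := col) (X := Y) (x := par) hj
    rw [← huj] at hup hdig
    have hpow : 2 ^ (j + j + 1) ≤ 2 ^ 7 := Nat.pow_le_pow_right (by norm_num) (by omega)
    have hpp : par * 2 ^ (j + j + 1) ≤ 3 * 2 ^ 7 := Nat.mul_le_mul (by omega) hpow
    have hle1 : encCols (K.slow Y) col Y / 2 ^ (j + j + 1) ≤ encCols (K.slow Y) col Y :=
      Nat.div_le_self _ _
    have huY : u - Y = j := by omega
    simp [hgid, hc3, hx, hd, hpar, huY]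
    repeat refine And.intro (by omega) ?_
    constructor
    · intro hw
      have hcu : col u = 0 := by omega
      simp [hcu] at hup
      have hpar1 : par / 2 = 1 := by omega
      have henc : encCols (K.slow Y) col Y + 512 + par * 2 ^ (j + j + 1) =
          encCols (K.slow Y) (Function.update col u par) Y := by omega
      repeat refine And.intro (by omega) ?_
      constructor
      · intro hwhite
        repeat refine And.intro (by omega) ?_
        refine hQ2 _ ?_ ?_ hcu ?_ rfl ?_ ?_ (Or.inr ⟨?_, ?_, ?_⟩)
        · intro v hv; simp at hv; simp [hv]
        · simp
        · refine hR.update_group hY ?_ ?_ rfl ?_ hcolp ?_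
          · intro v hv; simp at hv; rcases hv with rfl | rfl | rfl | rfl | rfl <;> simp
          · intro i hi hi'
            simp only []
            rw [Function.update_of_ne hi, Function.update_of_ne hi']
          · intro v hv
            rw [Function.update_of_ne (by omega)]
          · simp [henc]
        · intro i hi
          simp only []
          rw [Function.update_of_ne (by omega), Function.update_of_ne (by omega)]
        · intro X hX hXu
          unfold Ctx.link
          split_ifs with h
          · simp only []
            unfold Ctx.IsId Ctx.IsGroup at hX
            rw [Function.update_of_ne (by omega), Function.update_of_ne (by omega)]
          · rfl
        · rintro ⟨v, h1, h2, h3, h4⟩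
          obtain ⟨i, hi, hvi⟩ := K.eq_add_of_gid h1 hY h3
          have := encCols_gray (s := K.slow Y) (col := col) (X := Y) hi (by rwa [← hvi])
          omega
        · simp
        · unfold Ctx.link
          rw [if_pos (by omega)]
          simp
      · intro hgray
        refine hQ2 _ ?_ ?_ hcu ?_ rfl ?_ ?_ (Or.inl ⟨?_, ?_, ?_⟩)
        · intro v hv; simp at hv; simp [hv]
        · simp
        · refine hR.update_group hY ?_ ?_ rfl ?_ hcolp ?_
          · intro v hv; simp at hv; rcases hv with rfl | rfl | rfl | rfl | rfl <;> simp
          · intro i hi hi'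
            simp only []
            rw [Function.update_of_ne hi']
          · intro v hv
            rw [Function.update_of_ne (by omega)]
          · simp [henc]
        · intro i hi
          simp only []
          rw [Function.update_of_ne (by omega)]
        · intro X hX hXu
          unfold Ctx.link
          split_ifs with h
          · simp only []
            unfold Ctx.IsId Ctx.IsGroup at hX
            rw [Function.update_of_ne (by omega)]
          · rfl
        · obtain ⟨i, hi, hi'⟩ := exists_gray hs hR.col_lt (by omega)
          exact ⟨Y + i, by omega, by omega, K.gid_add hY hi, hi'⟩
        · simp [hx]
        · unfold Ctx.link
          rw [if_pos (by omega), if_pos (by omega)]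
          simp
    · intro hw
      have hcu : col u ≠ 0 := by omega
      refine hQ1 _ ?_ ?_ hcu rfl rfl rfl
      · intro v hv; simp at hv; simp [hv]
      · simp

/-! ### Distances in directed graphs -/

section Dist

variable {V : Type*} {G : Digraph V} {s : V}

theorem hasDist_unique {v : V} {d d' : ℕ} (h : G.HasDist s v d) (h' : G.HasDist s v d') :
    d = d' := h.unique h'

theorem hasDist_self : G.HasDist s s 0 := ⟨.nil, fun _ _ => Nat.zero_le _⟩

theorem hasDist_zero {v : V} (h : G.HasDist s v 0) : v = s := by
  cases h.1
  rfl

theorem exists_hasDist {v : V} {d : ℕ} (h : G.HasWalk s d v) : ∃ i ≤ d, G.HasDist s v i := by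
  classical
  have hex : ∃ i, G.HasWalk s i v := ⟨d, h⟩
  exact ⟨Nat.find hex, Nat.find_min' hex h, Nat.find_spec hex, fun i hi => Nat.find_min' hex hi⟩

theorem hasDist_pred {v : V} {d : ℕ} (h : G.HasDist s v (d + 1)) :
    ∃ u, G.HasDist s u d ∧ G.Adj u v := by
  obtain ⟨hw, hmin⟩ := h
  obtain _ | @⟨_, u, _, hu, hadj⟩ := hw
  refine ⟨u, ⟨hu, fun i hi => ?_⟩, hadj⟩
  have := hmin (Digraph.HasWalk.snoc hi hadj)
  omega

theorem hasDist_succ {u v : V} {d : ℕ} (h : G.HasDist s u d) (hadj : G.Adj u v)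
    (hno : ∀ i ≤ d, ¬ G.HasDist s v i) : G.HasDist s v (d + 1) := by
  obtain ⟨i, hi, hd⟩ := exists_hasDist (Digraph.HasWalk.snoc h.1 hadj)
  obtain rfl : i = d + 1 := by
    by_contra hne
    exact hno i (by omega) hd
  exact hd

/-- All smaller distances occur, too, so that distances are smaller than the number of vertices. -/
theorem hasDist_lt {v : V} {d : ℕ} (S : Finset V) (hS : ∀ v d, G.HasDist s v d → v ∈ S)
    (h : G.HasDist s v d) : d < S.card := by
  have hex : ∀ k i, i + k = d → ∃ u, G.HasDist s u i := by
    intro k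
    induction k with
    | zero => rintro i rfl; exact ⟨v, h⟩
    | succ k ih =>
      intro i hi
      obtain ⟨u, hu⟩ := ih (i + 1) (by omega)
      obtain ⟨u', hu', -⟩ := hasDist_pred hu
      exact ⟨u', hu'⟩
  have hex' : ∀ i : Fin (d + 1), ∃ u, G.HasDist s u i := fun i => hex (d - i) i (by omega)
  choose f hf using hex'
  have hinj : Function.Injective f := by
    intro i j hij
    have hi := hf i
    rw [hij] at hi
    exact Fin.ext (hasDist_unique hi (hf j))
  have := Finset.card_le_card_of_injOn (s := Finset.univ) (t := S) f
    (fun i _ => hS _ _ (hf i)) hinj.injOn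
  simpa using this

end Dist

namespace Ctx

variable (K : Ctx)

theorem adj_range {v u : ℕ} (h : K.graph.Adj v u) : 1 ≤ u ∧ u ≤ K.n := by
  obtain ⟨⟨h1, h2⟩, i, hi, hi', rfl⟩ := h
  have := K.le_P h1 (by omega)
  have := K.P_le_N (v := v + 1) (by omega) (by omega)
  exact K.range i (by omega) (by omega)

theorem hasDist_range {s v d : ℕ} (hs : 1 ≤ s ∧ s ≤ K.n) (h : K.graph.HasDist s v d) :
    1 ≤ v ∧ v ≤ K.n := by
  cases d with
  | zero => rwa [hasDist_zero h]
  | succ d =>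
    obtain ⟨u, -, hu⟩ := hasDist_pred h
    exact K.adj_range hu

theorem hasDist_lt_n {s v d : ℕ} (hs : 1 ≤ s ∧ s ≤ K.n) (h : K.graph.HasDist s v d) :
    d < K.n := by
  have := hasDist_lt (Finset.Icc 1 K.n)
    (fun v d h => by simpa using K.hasDist_range hs h) h
  simpa using this

/-- The encoding only permutes the adjacency arrays of a group. -/
theorem GroupEnc.values {K : Ctx} {mem : ℕ → ℕ} {X j : ℕ} (hX : K.IsGroup X)
    (h : K.GroupEnc mem X) (hj : j < 4) :
    (∀ i, K.P (X + j) ≤ i → i < K.P (X + j + 1) →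
      ∃ i', K.P (X + j) ≤ i' ∧ i' < K.P (X + j + 1) ∧ mem i = K.A i') ∧
    (∀ i, K.P (X + j) ≤ i → i < K.P (X + j + 1) →
      ∃ i', K.P (X + j) ≤ i' ∧ i' < K.P (X + j + 1) ∧ mem i' = K.A i) := by
  have hm4 := K.m_mod
  have hmn := K.m_le
  obtain ⟨hX1, hX2⟩ := hX
  have b0 := K.P_le (u := X) (v := X + j) (by omega) (by omega) (by omega)
  have b1 := K.P_le (u := X + j + 1) (v := X + 4) (by omega) (by omega) (by omega)
  by_cases hf : K.L X < 2 ^ K.h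
  · have := (h.fast hf).2
    exact ⟨fun i hi hi' => ⟨i, hi, hi', this i (by omega) (by omega)⟩,
      fun i hi hi' => ⟨i, hi, hi', this i (by omega) (by omega)⟩⟩
  obtain ⟨k, hk, ha, hlen, e1, e2, e3, erest⟩ := h.slow hf
  by_cases hjk : j = k
  · subst hjk
    have hp := pairs_of_three e1 e2 e3
    have key : ∀ i, K.P (X + j) ≤ i → i < K.P (X + j) + 6 * K.l →
        ∃ i', K.P (X + j) ≤ i' ∧ i' < K.P (X + j) + 6 * K.l ∧ mem i = K.A i' ∧
          mem i' = K.A i := by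
      intro i hi hi'
      have hpc := hp ((i - K.P (X + j)) / 2) (by omega)
      obtain hc | hc : i = K.P (X + j) + 2 * ((i - K.P (X + j)) / 2) ∨
          i = K.P (X + j) + 2 * ((i - K.P (X + j)) / 2) + 1 := by omega
      · rw [← hc] at hpc
        rcases hpc with hpc | hpc
        · exact ⟨i, hi, hi', hpc.1, hpc.1⟩
        · exact ⟨i + 1, by omega, by omega, hpc.1, hpc.2⟩
      · rw [← hc] at hpc
        rcases hpc with hpc | hpc
        · exact ⟨i, hi, hi', hpc.2, hpc.2⟩
        · exact ⟨_, Nat.le_add_right _ _, by omega, hpc.2, hpc.1⟩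
    constructor
    · intro i hi hi'
      by_cases hc : i < K.P (X + j) + 6 * K.l
      · obtain ⟨i', h1, h2, h3, -⟩ := key i hi hc
        exact ⟨i', h1, by omega, h3⟩
      · exact ⟨i, hi, hi', erest i (by omega) (by omega) (by omega)⟩
    · intro i hi hi'
      by_cases hc : i < K.P (X + j) + 6 * K.l
      · obtain ⟨i', h1, h2, -, h3⟩ := key i hi hc
        exact ⟨i', h1, by omega, h3⟩
      · exact ⟨i, hi, hi', erest i (by omega) (by omega) (by omega)⟩
  · have hout : ∀ i, K.P (X + j) ≤ i → i < K.P (X + j + 1) → mem i = K.A i := by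
      intro i hi hi'
      refine erest i (by omega) (by omega) ?_
      rcases Nat.lt_or_gt_of_ne hjk with hlt | hlt
      · have := K.P_le (u := X + j + 1) (v := X + k) (by omega) (by omega) (by omega)
        omega
      · have := K.P_le (u := X + k + 1) (v := X + j) (by omega) (by omega) (by omega)
        omega
    exact ⟨fun i hi hi' => ⟨i, hi, hi', hout i hi hi'⟩, fun i hi hi' => ⟨i, hi, hi', hout i hi hi'⟩⟩

/-! ### The invariant of the search -/

/-- The state of a breadth-first search in which the vertices at distance `d` are processed: `l` is
the list of the discovered vertices with their distances, vertices at distance `d` that have not yet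
been processed have the colour `cp`, and those at distance `d + 1` have the colour `np`. -/
structure Search (s : ℕ) (col : ℕ → ℕ) (l : List (ℕ × ℕ)) (d cp np : ℕ) : Prop where
  nodup : (l.map Prod.fst).Nodup
  asc : l.Pairwise fun a b => a.2 ≤ b.2
  sound : ∀ v i, (v, i) ∈ l → K.graph.HasDist s v i ∧ i ≤ d + 1
  complete : ∀ v i, K.graph.HasDist s v i → i ≤ d → (v, i) ∈ l
  col_ne : ∀ v, 1 ≤ v → v ≤ K.n → (col v ≠ 0 ↔ ∃ i, (v, i) ∈ l)
  cur : ∀ v, 1 ≤ v → v ≤ K.n → col v = cp → (v, d) ∈ l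
  nxt : ∀ v, 1 ≤ v → v ≤ K.n → (col v = np ↔ (v, d + 1) ∈ l)
  closed : ∀ v u, col v = 1 → K.graph.Adj v u → col u ≠ 0

/-- The two gray colours. -/
def Grays (cp np : ℕ) : Prop := cp = 2 ∧ np = 3 ∨ cp = 3 ∧ np = 2

variable {K}

theorem Search.discover {s d cp np v u : ℕ} {col : ℕ → ℕ} {l : List (ℕ × ℕ)}
    (h : K.Search s col l d cp np) (hg : Grays cp np) (hv : K.graph.HasDist s v d)
    (hadj : K.graph.Adj v u) (hu : col u = 0) :
    K.Search s (Function.update col u np) (l ++ [(u, d + 1)]) d cp np := by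
  obtain ⟨hu1, hun⟩ := K.adj_range hadj
  have hnew : ∀ i, (u, i) ∉ l := fun i hi => (h.col_ne u hu1 hun).2 ⟨i, hi⟩ hu
  have hdist : K.graph.HasDist s u (d + 1) :=
    hasDist_succ hv hadj fun i hi hd => hnew i (h.complete u i hd hi)
  unfold Grays at hg
  refine ⟨?_, ?_, ?_, ?_, ?_, ?_, ?_, ?_⟩
  · rw [List.map_append, List.nodup_append]
    refine ⟨h.nodup, by simp, ?_⟩
    rintro a ha b hb rfl
    simp only [List.map_cons, List.map_nil, List.mem_singleton] at hb
    subst hb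
    obtain ⟨⟨b, i⟩, hb, rfl⟩ := List.mem_map.1 ha
    exact hnew i hb
  · rw [List.pairwise_append]
    refine ⟨h.asc, by simp, ?_⟩
    rintro ⟨a, i⟩ ha b hb
    simp only [List.mem_singleton] at hb
    subst hb
    exact (h.sound a i ha).2
  · intro w i hw
    rcases List.mem_append.1 hw with hw | hw
    · exact h.sound w i hw
    · simp only [List.mem_singleton, Prod.mk.injEq] at hw
      obtain ⟨rfl, rfl⟩ := hw
      exact ⟨hdist, le_rfl⟩
  · exact fun w i hw hi => List.mem_append_left _ (h.complete w i hw hi)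
  · intro w h1 h2
    by_cases hw : w = u
    · subst hw
      simp only [Function.update_self]
      exact ⟨fun _ => ⟨d + 1, by simp⟩, fun _ => by omega⟩
    · rw [Function.update_of_ne hw, h.col_ne w h1 h2]
      simp [hw]
  · intro w h1 h2 hc
    by_cases hw : w = u
    · subst hw
      rw [Function.update_self] at hc
      omega
    · rw [Function.update_of_ne hw] at hc
      exact List.mem_append_left _ (h.cur w h1 h2 hc)
  · intro w h1 h2
    by_cases hw : w = u
    · subst hw
      simp
    · rw [Function.update_of_ne hw, h.nxt w h1 h2]
      simp [hw]
  · intro w x hc hwx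
    have hwu : w ≠ u := by
      rintro rfl
      rw [Function.update_self] at hc
      omega
    rw [Function.update_of_ne hwu] at hc
    by_cases hx : x = u
    · subst hx
      rw [Function.update_self]
      omega
    · rw [Function.update_of_ne hx]
      exact h.closed w x hc hwx

theorem Search.finish {s d cp np v : ℕ} {col : ℕ → ℕ} {l : List (ℕ × ℕ)}
    (h : K.Search s col l d cp np) (hg : Grays cp np) (hv : col v = cp)
    (hadj : ∀ u, K.graph.Adj v u → col u ≠ 0) :
    K.Search s (Function.update col v 1) l d cp np := by
  unfold Grays at hg
  have hne : ∀ w, Function.update col v 1 w ≠ 0 ↔ col w ≠ 0 := by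
    intro w
    by_cases hw : w = v
    · subst hw
      rw [Function.update_self]
      omega
    · rw [Function.update_of_ne hw]
  refine ⟨h.nodup, h.asc, h.sound, h.complete, ?_, ?_, ?_, ?_⟩
  · exact fun w h1 h2 => (hne w).trans (h.col_ne w h1 h2)
  · intro w h1 h2 hc
    by_cases hw : w = v
    · subst hw
      rw [Function.update_self] at hc
      omega
    · rw [Function.update_of_ne hw] at hc
      exact h.cur w h1 h2 hc
  · intro w h1 h2
    rw [← h.nxt w h1 h2]
    by_cases hw : w = v
    · subst hw
      rw [Function.update_self]
      omega
    · rw [Function.update_of_ne hw]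
  · intro w x hc hwx
    rw [hne]
    by_cases hw : w = v
    · subst hw
      exact hadj x hwx
    · rw [Function.update_of_ne hw] at hc
      exact h.closed w x hc hwx

/-- All vertices at distance `d` have been processed, so that the search proceeds to distance
`d + 1`. -/
theorem Search.advance {s d cp np : ℕ} {col : ℕ → ℕ} {l : List (ℕ × ℕ)}
    (h : K.Search s col l d cp np) (hs : 1 ≤ s ∧ s ≤ K.n) (hg : Grays cp np)
    (hc4 : ∀ v, col v < 4) (hno : ∀ v, 1 ≤ v → v ≤ K.n → col v ≠ cp) :
    K.Search s col l (d + 1) np cp := by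
  unfold Grays at hg
  have hcomp : ∀ v i, K.graph.HasDist s v i → i ≤ d + 1 → (v, i) ∈ l := by
    intro v i hd hi
    rcases Nat.lt_or_ge i (d + 1) with hlt | hge
    · exact h.complete v i hd (by omega)
    · obtain rfl : i = d + 1 := by omega
      obtain ⟨u, hu, hadj⟩ := hasDist_pred hd
      have hul := h.complete u d hu le_rfl
      obtain ⟨hu1, hun⟩ := K.hasDist_range hs hu
      have hcu : col u = 1 := by
        have h0 := (h.col_ne u hu1 hun).2 ⟨d, hul⟩
        have h1 := hno u hu1 hun
        have h2 : col u ≠ np := fun hc => by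
          have := hasDist_unique hu (h.sound _ _ ((h.nxt u hu1 hun).1 hc)).1
          omega
        have := hc4 u
        omega
      obtain ⟨hv1, hvn⟩ := K.adj_range hadj
      obtain ⟨j, hj⟩ := (h.col_ne v hv1 hvn).1 (h.closed u v hcu hadj)
      rwa [hasDist_unique hd (h.sound v j hj).1]
  refine ⟨h.nodup, h.asc, fun v i hv => ⟨(h.sound v i hv).1, ?_⟩, hcomp, h.col_ne, ?_, ?_,
    h.closed⟩
  · have := (h.sound v i hv).2
    omega
  · exact fun v h1 h2 hc => (h.nxt v h1 h2).1 hc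
  · intro v h1 h2
    refine ⟨fun hc => absurd hc (hno v h1 h2), fun hv => ?_⟩
    have := (h.sound v _ hv).2
    omega

/-- `L` is a stack with top element `x`. -/
def Linked (K : Ctx) (σ : St) : ℕ → List ℕ → Prop
  | x, [] => x = 0
  | x, X :: L => x = X ∧ Linked K σ (K.link σ X) L

theorem Linked.congr {σ σ' : St} {x : ℕ} {L : List ℕ} (h : Linked K σ x L)
    (hl : ∀ X ∈ L, K.link σ' X = K.link σ X) : Linked K σ' x L := by
  induction L generalizing x with
  | nil => exact h
  | cons X L ih =>
    refine ⟨h.1, ?_⟩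
    rw [hl X (by simp)]
    exact ih h.2 fun Y hY => hl Y (by simp [hY])

/-- The two stacks contain the groups with gray vertices, and a group with vertices of both gray
colours is on the first one. The group `X₀` is being processed, or there is no such group, and then
`X₀ = 0`. -/
structure Stacks (K : Ctx) (σ : St) (col : ℕ → ℕ) (cur nxt : List ℕ) (cp np X₀ : ℕ) : Prop where
  linked_cur : Linked K σ (σ.r .cur) cur
  linked_nxt : Linked K σ (σ.r .nxt) nxt
  nodup_cur : cur.Nodup
  nodup_nxt : nxt.Nodup
  disjoint : ∀ X ∈ cur, X ∉ nxt
  gray : ∀ v, 1 ≤ v → v ≤ K.n → 2 ≤ col v → K.gid v ∈ cur ∨ K.gid v ∈ nxt ∨ K.gid v = X₀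
  mem_cur : ∀ X ∈ cur, X ≠ X₀ ∧ ∃ v, 1 ≤ v ∧ v ≤ K.n ∧ K.gid v = X ∧ col v = cp
  mem_nxt : ∀ X ∈ nxt, X ≠ X₀ ∧ (∃ v, 1 ≤ v ∧ v ≤ K.n ∧ K.gid v = X ∧ col v = np) ∧
    ∀ v, 1 ≤ v → v ≤ K.n → K.gid v = X → col v ≠ cp

theorem Stacks.isId_cur {σ : St} {col : ℕ → ℕ} {cur nxt : List ℕ} {cp np X₀ : ℕ}
    (h : K.Stacks σ col cur nxt cp np X₀) {X : ℕ} (hX : X ∈ cur) : K.IsId X := by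
  obtain ⟨-, v, h1, h2, rfl, -⟩ := h.mem_cur X hX
  exact K.isId_gid h1 h2

theorem Stacks.isId_nxt {σ : St} {col : ℕ → ℕ} {cur nxt : List ℕ} {cp np X₀ : ℕ}
    (h : K.Stacks σ col cur nxt cp np X₀) {X : ℕ} (hX : X ∈ nxt) : K.IsId X := by
  obtain ⟨-, ⟨v, h1, h2, rfl, -⟩, -⟩ := h.mem_nxt X hX
  exact K.isId_gid h1 h2

theorem Linked.le_n {σ : St} {x : ℕ} {L : List ℕ} (h : Linked K σ x L)
    (hL : ∀ X ∈ L, K.IsId X) : x ≤ K.n := by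
  cases L with
  | nil => simp [Linked] at h; omega
  | cons X L =>
    obtain ⟨rfl, -⟩ := h
    have hx := hL x (by simp)
    have hm := K.m_le
    unfold IsId IsGroup at hx
    omega

theorem Stacks.congr {σ σ' : St} {col : ℕ → ℕ} {cur nxt : List ℕ} {cp np X₀ : ℕ}
    (h : K.Stacks σ col cur nxt cp np X₀) (hc : σ'.r .cur = σ.r .cur) (hn : σ'.r .nxt = σ.r .nxt)
    (hl : ∀ X, K.IsId X → K.link σ' X = K.link σ X) : K.Stacks σ' col cur nxt cp np X₀ :=
  ⟨by rw [hc]; exact h.linked_cur.congr fun X hX => hl X (h.isId_cur hX),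
    by rw [hn]; exact h.linked_nxt.congr fun X hX => hl X (h.isId_nxt hX),
    h.nodup_cur, h.nodup_nxt, h.disjoint, h.gray, h.mem_cur, h.mem_nxt⟩

/-- A white vertex becomes gray in a group that already has a gray vertex. -/
theorem Stacks.discover_old {σ σ' : St} {col : ℕ → ℕ} {cur nxt : List ℕ} {cp np X₀ u : ℕ}
    (h : K.Stacks σ col cur nxt cp np X₀) (hg : Grays cp np) (hu : col u = 0)
    (hex : ∃ v, 1 ≤ v ∧ v ≤ K.n ∧ K.gid v = K.gid u ∧ 2 ≤ col v)
    (hc : σ'.r .cur = σ.r .cur) (hn : σ'.r .nxt = σ.r .nxt)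
    (hl : ∀ X, K.IsId X → K.link σ' X = K.link σ X) :
    K.Stacks σ' (Function.update col u np) cur nxt cp np X₀ := by
  have h' := h.congr hc hn hl
  unfold Grays at hg
  have key : ∀ v, col v ≠ 0 → Function.update col u np v = col v := fun v hv =>
    Function.update_of_ne (by rintro rfl; exact hv hu) _ _
  refine ⟨h'.linked_cur, h'.linked_nxt, h.nodup_cur, h.nodup_nxt, h.disjoint, ?_, ?_, ?_⟩
  · intro v h1 h2 hv
    by_cases hvu : v = u
    · subst hvu
      obtain ⟨w, w1, w2, w3, w4⟩ := hex
      rw [← w3]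
      exact h.gray w w1 w2 w4
    · rw [Function.update_of_ne hvu] at hv
      exact h.gray v h1 h2 hv
  · intro X hX
    obtain ⟨h0, v, h1, h2, h3, h4⟩ := h.mem_cur X hX
    exact ⟨h0, v, h1, h2, h3, by rw [key v (by omega), h4]⟩
  · intro X hX
    obtain ⟨h0, ⟨v, h1, h2, h3, h4⟩, h5⟩ := h.mem_nxt X hX
    refine ⟨h0, ⟨v, h1, h2, h3, by rw [key v (by omega), h4]⟩, fun w w1 w2 w3 => ?_⟩
    by_cases hwu : w = u
    · subst hwu
      rw [Function.update_self]
      omega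
    · rw [Function.update_of_ne hwu]
      exact h5 w w1 w2 w3

/-- A white vertex becomes gray in a group without gray vertices. -/
theorem Stacks.discover_new {σ σ' : St} {col : ℕ → ℕ} {cur nxt : List ℕ} {cp np X₀ u : ℕ}
    (h : K.Stacks σ col cur nxt cp np X₀) (hg : Grays cp np) (hu : col u = 0) (hu1 : 1 ≤ u)
    (hun : u ≤ K.n)
    (hex : ¬∃ v, 1 ≤ v ∧ v ≤ K.n ∧ K.gid v = K.gid u ∧ 2 ≤ col v)
    (hX₀ : K.gid u ≠ X₀)
    (hc : σ'.r .cur = σ.r .cur) (hn : σ'.r .nxt = K.gid u)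
    (hlu : K.link σ' (K.gid u) = σ.r .nxt)
    (hl : ∀ X, K.IsId X → X ≠ K.gid u → K.link σ' X = K.link σ X) :
    K.Stacks σ' (Function.update col u np) cur (K.gid u :: nxt) cp np X₀ := by
  unfold Grays at hg
  have key : ∀ v, col v ≠ 0 → Function.update col u np v = col v := fun v hv =>
    Function.update_of_ne (by rintro rfl; exact hv hu) _ _
  have hcur : K.gid u ∉ cur := fun hX => by
    obtain ⟨-, v, h1, h2, h3, h4⟩ := h.mem_cur _ hX
    exact hex ⟨v, h1, h2, h3, by omega⟩
  have hnxt : K.gid u ∉ nxt := fun hX => by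
    obtain ⟨-, ⟨v, h1, h2, h3, h4⟩, -⟩ := h.mem_nxt _ hX
    exact hex ⟨v, h1, h2, h3, by omega⟩
  refine ⟨?_, ⟨hn, ?_⟩, h.nodup_cur, List.nodup_cons.2 ⟨hnxt, h.nodup_nxt⟩, ?_, ?_, ?_, ?_⟩
  · rw [hc]
    exact h.linked_cur.congr fun X hX => hl X (h.isId_cur hX) (by rintro rfl; exact hcur hX)
  · rw [hlu]
    exact h.linked_nxt.congr fun X hX => hl X (h.isId_nxt hX) (by rintro rfl; exact hnxt hX)
  · intro X hX hX'
    rcases List.mem_cons.1 hX' with rfl | hX'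
    · exact hcur hX
    · exact h.disjoint X hX hX'
  · intro v h1 h2 hv
    by_cases hvu : v = u
    · subst hvu
      simp
    · rw [Function.update_of_ne hvu] at hv
      rcases h.gray v h1 h2 hv with h | h | h <;> simp [h]
  · intro X hX
    obtain ⟨h0, v, h1, h2, h3, h4⟩ := h.mem_cur X hX
    exact ⟨h0, v, h1, h2, h3, by rw [key v (by omega), h4]⟩
  · intro X hX
    rcases List.mem_cons.1 hX with hX | hX
    · subst hX
      refine ⟨hX₀, ⟨u, hu1, hun, rfl, Function.update_self ..⟩, fun w w1 w2 w3 hw => ?_⟩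
      by_cases hwu : w = u
      · subst hwu
        rw [Function.update_self] at hw
        omega
      · rw [Function.update_of_ne hwu] at hw
        exact hex ⟨w, w1, w2, w3, by omega⟩
    · obtain ⟨h0, ⟨v, h1, h2, h3, h4⟩, h5⟩ := h.mem_nxt X hX
      refine ⟨h0, ⟨v, h1, h2, h3, by rw [key v (by omega), h4]⟩, fun w w1 w2 w3 => ?_⟩
      have hwu : w ≠ u := by
        intro hwu
        rw [hwu] at w3
        exact hnxt (w3 ▸ hX)
      rw [Function.update_of_ne hwu]
      exact h5 w w1 w2 w3

/-- A vertex of the group that is being processed becomes black. -/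
theorem Stacks.finish {σ σ' : St} {col : ℕ → ℕ} {cur nxt : List ℕ} {cp np v : ℕ}
    (h : K.Stacks σ col cur nxt cp np (K.gid v))
    (hc : σ'.r .cur = σ.r .cur) (hn : σ'.r .nxt = σ.r .nxt)
    (hl : ∀ X, K.IsId X → K.link σ' X = K.link σ X) :
    K.Stacks σ' (Function.update col v 1) cur nxt cp np (K.gid v) := by
  have h' := h.congr hc hn hl
  refine ⟨h'.linked_cur, h'.linked_nxt, h.nodup_cur, h.nodup_nxt, h.disjoint, ?_, ?_, ?_⟩
  · intro w h1 h2 hw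
    by_cases hwv : w = v
    · subst hwv
      simp
    · rw [Function.update_of_ne hwv] at hw
      exact h.gray w h1 h2 hw
  · intro X hX
    obtain ⟨h0, w, h1, h2, h3, h4⟩ := h.mem_cur X hX
    refine ⟨h0, w, h1, h2, h3, ?_⟩
    rw [Function.update_of_ne (by rintro rfl; exact h0 h3.symm), h4]
  · intro X hX
    obtain ⟨h0, ⟨w, h1, h2, h3, h4⟩, h5⟩ := h.mem_nxt X hX
    refine ⟨h0, ⟨w, h1, h2, h3, ?_⟩, fun x x1 x2 x3 => ?_⟩
    · rw [Function.update_of_ne (by rintro rfl; exact h0 h3.symm), h4]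
    · rw [Function.update_of_ne (by rintro rfl; exact h0 x3.symm)]
      exact h5 x x1 x2 x3

/-- A vertex outside of groups becomes black without any change of the state. -/
theorem Rep.finish_single {σ : St} {col : ℕ → ℕ} {v : ℕ} (h : K.Rep σ col) (hv : K.m < v)
    (hc : col v ≠ 0) : K.Rep σ (Function.update col v 1) where
  n := h.n
  N := h.N
  m := h.m
  h := h.h
  l := h.l
  head := h.head
  table := h.table
  group := h.group
  cols X hX := by
    have := K.m_mod
    rw [h.cols X hX]
    unfold IsGroup at hX
    unfold encCols
    repeat rw [Function.update_of_ne (by omega)]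
  rest := h.rest
  work w hw hw' := by
    rw [h.work w hw hw']
    by_cases hwv : w = v
    · subst hwv
      simp [hc]
    · rw [Function.update_of_ne hwv]
  col_lt w := by
    have := h.col_lt w
    rw [Function.update_apply]
    split_ifs <;> omega

end Ctx

/-! ### The search -/

/-- The loop rule with a variant that need not be a function of the state. -/
theorem wp_loop_indexed {B len : ℕ} {c : Cond} {a : Cmd} {Q : St → Prop} (I : ℕ → St → Prop)
    (hI : ∀ k σ, I k σ → c.Ok B len σ ∧
      (c.Holds σ → wp B len a (fun σ' => ∃ k' < k, I k' σ') (σ.tick (c.cost + 2))) ∧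
      (¬ c.Holds σ → Q (σ.tick (c.cost + 2))))
    {k : ℕ} {σ : St} (hσ : I k σ) : wp B len (.loop c a) Q σ := by
  refine wp_loop (fun σ => ∃ k, I k σ) (fun σ => sInf {k | I k σ}) (fun σ hσ => ?_) σ ⟨k, hσ⟩
  obtain ⟨h1, h2, h3⟩ := hI _ σ (Nat.sInf_mem hσ)
  refine ⟨h1, fun hc => wp_mono a ?_ _ (h2 hc), h3⟩
  rintro σ' ⟨k', hk', h'⟩
  exact ⟨⟨k', h'⟩, (Nat.sInf_le h').trans_lt hk'⟩

namespace Ctx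

/-- The output for a list of vertices with their distances. -/
def outs (l : List (ℕ × ℕ)) : List ℕ := l.flatMap fun p => [p.1, p.2]

/-- The search continues: `col'` results from `col` by giving white vertices the colour `np`. -/
def Ext (np : ℕ) (col col' : ℕ → ℕ) : Prop := ∀ w, col' w = col w ∨ col w = 0 ∧ col' w = np

theorem Ext.refl {np : ℕ} {col : ℕ → ℕ} : Ext np col col := fun _ => Or.inl rfl

theorem Ext.trans {np : ℕ} {col col' col'' : ℕ → ℕ} (h : Ext np col col')
    (h' : Ext np col' col'') : Ext np col col'' := by
  intro w
  rcases h w with h1 | h1 <;> rcases h' w with h2 | h2 <;> omega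

theorem Ext.ne_zero {np : ℕ} {col col' : ℕ → ℕ} {w : ℕ} (h : Ext np col col') (hw : col w ≠ 0) :
    col' w = col w := by
  rcases h w with h1 | h1 <;> omega

/-- The state while the vertices at distance `d` are processed. -/
structure Inv (K : Ctx) (s : ℕ) (σ : St) (col : ℕ → ℕ) (l : List (ℕ × ℕ)) (d cp np : ℕ)
    (cur nxt : List ℕ) (X₀ : ℕ) : Prop where
  rep : K.Rep σ col
  search : K.Search s col l d cp np
  stack : K.Stacks σ col cur nxt cp np X₀
  out : σ.out = outs l
  grays : Grays cp np
  level : σ.r .d = d + 1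
  par : σ.r .par = np
  cp : σ.r .cp = cp

variable {K : Ctx}

theorem Inv.congr {s : ℕ} {σ σ' : St} {col : ℕ → ℕ} {l : List (ℕ × ℕ)} {d cp np : ℕ}
    {cur nxt : List ℕ} {X₀ : ℕ} (h : K.Inv s σ col l d cp np cur nxt X₀)
    (hr : ∀ v, v ∈ [Var.n, .N, .m, .h, .l, .d, .par, .cp, .cur, .nxt] → σ'.r v = σ.r v)
    (hm : σ'.mem = σ.mem) (hw : σ'.work = σ.work) (ho : σ'.out = σ.out) :
    K.Inv s σ' col l d cp np cur nxt X₀ where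
  rep := h.rep.congr (fun v hv => hr v (by simp at hv ⊢; tauto)) hm hw
  search := h.search
  stack := h.stack.congr (hr _ (by decide)) (hr _ (by decide))
    fun X _ => by unfold link; rw [hm, hw]
  out := ho.trans h.out
  grays := h.grays
  level := (hr _ (by decide)).trans h.level
  par := (hr _ (by decide)).trans h.par
  cp := (hr _ (by decide)).trans h.cp

end Ctx

open Ctx

/-- `discover` maintains the invariant when `u` is a neighbour of a vertex `v` that is being
processed. -/
theorem discover_inv (K : Ctx) {Q : St → Prop} {s : ℕ} {σ : St} {col : ℕ → ℕ} {l : List (ℕ × ℕ)}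
    {d cp np : ℕ} {cur nxt : List ℕ} {u v : ℕ}
    (hI : K.Inv s σ col l d cp np cur nxt (K.gid v)) (hu : σ.r .u = u)
    (hadj : K.graph.Adj v u) (hcv : col v = cp)
    (hQ : ∀ (σ' : St) col' l' nxt', K.Inv s σ' col' l' d cp np cur nxt' (K.gid v) →
      Ext np col col' → col' u ≠ 0 → (∀ x, x ∉ [Var.t, .g, .c, .a, .nxt] → σ'.r x = σ.r x) →
      (∀ i, K.n + 2 ≤ i → σ'.mem i = σ.mem i) → σ'.time ≤ σ.time + 200 → Q σ') :
    wp K.B K.N discover Q σ := by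
  obtain ⟨hu1, hun⟩ := K.adj_range hadj
  obtain ⟨hv1, hvn⟩ := hadj.1
  have hg := hI.grays
  have hg' := hg
  unfold Grays at hg'
  refine discover_spec K hI.rep hu hu1 hun hI.level hI.par (by omega) rfl
    (hI.stack.linked_nxt.le_n fun X hX => hI.stack.isId_nxt hX) ?_ ?_
  · intro σ' hr ht hcu hm hw ho
    refine hQ σ' col l nxt (hI.congr ?_ hm hw ho) .refl hcu ?_ (by simp [hm]) ht
    · intro x hx
      refine hr x ?_
      revert hx
      cases x <;> decide
    · intro x hx
      exact hr x (by simp at hx ⊢; tauto)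
  · intro σ' hr ht hcu hrep ho hm hl hcase
    have hdist := (hI.search.sound _ _ (hI.search.cur v hv1 hvn hcv)).1
    have hext : Ext np col (Function.update col u np) := by
      intro w
      by_cases hw : w = u
      · subst hw
        simp [hcu]
      · simp [hw]
    have hne : Function.update col u np u ≠ 0 := by rw [Function.update_self]; omega
    have hsearch := hI.search.discover hg hdist hadj hcu
    have hout : σ'.out = outs (l ++ [(u, d + 1)]) := by
      rw [ho, hI.out]
      simp [outs]
    have hcur : σ'.r .cur = σ.r .cur := hr _ (by decide)
    have h1 : σ'.r .d = d + 1 := (hr _ (by decide)).trans hI.level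
    have h2 : σ'.r .par = np := (hr _ (by decide)).trans hI.par
    have h3 : σ'.r .cp = cp := (hr _ (by decide)).trans hI.cp
    rcases hcase with ⟨hex, hn, hlu⟩ | ⟨hex, hn, hlu⟩
    · refine hQ σ' _ _ nxt ⟨hrep, hsearch, ?_, hout, hg, h1, h2, h3⟩ hext hne hr hm ht
      refine hI.stack.discover_old hg hcu hex hcur hn fun X hX => ?_
      by_cases hXu : X = K.gid u
      · rw [hXu, hlu]
      · exact hl X hX hXu
    · refine hQ σ' _ _ (K.gid u :: nxt) ⟨hrep, hsearch, ?_, hout, hg, h1, h2, h3⟩ hext hne hr hm ht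
      refine hI.stack.discover_new hg hcu hu1 hun hex ?_ hcur hn hlu hl
      exact fun hvu => hex ⟨v, hv1, hvn, hvu.symm, by omega⟩

theorem scan_spec (K : Ctx) {Q : St → Prop} {s : ℕ} {σ : St} {col : ℕ → ℕ} {l : List (ℕ × ℕ)}
    {d cp np : ℕ} {cur nxt : List ℕ} {v a b : ℕ}
    (hI : K.Inv s σ col l d cp np cur nxt (K.gid v)) (hcv : col v = cp)
    (ha : σ.r .q = a) (hb : σ.r .e = b) (han : K.n + 2 ≤ a) (hab : a ≤ b) (hbN : b ≤ K.N)
    (hadj : ∀ i, a ≤ i → i < b → K.graph.Adj v (σ.mem i))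
    (hQ : ∀ (σ' : St) col' l' nxt', K.Inv s σ' col' l' d cp np cur nxt' (K.gid v) →
      Ext np col col' → (∀ i, a ≤ i → i < b → col' (σ.mem i) ≠ 0) →
      (∀ x, x ∉ [Var.t, .g, .c, .a, .nxt, .u, .q] → σ'.r x = σ.r x) →
      σ'.time ≤ σ.time + 300 * (b - a) + 10 → Q σ') :
    wp K.B K.N scan Q σ := by
  have hNB := K.N_lt
  refine wp_loop_indexed (fun k τ => ∃ col' l' nxt',
    K.Inv s τ col' l' d cp np cur nxt' (K.gid v) ∧ Ext np col col' ∧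
    a ≤ τ.r .q ∧ τ.r .q + k = b ∧ (∀ i, a ≤ i → i < τ.r .q → col' (σ.mem i) ≠ 0) ∧
    (∀ i, K.n + 2 ≤ i → τ.mem i = σ.mem i) ∧
    (∀ x, x ∉ [Var.t, .g, .c, .a, .nxt, .u, .q] → τ.r x = σ.r x) ∧
    τ.time + 300 * k ≤ σ.time + 300 * (b - a)) ?_ (k := b - a)
    ⟨col, l, nxt, hI, .refl, ha.ge, by omega, by intros; omega, fun _ _ => rfl, fun _ _ => rfl,
      le_rfl⟩
  rintro k τ ⟨col', l', nxt', hI', hext, haq, hk, hseen, hm, hr, ht⟩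
  have hτe : τ.r .e = b := by rw [hr _ (by decide), hb]
  refine ⟨by simp, fun hc => ?_, fun hc => ?_⟩
  · simp [hτe] at hc
    have hadj' := hadj (τ.r .q) haq hc
    rw [← hm _ (by omega)] at hadj'
    have hcv0 : col v ≠ 0 := by
      have := hI.grays
      unfold Grays at this
      omega
    generalize hI₀ : (fun σ' : St => (_ : Prop)) = I
    simp
    refine ⟨by omega, ?_⟩
    refine discover_inv K (s := s) (d := d) (cp := cp) (np := np) (cur := cur) (v := v)
      (u := τ.mem (τ.r .q)) (col := col') (l := l') (nxt := nxt') (hI'.congr ?_ rfl rfl rfl) ?_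
      hadj' ?_ ?_
    · intro x hx
      simp only []
      rw [Function.update_of_ne]
      rintro rfl
      revert hx
      decide
    · simp
    · rw [hext.ne_zero hcv0, hcv]
    intro σ' col'' l'' nxt'' hI'' hext' hcu hr' hm' ht'
    have hq' : σ'.r .q = τ.r .q := by rw [hr' _ (by decide)]; simp
    simp [hq']
    repeat refine And.intro (by omega) ?_
    rw [← hI₀]
    refine ⟨k - 1, by omega, col'', l'', nxt'', hI''.congr ?_ rfl rfl rfl, hext.trans hext',
      by simp; omega, by simp; omega, ?_, ?_, ?_, ?_⟩
    · intro x hx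
      simp only []
      rw [Function.update_of_ne]
      rintro rfl
      revert hx
      decide
    · intro i hi hi'
      simp at hi'
      by_cases hiq : i = τ.r .q
      · subst hiq
        rw [← hm _ (by omega)]
        exact hcu
      · rw [hext'.ne_zero (hseen i hi (by omega))]
        exact hseen i hi (by omega)
    · intro i hi
      exact (hm' i hi).trans (hm i hi)
    · intro x hx
      simp at hx
      simp [hx, hr', hr]
    · simp at ht' ⊢
      omega
  · simp [hτe] at hc
    refine hQ _ col' l' nxt' (hI'.congr (fun _ _ => rfl) rfl rfl rfl) hext ?_ hr ?_
    · exact fun i hi hi' => hseen i hi (by omega)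
    · simp
      omega

namespace Ctx

variable (K : Ctx)

/-- The contribution of a vertex to the running time: the length of its adjacency array and, for a
vertex in a group, the time for finding it. -/
def weight (v : ℕ) : ℕ := 1 + (K.P (v + 1) - K.P v) + if v ≤ K.m then K.L (K.gid v) else 0

/-- The total weight of the vertices that have been processed. -/
def potential (col : ℕ → ℕ) : ℕ := ∑ v ∈ Finset.Icc 1 K.n, if col v = 1 then K.weight v else 0

variable {K}

theorem potential_congr {col col' : ℕ → ℕ} (h : ∀ v, col' v = 1 ↔ col v = 1) :
    K.potential col' = K.potential col :=
  Finset.sum_congr rfl fun v _ => by simp only [h v]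

theorem Ext.potential {np : ℕ} {col col' : ℕ → ℕ} (h : Ext np col col') (hnp : np ≠ 1) :
    K.potential col' = K.potential col :=
  potential_congr fun v => by rcases h v with h1 | h1 <;> omega

theorem potential_update {col : ℕ → ℕ} {v : ℕ} (h1 : 1 ≤ v) (h2 : v ≤ K.n) (hv : col v ≠ 1) :
    K.potential (Function.update col v 1) = K.potential col + K.weight v := by
  have hmem : v ∈ Finset.Icc 1 K.n := by simp [h1, h2]
  unfold potential
  rw [← Finset.add_sum_erase _ _ hmem, ← Finset.add_sum_erase (Finset.Icc 1 K.n) _ hmem,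
    if_pos (Function.update_self ..), if_neg hv]
  rw [Finset.sum_congr rfl (g := fun v => if col v = 1 then K.weight v else 0)]
  · omega
  · intro w hw
    rw [Function.update_of_ne (Finset.ne_of_mem_erase hw)]

theorem weight_pos (v : ℕ) : 1 ≤ K.weight v := by
  unfold weight
  omega

theorem sum_degree (k : ℕ) (hk : k ≤ K.n) :
    ∑ v ∈ Finset.Icc 1 k, (1 + (K.P (v + 1) - K.P v)) + (K.n + 2) = k + K.P (k + 1) := by
  induction k with
  | zero => simp [K.first]
  | succ k ih =>
    rw [Finset.sum_Icc_succ_top (by omega)]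
    have := ih (by omega)
    have := K.mono (k + 1) (by omega) hk
    omega

theorem sum_group (k : ℕ) (hk : 4 * k ≤ K.m) :
    ∑ v ∈ Finset.Icc 1 (4 * k), K.L (K.gid v) + 4 * (K.n + 2) = 4 * K.P (4 * k + 1) := by
  have hm := K.m_le
  have hm4 := K.m_mod
  induction k with
  | zero => simp [K.first]
  | succ k ih =>
    have hg : ∀ j < 4, K.gid (4 * k + 1 + j) = 4 * k + 1 := fun j hj =>
      K.gid_add ⟨by omega, by omega⟩ hj
    rw [show 4 * (k + 1) = 4 * k + 1 + 1 + 1 + 1 by ring]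
    rw [Finset.sum_Icc_succ_top (by omega), Finset.sum_Icc_succ_top (by omega),
      Finset.sum_Icc_succ_top (by omega), Finset.sum_Icc_succ_top (by omega)]
    have h0 := hg 0 (by omega)
    have h1 := hg 1 (by omega)
    have h2 := hg 2 (by omega)
    have h3 := hg 3 (by omega)
    simp only [add_assoc, Nat.reduceAdd, add_zero] at h0 h1 h2 h3 ⊢
    rw [h0, h1, h2, h3]
    have hP := K.P_le (u := 4 * k + 1) (v := 4 * k + 5) (by omega) (by omega) (by omega)
    have := ih (by omega)
    have hL : K.L (4 * k + 1) = K.P (4 * k + 5) - K.P (4 * k + 1) := rfl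
    omega

/-- Summed over all vertices, the degrees give `N - n - 2`, and every group counts for each of its four
members. -/
theorem potential_le (col : ℕ → ℕ) : K.potential col ≤ 5 * K.N := by
  have hm := K.m_le
  have hm4 := K.m_mod
  have h1 : K.potential col ≤ ∑ v ∈ Finset.Icc 1 K.n, K.weight v :=
    Finset.sum_le_sum fun v _ => by split_ifs <;> omega
  have h2 : ∑ v ∈ Finset.Icc 1 K.n, K.weight v =
      ∑ v ∈ Finset.Icc 1 K.n, (1 + (K.P (v + 1) - K.P v)) +
        ∑ v ∈ Finset.Icc 1 K.m, K.L (K.gid v) := by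
    unfold weight
    rw [Finset.sum_add_distrib, ← Finset.sum_filter]
    congr 2
    ext v
    simp
    omega
  have h3 := sum_degree (K := K) K.n le_rfl
  have h4 := sum_group (K := K) (K.m / 4) (by omega)
  rw [show 4 * (K.m / 4) = K.m by omega] at h4
  have h5 := K.P_le_N (v := K.m + 1) (by omega) (by omega)
  rw [K.last] at h3
  omega

end Ctx

namespace Ctx

variable {K : Ctx}

theorem Stacks.pop {σ σ' : St} {col : ℕ → ℕ} {cur nxt : List ℕ} {cp np X : ℕ}
    (h : K.Stacks σ col (X :: cur) nxt cp np 0)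
    (hc : σ'.r .cur = K.link σ X) (hn : σ'.r .nxt = σ.r .nxt)
    (hl : ∀ X, K.IsId X → K.link σ' X = K.link σ X) : K.Stacks σ' col cur nxt cp np X where
  linked_cur := by
    rw [hc]
    exact h.linked_cur.2.congr fun Y hY => hl Y (h.isId_cur (List.mem_cons_of_mem _ hY))
  linked_nxt := by
    rw [hn]
    exact h.linked_nxt.congr fun Y hY => hl Y (h.isId_nxt hY)
  nodup_cur := (List.nodup_cons.1 h.nodup_cur).2
  nodup_nxt := h.nodup_nxt
  disjoint Y hY := h.disjoint Y (List.mem_cons_of_mem _ hY)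
  gray v h1 h2 hv := by
    rcases h.gray v h1 h2 hv with h3 | h3 | h3
    · rcases List.mem_cons.1 h3 with h3 | h3
      · exact Or.inr (Or.inr h3)
      · exact Or.inl h3
    · exact Or.inr (Or.inl h3)
    · rcases K.isId_gid h1 h2 with h4 | h4
      · have := h4.1
        omega
      · omega
  mem_cur Y hY := by
    refine ⟨?_, (h.mem_cur Y (List.mem_cons_of_mem _ hY)).2⟩
    rintro rfl
    exact (List.nodup_cons.1 h.nodup_cur).1 hY
  mem_nxt Y hY := by
    refine ⟨?_, (h.mem_nxt Y hY).2⟩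
    rintro rfl
    exact h.disjoint Y (by simp) hY

theorem IsId.ne_zero {X : ℕ} (h : K.IsId X) : X ≠ 0 := by
  rcases h with h | h
  · have := h.1
    omega
  · omega

/-- A group without gray vertices is dropped. -/
theorem Stacks.drop {σ σ' : St} {col : ℕ → ℕ} {cur nxt : List ℕ} {cp np X : ℕ}
    (h : K.Stacks σ col cur nxt cp np X) (hX : ∀ v, 1 ≤ v → v ≤ K.n → K.gid v = X → col v < 2)
    (hc : σ'.r .cur = σ.r .cur) (hn : σ'.r .nxt = σ.r .nxt)
    (hl : ∀ X, K.IsId X → K.link σ' X = K.link σ X) : K.Stacks σ' col cur nxt cp np 0 := by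
  have h' := h.congr hc hn hl
  refine ⟨h'.linked_cur, h'.linked_nxt, h.nodup_cur, h.nodup_nxt, h.disjoint, ?_, ?_, ?_⟩
  · intro v h1 h2 hv
    rcases h.gray v h1 h2 hv with h3 | h3 | h3
    · exact Or.inl h3
    · exact Or.inr (Or.inl h3)
    · have := hX v h1 h2 h3
      omega
  · exact fun Y hY => ⟨(h.isId_cur hY).ne_zero, (h.mem_cur Y hY).2⟩
  · exact fun Y hY => ⟨(h.isId_nxt hY).ne_zero, (h.mem_nxt Y hY).2⟩

/-- A group whose gray vertices have the colour `np` is put on the second stack. -/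
theorem Stacks.push {σ σ' : St} {col : ℕ → ℕ} {cur nxt : List ℕ} {cp np X : ℕ}
    (h : K.Stacks σ col cur nxt cp np X) (hX : ∀ v, 1 ≤ v → v ≤ K.n → K.gid v = X → col v ≠ cp)
    (hex : ∃ v, 1 ≤ v ∧ v ≤ K.n ∧ K.gid v = X ∧ col v = np)
    (hc : σ'.r .cur = σ.r .cur) (hn : σ'.r .nxt = X) (hlX : K.link σ' X = σ.r .nxt)
    (hl : ∀ Y, K.IsId Y → Y ≠ X → K.link σ' Y = K.link σ Y) :
    K.Stacks σ' col cur (X :: nxt) cp np 0 := by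
  have hcur : ∀ Y ∈ cur, Y ≠ X := fun Y hY => (h.mem_cur Y hY).1
  have hnxt : ∀ Y ∈ nxt, Y ≠ X := fun Y hY => (h.mem_nxt Y hY).1
  refine ⟨?_, ⟨hn, ?_⟩, h.nodup_cur, List.nodup_cons.2 ⟨fun hX => hnxt X hX rfl, h.nodup_nxt⟩,
    ?_, ?_, ?_, ?_⟩
  · rw [hc]
    exact h.linked_cur.congr fun Y hY => hl Y (h.isId_cur hY) (hcur Y hY)
  · rw [hlX]
    exact h.linked_nxt.congr fun Y hY => hl Y (h.isId_nxt hY) (hnxt Y hY)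
  · intro Y hY hY'
    rcases List.mem_cons.1 hY' with h1 | h1
    · exact hcur Y hY h1
    · exact h.disjoint Y hY h1
  · intro v h1 h2 hv
    rcases h.gray v h1 h2 hv with h3 | h3 | h3
    · exact Or.inl h3
    · exact Or.inr (Or.inl (List.mem_cons_of_mem _ h3))
    · exact Or.inr (Or.inl (by simp [h3]))
  · exact fun Y hY => ⟨(h.isId_cur hY).ne_zero, (h.mem_cur Y hY).2⟩
  · intro Y hY
    rcases List.mem_cons.1 hY with h1 | h1
    · subst h1
      obtain ⟨v, v1, v2, v3, v4⟩ := hex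
      exact ⟨(v3 ▸ K.isId_gid v1 v2 : K.IsId Y).ne_zero, ⟨v, v1, v2, v3, v4⟩, hX⟩
    · exact ⟨(h.isId_nxt h1).ne_zero, (h.mem_nxt Y h1).2⟩

end Ctx

/-- The time is charged to the potential, up to a constant, which is paid by the group as a whole. -/
theorem processMember_spec (K : Ctx) {Q : St → Prop} {s : ℕ} {σ : St} {col : ℕ → ℕ}
    {l : List (ℕ × ℕ)} {d cp np : ℕ} {cur nxt : List ℕ} {X j : ℕ}
    (hI : K.Inv s σ col l d cp np cur nxt X) (hX : K.IsGroup X)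
    (hX' : σ.r .X = X) (hj' : σ.r .j = j) (hj : j < 4)
    (hQ : ∀ (σ' : St) col' l' nxt', K.Inv s σ' col' l' d cp np cur nxt' X →
      σ'.r .X = X → σ'.r .j = j → col' (X + j) ≠ cp →
      (∀ w, w ≠ X + j → (col' w = cp ↔ col w = cp)) →
      K.potential col ≤ K.potential col' →
      (col (X + j) = cp → K.potential col < K.potential col') →
      σ'.time + 1000 * K.potential col ≤ σ.time + 1000 * K.potential col' + 100 → Q σ') :
    wp K.B K.N processMember Q σ := by
  have hXm := hX
  obtain ⟨hX1, hX2⟩ := hXm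
  have hm4 := K.m_mod
  have hmn := K.m_le
  have hm : 0 < K.m := by omega
  have hN := K.big_N hm
  have hNB := K.N_lt
  have hPl := K.le_P (v := K.n + 1) (by omega) le_rfl
  rw [K.last] at hPl
  have hg := hI.grays
  have hg' := hg
  unfold Grays at hg'
  have hs := K.slow_lt X
  have hc3 := hI.rep.cols X hX
  have hlt := encCols_lt (X := X) hs hI.rep.col_lt
  have hdig := encCols_digit (X := X) hs hI.rep.col_lt hj
  have hle1 : encCols (K.slow X) col X / 2 ^ (j + j + 1) ≤ encCols (K.slow X) col X :=
    Nat.div_le_self _ _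
  have hpow : 2 ^ (j + j + 1) ≤ 2 ^ 7 := Nat.pow_le_pow_right (by norm_num) (by omega)
  have hgid := K.gid_add hX hj
  have hmod := sub_div_mul_eq_mod (encCols (K.slow X) col X / 2 ^ (j + j + 1)) 2
  have hdm := div_mul_le (encCols (K.slow X) col X / 2 ^ (j + j + 1)) 2
  norm_num at hmod hdm
  simp [processMember, hX', hj', hc3, hI.cp]
  repeat refine And.intro (by omega) ?_
  rw [hmod, hdig]
  constructor
  · intro hcj
    have p1 := K.mono (X + j) (by omega) (by omega)
    have p2 := K.P_le_N (v := X + j + 1) (by omega) (by omega)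
    have p3 := K.le_P (v := X + j) (by omega) (by omega)
    have hval := GroupEnc.values hX (hI.rep.group X hX) hj
    refine getStart_spec K hX (i := j) (by simp [hX']) (by simp) (by simp [hI.rep.h hm])
      (by simp [hI.rep.l hm]) (by omega) (hI.rep.group X hX)
      (by simpa only [hc3] using encCols_mod_two hs) (by simp only [hc3]; omega)
      (hI.rep.next hX) ?_
    intro σ₁ r₁ hp₁ m₁ w₁ o₁ t₁
    have e1 : σ₁.r .j = j := by rw [r₁] <;> simp [hj']
    have e2 : σ₁.r .X = X := by rw [r₁] <;> simp [hX']
    have e3 : σ₁.r .h = K.h := by rw [r₁] <;> simp [hI.rep.h hm]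
    have e4 : σ₁.r .l = K.l := by rw [r₁] <;> simp [hI.rep.l hm]
    simp [e1, hp₁]
    repeat refine And.intro (by omega) ?_
    refine getStart_spec K hX (i := j + 1) (by simp [e2]) (by simp) (by simp [e3])
      (by simp [e4]) (by omega) (by simpa only [m₁] using hI.rep.group X hX)
      (by simpa only [m₁, hc3] using encCols_mod_two hs) (by simp only [m₁, hc3]; omega)
      (by simpa only [m₁] using hI.rep.next hX) ?_
    intro σ₂ r₂ hp₂ m₂ w₂ o₂ t₂
    simp
    have hI₂ : K.Inv s { σ₂ with r := Function.update σ₂.r .e (σ₂.r .p), time := σ₂.time + 2 }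
        col l d cp np cur nxt (K.gid (X + j)) := by
      rw [hgid]
      refine hI.congr ?_ (by simp [m₂, m₁]) (by simp [w₂, w₁]) (by simp [o₂, o₁])
      intro x hx
      simp at hx
      rcases hx with rfl | rfl | rfl | rfl | rfl | rfl | rfl | rfl | rfl | rfl <;> simp [r₂, r₁]
    refine scan_spec K hI₂ hcj (a := K.P (X + j)) (b := K.P (X + j + 1)) ?_ ?_ p3 p1 p2 ?_ ?_
    · simp [r₂]
    · simp [hp₂, add_assoc]
    · intro i hi hi'
      obtain ⟨i', h1, h2, h3⟩ := hval.1 i hi hi'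
      exact ⟨⟨by omega, by omega⟩, i', h1, h2, by simp [m₂, m₁, h3]⟩
    intro σ₃ col' l' nxt' hI₃ hext hseen r₃ t₃
    have f1 : σ₃.r .X = X := by rw [r₃] <;> simp [r₂, e2]
    have f2 : σ₃.r .j = j := by rw [r₃] <;> simp [r₂, e1]
    have hc3' := hI₃.rep.cols X hX
    have hlt' := encCols_lt (X := X) hs hI₃.rep.col_lt
    have hcj' : col' (X + j) = cp := by rw [hext.ne_zero (by omega), hcj]
    have hup := encCols_update (s := K.slow X) (col := col') (X := X) (x := 1) hj
    rw [hcj'] at hup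
    have hcp2 : cp / 2 = 1 := by omega
    obtain ⟨c, rfl⟩ : ∃ c, cp = c + 1 := ⟨cp - 1, by omega⟩
    have hcc : c * 2 ^ (j + j + 1) ≤ 2 * 2 ^ 7 := Nat.mul_le_mul (by omega) hpow
    rw [hcp2, add_mul] at hup
    norm_num at hup
    simp [f1, f2, hc3', hI₃.cp]
    repeat refine And.intro (by omega) ?_
    have hlink : ∀ τ : St, τ.mem = Function.update σ₃.mem (X + 3)
        (encCols (K.slow X) col' X - (512 + c * 2 ^ (j + j + 1))) → τ.work = σ₃.work →
        ∀ Y, K.IsId Y → K.link τ Y = K.link σ₃ Y := by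
      intro τ hτ hτ' Y hY
      unfold link
      split_ifs with h
      · unfold IsId IsGroup at hY
        rw [hτ, Function.update_of_ne (by omega)]
      · rw [hτ']
    refine hQ _ (Function.update col' (X + j) 1) l' nxt' ⟨?_, ?_, ?_, hI₃.out, hg, hI₃.level,
      hI₃.par, hI₃.cp⟩ f1 f2 ?_ ?_ ?_ ?_ ?_
    · refine hI₃.rep.update_group hX (fun _ _ => rfl) ?_ rfl ?_ ?_ ?_
      · intro i hi hi'
        simp only []
        rw [Function.update_of_ne hi']
      · intro v hv
        rw [Function.update_of_ne (by omega)]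
      · intro v
        have := hI₃.rep.col_lt v
        rw [Function.update_apply]
        split_ifs <;> omega
      · simp
        omega
    · refine hI₃.search.finish hg hcj' ?_
      rintro u ⟨-, i, h1, h2, rfl⟩
      obtain ⟨i', h1', h2', h3'⟩ := hval.2 i h1 h2
      rw [← h3']
      simpa [m₂, m₁] using hseen i' h1' h2'
    · have := fun (τ : St) (hτ : τ.r = σ₃.r) hm hw =>
        hI₃.stack.finish (σ' := τ) (by rw [hτ]) (by rw [hτ]) (hlink τ hm hw)
      simp only [hgid] at this
      exact this _ rfl rfl rfl
    · rw [Function.update_self]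
      omega
    · intro w hw
      rw [Function.update_of_ne hw]
      rcases hext w with h | h <;> omega
    all_goals
      rw [potential_update (by omega) (by omega) (by omega), hext.potential (by omega)]
    · omega
    · have := K.weight_pos (X + j)
      omega
    · unfold weight
      rw [if_pos (by omega), hgid]
      simp at t₁ t₂ t₃ ⊢
      omega
  · intro hcj
    refine hQ _ col l nxt (hI.congr ?_ rfl rfl rfl) (by simp [hX']) (by simp [hj']) hcj
      (fun _ _ => Iff.rfl) le_rfl (fun h => absurd h hcj) (by simp; omega)
    intro x hx
    simp at hx
    rcases hx with rfl | rfl | rfl | rfl | rfl | rfl | rfl | rfl | rfl | rfl <;> simp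

/-- Since a group on the first stack has a vertex of the colour `cp`, a pop increases the potential,
which pays for the time. -/
theorem pop_spec (K : Ctx) {Q : St → Prop} {s : ℕ} {σ : St} {col : ℕ → ℕ}
    {l : List (ℕ × ℕ)} {d cp np : ℕ} {cur nxt : List ℕ} {X : ℕ}
    (hI : K.Inv s σ col l d cp np (X :: cur) nxt 0)
    (hQ : ∀ (σ' : St) col' l' nxt', K.Inv s σ' col' l' d cp np cur nxt' 0 →
      K.potential col < K.potential col' →
      σ'.time + 2000 * K.potential col ≤ σ.time + 2000 * K.potential col' → Q σ') :
    wp K.B K.N pop Q σ := by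
  have hm4 := K.m_mod
  have hmn := K.m_le
  have hNB := K.N_lt
  have hPl := K.le_P (v := K.n + 1) (by omega) le_rfl
  rw [K.last] at hPl
  have hnl := K.n_lt
  have hg := hI.grays
  have hg' := hg
  unfold Grays at hg'
  have hcur : σ.r .cur = X := hI.stack.linked_cur.1
  have hXid := hI.stack.isId_cur (X := X) (by simp)
  obtain ⟨-, v, hv1, hvn, hvX, hcv⟩ := hI.stack.mem_cur X (by simp)
  -- The invariant after the removal of `X` from the stack.
  have hpop : ∀ τ : St, (∀ x, x ∈ [Var.n, .N, .m, .h, .l, .d, .par, .cp, .nxt] → τ.r x = σ.r x) →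
      τ.r .cur = K.link σ X → τ.mem = σ.mem → τ.work = σ.work → τ.out = σ.out →
      K.Inv s τ col l d cp np cur nxt X := by
    intro τ hr hc hm hw ho
    refine ⟨hI.rep.congr (fun x hx => hr x (by simp at hx ⊢; tauto)) hm hw, hI.search,
      hI.stack.pop hc (hr _ (by decide)) fun Y _ => by unfold link; rw [hm, hw],
      ho.trans hI.out, hg, (hr _ (by decide)).trans hI.level, (hr _ (by decide)).trans hI.par,
      (hr _ (by decide)).trans hI.cp⟩
  simp [pop, hcur, hI.rep.m]
  constructor
  · intro hmX
    obtain rfl := K.eq_of_gid hv1 hmX hvX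
    have hw : σ.work (v - K.m - 1) ≠ 0 := fun h => by
      have := (hI.rep.work v hmX hvn).1 h
      omega
    have ht1 := hI.rep.table v hmX (by omega)
    have ht2 := hI.rep.table (v + 1) (by omega) (by omega)
    have p1 := K.mono v hv1 hvn
    have p2 := K.P_le_N (v := v + 1) (by omega) (by omega)
    have p3 := K.le_P (v := v) (by omega) (by omega)
    have p4 := K.P_le (u := K.m + 1) (v := v) (by omega) (by omega) (by omega)
    simp [ht1, ht2]
    repeat refine And.intro (by omega) ?_
    rw [← hvX] at hpop
    refine scan_spec K (hpop _ ?_ ?_ rfl rfl rfl) hcv (a := K.P v) (b := K.P (v + 1)) ?_ ?_ p3 p1 p2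
      ?_ ?_
    · intro x hx
      simp at hx
      rcases hx with rfl | rfl | rfl | rfl | rfl | rfl | rfl | rfl | rfl <;> simp
    · simp
      unfold link
      rw [hvX, if_neg (by omega)]
    · simp
    · simp
    · intro i hi hi'
      exact ⟨⟨hv1, hvn⟩, i, hi, hi', (hI.rep.rest i (by omega) (by omega)).symm⟩
    intro σ₁ col' l' nxt' hI₁ hext hseen r₁ t₁
    have hcv' : col' v = cp := by rw [hext.ne_zero (by omega), hcv]
    refine hQ _ (Function.update col' v 1) l' nxt' ⟨hI₁.rep.finish_single hmX (by omega), ?_, ?_,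
      hI₁.out, hg, hI₁.level, hI₁.par, hI₁.cp⟩ ?_ ?_
    · refine hI₁.search.finish hg hcv' ?_
      rintro u ⟨-, i, h1, h2, rfl⟩
      rw [← hI.rep.rest i (by omega) (by omega)]
      exact hseen i h1 h2
    · refine (hI₁.stack.finish rfl rfl fun _ _ => rfl).drop ?_ rfl rfl fun _ _ => rfl
      intro w hw1 hwn hw
      rw [hvX] at hw
      obtain rfl := K.eq_of_gid hw1 hmX hw
      simp
    all_goals
      rw [potential_update hv1 hvn (by omega), hext.potential (by omega)]
      have := K.weight_pos v
    · omega
    · have : 1 + (K.P (v + 1) - K.P v) ≤ K.weight v := by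
        unfold weight
        omega
      simp at t₁
      omega
  · intro hmX
    have hX : K.IsGroup X := by
      rcases hXid with h | h
      · exact h
      · omega
    have hXm := hX
    obtain ⟨hX1, hX2⟩ := hXm
    have hm : 0 < K.m := by omega
    have hN := K.big_N hm
    obtain ⟨i₀, hi₀, hvi⟩ := K.eq_add_of_gid hv1 hX hvX
    have hs := K.slow_lt X
    repeat refine And.intro (by omega) ?_
    -- The vertex `v` has the number `i₀` in the group; its processing increases the potential.
    refine wp_loop_indexed (fun k τ => ∃ col' l' nxt',
      K.Inv s τ col' l' d cp np cur nxt' X ∧ τ.r .X = X ∧ τ.r .j + k = 4 ∧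
      (∀ i < τ.r .j, col' (X + i) ≠ cp) ∧ K.potential col ≤ K.potential col' ∧
      (if τ.r .j ≤ i₀ then col' v = cp else K.potential col < K.potential col') ∧
      τ.time + 1000 * K.potential col + 200 * k ≤
        σ.time + 1000 * K.potential col' + 900) ?_ (k := 4) ?_
    · rintro k τ ⟨col', l', nxt', hI₁, hτX, hk, hdone, hpot, hvcp, ht⟩
      refine ⟨by simp; omega, fun hc => ?_, fun hc => ?_⟩
      · simp at hc
        generalize hI₀ : (fun σ' : St => (_ : Prop)) = I
        rw [wp_seq]
        refine processMember_spec K (j := τ.r .j) (hI₁.congr (fun _ _ => rfl) rfl rfl rfl) hX hτX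
          rfl hc ?_
        intro σ₂ col'' l'' nxt'' hI₂ hσX hσj hne hiff hpot' hpot'' ht'
        simp [hσj]
        repeat refine And.intro (by omega) ?_
        rw [← hI₀]
        refine ⟨k - 1, by omega, col'', l'', nxt'', hI₂.congr ?_ rfl rfl rfl, by simp [hσX],
          by simp; omega, ?_, by omega, ?_, ?_⟩
        · intro x hx
          simp at hx
          rcases hx with rfl | rfl | rfl | rfl | rfl | rfl | rfl | rfl | rfl | rfl <;> simp
        · intro i hi
          simp at hi
          by_cases hij : i = τ.r .j
          · rw [hij]
            exact hne
          · rw [Ne, hiff _ (by omega)]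
            exact hdone i (by omega)
        · simp
          split_ifs with h
          · rw [if_pos (by omega)] at hvcp
            rwa [hiff _ (by omega)]
          · by_cases hij : τ.r .j = i₀
            · rw [if_pos (by omega)] at hvcp
              have := hpot'' (by rw [hij, ← hvi, hvcp])
              omega
            · rw [if_neg (by omega)] at hvcp
              omega
        · simp at ht' ⊢
          omega
      · simp at hc
        rw [if_neg (by omega)] at hvcp
        have hc3 := hI₁.rep.cols X hX
        have hlt := encCols_lt (X := X) hs hI₁.rep.col_lt
        have hno : ∀ w, 1 ≤ w → w ≤ K.n → K.gid w = X → col' w ≠ cp := by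
          intro w w1 wn wX
          obtain ⟨i, hi, rfl⟩ := K.eq_add_of_gid w1 hX wX
          exact hdone i (by omega)
        simp [hτX, hc3]
        repeat refine And.intro (by omega) ?_
        constructor
        · intro hlt512
          refine hQ _ col' l' nxt' ⟨hI₁.rep.congr (fun _ _ => rfl) rfl rfl, hI₁.search,
            hI₁.stack.drop ?_ rfl rfl fun _ _ => rfl, hI₁.out, hg, hI₁.level, hI₁.par, hI₁.cp⟩
            hvcp ?_
          · intro w w1 wn wX
            obtain ⟨i, hi, rfl⟩ := K.eq_add_of_gid w1 hX wX
            by_contra h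
            have := encCols_gray (s := K.slow X) (col := col') (X := X) hi (by omega)
            omega
          · simp
            omega
        · intro hge
          obtain ⟨i, hi, hgr⟩ := exists_gray hs hI₁.rep.col_lt hge
          have hnxt : τ.r .nxt ≤ K.n :=
            hI₁.stack.linked_nxt.le_n fun Y hY => hI₁.stack.isId_nxt hY
          repeat refine And.intro (by omega) ?_
          have hnp : col' (X + i) = np := by
            have := hdone i (by omega)
            have := hI₁.rep.col_lt (X + i)
            omega
          refine hQ _ col' l' (X :: nxt') ⟨hI₁.rep.update_group hX ?_ ?_ rfl (fun _ _ => rfl)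
            hI₁.rep.col_lt ?_, hI₁.search, hI₁.stack.push hno
            ⟨X + i, by omega, by omega, K.gid_add hX hi, hnp⟩ ?_ ?_ ?_ ?_, hI₁.out, hg, ?_, ?_, ?_⟩
            hvcp ?_
          · intro x hx
            simp at hx
            rcases hx with rfl | rfl | rfl | rfl | rfl <;> simp
          · intro i hi hi'
            simp only []
            rw [Function.update_of_ne hi]
          · simp [hc3]
          · simp
          · simp
          · unfold link
            simp [show X ≤ K.m by omega]
          · intro Y hY hYX
            unfold link
            split_ifs with h
            · simp [hYX]
            · rfl
          · simp [hI₁.level]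
          · simp [hI₁.par]
          · simp [hI₁.cp]
          · simp
            omega
    · refine ⟨col, l, nxt, hpop _ ?_ ?_ rfl rfl rfl, by simp, by simp, by simp, le_rfl, ?_, ?_⟩
      · intro x hx
        simp at hx
        rcases hx with rfl | rfl | rfl | rfl | rfl | rfl | rfl | rfl | rfl <;> simp
      · simp
        unfold link
        rw [if_pos (by omega)]
      · simp [hcv]
      · simp
        omega

namespace Ctx

variable {K : Ctx}

/-- When no gray vertices are left, the search is complete. -/
theorem Search.isBFS {s d cp np : ℕ} {col : ℕ → ℕ} {l : List (ℕ × ℕ)}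
    (h : K.Search s col l d cp np)
    (hno : ∀ v, 1 ≤ v → v ≤ K.n → col v < 2) : IsBFS (K.graph.HasDist s) l := by
  refine ⟨h.nodup, fun v i => ⟨fun hv => (h.sound v i hv).1, ?_⟩, h.asc⟩
  induction i generalizing v with
  | zero => exact fun hv => h.complete v 0 hv (Nat.zero_le _)
  | succ i ih =>
    intro hv
    obtain ⟨u, hu, hadj⟩ := hasDist_pred hv
    obtain ⟨hu1, hun⟩ := hadj.1
    obtain ⟨hv1, hvn⟩ := K.adj_range hadj
    have h0 := (h.col_ne u hu1 hun).2 ⟨i, ih u hu⟩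
    have h1 := hno u hu1 hun
    obtain ⟨j, hj⟩ := (h.col_ne v hv1 hvn).1 (h.closed u v (by omega) hadj)
    rwa [hasDist_unique hv (h.sound v j hj).1]

theorem Search.init {s : ℕ} (hs : 1 ≤ s) :
    K.Search s (Function.update (fun _ => 0) s 2) [(s, 0)] 0 2 3 := by
  have hcol : ∀ v, Function.update (fun _ : ℕ => 0) s 2 v = if v = s then 2 else 0 := fun v => by
    rw [Function.update_apply]
  refine ⟨by simp, by simp, ?_, ?_, ?_, ?_, ?_, ?_⟩
  · intro v i hv
    simp only [List.mem_singleton, Prod.mk.injEq] at hv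
    obtain ⟨rfl, rfl⟩ := hv
    exact ⟨hasDist_self, by omega⟩
  · intro v i hv hi
    obtain rfl : i = 0 := by omega
    rw [hasDist_zero hv]
    simp
  · intro v _ _
    rw [hcol]
    by_cases hv : v = s <;> simp [hv]
  · intro v _ _
    rw [hcol]
    by_cases hv : v = s <;> simp [hv]
  · intro v _ _
    rw [hcol]
    by_cases hv : v = s <;> simp [hv]
  · intro v u hv
    rw [hcol] at hv
    split_ifs at hv
    omega

/-- The stacks are exchanged when the first one is empty. -/
theorem Stacks.swap {σ σ' : St} {col : ℕ → ℕ} {nxt : List ℕ} {cp np : ℕ}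
    (h : K.Stacks σ col [] nxt np cp 0) (hc : σ'.r .cur = σ.r .nxt) (hn : σ'.r .nxt = 0)
    (hl : ∀ X, K.IsId X → K.link σ' X = K.link σ X) : K.Stacks σ' col nxt [] cp np 0 where
  linked_cur := by
    rw [hc]
    exact h.linked_nxt.congr fun X hX => hl X (h.isId_nxt hX)
  linked_nxt := hn
  nodup_cur := h.nodup_nxt
  nodup_nxt := List.nodup_nil
  disjoint := by simp
  gray v h1 h2 hv := by
    rcases h.gray v h1 h2 hv with h3 | h3 | h3
    · simp at h3
    · exact Or.inl h3
    · exact Or.inr (Or.inr h3)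
  mem_cur X hX := ⟨(h.mem_nxt X hX).1, (h.mem_nxt X hX).2.1⟩
  mem_nxt := by simp

theorem Linked.eq_nil {σ : St} {L : List ℕ} (h : Linked K σ 0 L) (hL : ∀ X ∈ L, K.IsId X) :
    L = [] := by
  cases L with
  | nil => rfl
  | cons X L => exact absurd h.1.symm (hL X (by simp)).ne_zero

theorem Linked.ne_nil {σ : St} {x : ℕ} {L : List ℕ} (h : Linked K σ x L) (hx : x ≠ 0) :
    ∃ X L', L = X :: L' := by
  cases L with
  | nil => exact absurd h hx
  | cons X L => exact ⟨X, L, rfl⟩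

end Ctx

theorem search_spec (K : Ctx) {Q : St → Prop} {s : ℕ} {σ : St} (hR : K.Rep σ fun _ => 0)
    (hs' : σ.r .s = s) (hs : 1 ≤ s ∧ s ≤ K.n) (ho : σ.out = [])
    (hcur : σ.r .cur = 0)
    (hQ : ∀ (σ' : St) l col, IsBFS (K.graph.HasDist s) l → σ'.out = outs l → K.Rep σ' col →
      σ'.time ≤ σ.time + 20000 * K.N → Q σ') :
    wp K.B K.N search Q σ := by
  have hNB := K.N_lt
  have hPl := K.le_P (v := K.n + 1) (by omega) le_rfl
  rw [K.last] at hPl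
  simp [search, hs']
  repeat refine And.intro (by omega) ?_
  refine discover_spec K (hR.congr ?_ rfl rfl) (u := s) (by simp) hs.1 hs.2 (d := 0) (by simp)
    (par := 2) (by simp) (by omega) (x := 0) (by simp) (by omega) ?_ ?_
  · intro x hx
    simp at hx
    rcases hx with rfl | rfl | rfl | rfl | rfl <;> simp
  · intro σ' _ _ h
    exact absurd rfl h
  intro σ₁ r₁ t₁ _ hR₁ ho₁ _ hl₁ hcase
  have hcase' : σ₁.r .nxt = K.gid s ∧ K.link σ₁ (K.gid s) = 0 := by
    rcases hcase with h | h
    · obtain ⟨⟨v, _, _, _, h⟩, _⟩ := h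
      omega
    · exact h.2
  clear hcase
  simp [ho] at ho₁
  have hgray : ∀ v, 2 ≤ Function.update (fun _ : ℕ => 0) s 2 v → v = s := by
    intro v hv
    by_contra h
    rw [Function.update_of_ne h] at hv
    omega
  have hstack : K.Stacks σ₁ (Function.update (fun _ => 0) s 2) [] [K.gid s] 3 2 0 := by
    refine ⟨?_, ⟨hcase'.1, hcase'.2⟩, List.nodup_nil, List.nodup_singleton _, by simp, ?_, by simp,
      ?_⟩
    · rw [r₁ _ (by decide)]
      simpa [Linked] using hcur
    · intro v _ _ hv
      simp [hgray v hv]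
    · intro X hX
      rw [List.mem_singleton] at hX
      subst hX
      refine ⟨(K.isId_gid hs.1 hs.2).ne_zero, ⟨s, hs.1, hs.2, rfl, by simp⟩, fun v _ _ _ hv => ?_⟩
      rw [hgray v (by omega)] at hv
      simp at hv
  -- The vertices of the colour `par` are at distance `d`, and all vertices at smaller distances are
  -- black.
  refine wp_loop_indexed (fun k τ => ∃ col l d cp np nxt, K.Rep τ col ∧ K.Search s col l d cp np ∧
    K.Stacks τ col [] nxt np cp 0 ∧ τ.out = outs l ∧ Grays cp np ∧ τ.r .d = d ∧ τ.r .par = cp ∧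
    τ.r .cp = np ∧ k + K.potential col = 5 * K.N ∧
    τ.time ≤ σ.time + 300 + 3000 * K.potential col) ?_
    (k := 5 * K.N - K.potential (Function.update (fun _ => 0) s 2)) ?_
  · rintro k τ ⟨col, l, d, cp, np, nxt, hτ, hsearch, hst, hout, hg, hd, hpar, hcp, hk, ht⟩
    refine ⟨by simp; omega, fun hc => ?_, fun hc => ?_⟩
    · simp at hc
      obtain ⟨X, nxt', rfl⟩ := hst.linked_nxt.ne_nil (by omega)
      obtain ⟨-, ⟨v, hv1, hvn, -, hcv⟩, -⟩ := hst.mem_nxt X (by simp)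
      have hdn := K.hasDist_lt_n hs (hsearch.sound _ _ (hsearch.cur v hv1 hvn hcv)).1
      generalize hI₀ : (fun σ' : St => (_ : Prop)) = I
      simp [hd]
      repeat refine And.intro (by omega) ?_
      -- The first stack is not empty initially, so the potential has increased when it is empty.
      refine wp_loop_indexed (fun k' τ' => ∃ col' l' cur nxt'',
        K.Inv s τ' col' l' d cp np cur nxt'' 0 ∧ K.potential col ≤ K.potential col' ∧
        (τ'.r .cur = 0 → K.potential col < K.potential col') ∧ k' + K.potential col' = 5 * K.N ∧
        τ'.time + 2100 * K.potential col ≤ τ.time + 100 + 2100 * K.potential col') ?_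
        (k := 5 * K.N - K.potential col) ?_
      · rintro k' τ' ⟨col', l', cur, nxt'', hI, hpot, hpot', hk', ht'⟩
        refine ⟨by simp; omega, fun hc => ?_, fun hc => ?_⟩
        · simp at hc
          obtain ⟨Y, cur, rfl⟩ := hI.stack.linked_cur.ne_nil (by omega)
          refine pop_spec K (hI.congr (fun _ _ => rfl) rfl rfl rfl) ?_
          intro σ₂ col'' l'' nxt₂ hI₂ hlt ht₂
          have := potential_le (K := K) col''
          simp at ht₂
          exact ⟨5 * K.N - K.potential col'', by omega, col'', l'', cur, nxt₂, hI₂, by omega,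
            fun _ => by omega, by omega, by omega⟩
        · simp at hc
          have hcur := hI.stack.linked_cur
          rw [hc] at hcur
          obtain rfl := hcur.eq_nil fun Y hY => hI.stack.isId_cur hY
          have hpot₂ := hpot' hc
          have := potential_le (K := K) col'
          have hg' := hg
          unfold Grays at hg'
          rw [← hI₀]
          refine ⟨5 * K.N - K.potential col', by omega, col', l', d + 1, np, cp, nxt'',
            hI.rep.congr (fun _ _ => rfl) rfl rfl,
            hI.search.advance hs hg hI.rep.col_lt ?_,
            hI.stack.congr rfl rfl fun _ _ => rfl, hI.out, by unfold Grays; omega, hI.level,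
            hI.par, hI.cp,
            by omega, ?_⟩
          · intro w w1 wn hw
            rcases hI.stack.gray w w1 wn (by omega) with h | h | h
            · simp at h
            · exact (hI.stack.mem_nxt _ h).2.2 w w1 wn rfl hw
            · exact (K.isId_gid w1 wn).ne_zero h
          · simp
            omega
      · have := potential_le (K := K) col
        refine ⟨col, l, X :: nxt', [], ⟨hτ.congr ?_ rfl rfl, hsearch,
          hst.swap ?_ ?_ fun _ _ => rfl, hout, hg, ?_, ?_, ?_⟩, le_rfl, ?_, by omega, ?_⟩
        · intro x hx
          simp at hx
          rcases hx with rfl | rfl | rfl | rfl | rfl <;> simp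
        · simp
        · simp
        · simp
        · simp [hcp]
        · simp [hpar]
        · simp
          omega
        · simp
    · simp at hc
      have hnxt := hst.linked_nxt
      rw [hc] at hnxt
      obtain rfl := hnxt.eq_nil fun Y hY => hst.isId_nxt hY
      refine hQ _ l col (hsearch.isBFS ?_) hout (hτ.congr (fun _ _ => rfl) rfl rfl) ?_
      · intro v h1 h2
        by_contra h
        rcases hst.gray v h1 h2 (by omega) with h | h | h
        · simp at h
        · simp at h
        · exact (K.isId_gid h1 h2).ne_zero h
      · simp
        omega
  · have := potential_le (K := K) (Function.update (fun _ => 0) s 2)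
    refine ⟨_, [(s, 0)], 0, 2, 3, [K.gid s], hR₁, Search.init hs.1, hstack, ?_, Or.inl ⟨rfl, rfl⟩,
      ?_, ?_, ?_, by omega, ?_⟩
    · simp [ho₁, outs]
    · rw [r₁ _ (by decide)]
      simp
    · rw [r₁ _ (by decide)]
      simp
    · rw [r₁ _ (by decide)]
      simp
    · simp at t₁
      omega

/-! ### The complete program -/

/-- The parameters of the program are computed, and the last pointer is completed. -/
theorem setup_spec (I : Input) {Q : St → Prop} {σ : St} (hmem : ∀ i < I.N, σ.mem i = I.A i)
    (hQ : ∀ (K : Ctx) (σ' : St), K.toInput = I →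
      (∀ v, v ∉ [Var.s, .n, .N, .m, .h, .t, .l] → σ'.r v = σ.r v) →
      σ'.r .s = σ.work 0 → σ'.r .n = K.n → σ'.r .N = K.N → σ'.r .m = K.m →
      (0 < K.m → σ'.r .h = K.h ∧ σ'.r .l = K.l) →
      σ'.mem = Function.update σ.mem (K.n + 1) K.N → σ'.work = Function.update σ.work 0 0 →
      σ'.out = σ.out → σ'.time ≤ σ.time + 1000 * K.N → Q σ') :
    wp I.B I.N setup Q σ := by
  obtain ⟨n, N, B, A, P, n_pos, N_lt, head, table, total, first, last, mono, asc, range⟩ := I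
  simp only at hmem ⊢
  have hnN : n + 2 ≤ N := by omega
  have h0 : σ.mem 0 = n := by rw [hmem 0 (by omega), head]
  have h1 : σ.mem (n + 1) = A (n + 1) := hmem _ (by omega)
  have hw : 0 < workSize := by decide
  simp [setup, h0, h1]
  have hN : n + A (n + 1) + 2 = N := by omega
  simp [hN]
  repeat refine And.intro (by omega) ?_
  simp only [Nat.div_div_eq_div_mul, Nat.reduceMul]
  constructor
  · intro hbig
    have hN10 : 8 ^ 10 ≤ N := by omega
    repeat refine And.intro (by omega) ?_
    refine wp_loop (fun τ => (∀ v, v ∉ [Var.s, .n, .N, .m, .h, .t, .l] → τ.r v = σ.r v) ∧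
      τ.r .s = σ.work 0 ∧ τ.r .n = n ∧ τ.r .N = N ∧ τ.r .m = n / 4 * 4 ∧
      τ.mem = Function.update σ.mem (n + 1) N ∧ τ.work = Function.update σ.work 0 0 ∧
      τ.out = σ.out ∧ 8 ^ τ.r .h ≤ N ∧ τ.r .t = N / 8 ^ (τ.r .h + 1) ∧
      τ.time ≤ σ.time + 100 + 20 * τ.r .h) (fun τ => N - τ.r .h) ?_ _ ?_
    · rintro τ ⟨hr, hs, hn, hτN, hm, hmem', hwork, ho, hh, ht, htime⟩
      have hhN : τ.r .h < N := lt_of_lt_of_le (Nat.lt_pow_self (by norm_num)) hh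
      refine ⟨by simp; omega, fun hc => ?_, fun hc => ?_⟩
      · simp [ht] at hc
        generalize hI : (fun σ' : St => (_ : Prop)) = I
        simp
        repeat refine And.intro (by omega) ?_
        rw [← hI]
        simp [hs, hn, hτN, hm, hmem', hwork, ho]
        refine ⟨⟨?_, hc, ?_, by omega⟩, by omega⟩
        · intro v v1 v2 v3 v4 v5 v6 v7
          rw [Function.update_of_ne v6, Function.update_of_ne v5]
          exact hr v (by simp [v1, v2, v3, v4, v5, v6, v7])
        · rw [ht, Nat.div_div_eq_div_mul]
          rfl
      · simp [ht] at hc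
        have h10 : 10 ≤ τ.r .h := by
          by_contra h
          have := Nat.pow_le_pow_right (n := 8) (by norm_num) (show τ.r .h + 1 ≤ 10 by omega)
          omega
        have h8 : ∀ k, 8 ^ k = 2 ^ (3 * k) := fun k => by norm_num [pow_mul]
        rw [h8] at hh hc
        have hlarge : 0 < n / 4 * 4 → 2 ^ (3 * τ.r .h) ≤ N ∧ N < 2 ^ (3 * τ.r .h + 3) ∧
          10 ≤ τ.r .h := fun _ => ⟨hh, hc, h10⟩
        have hm1 : n / 4 * 4 % 4 = 0 := by omega
        have hm2 : n / 4 * 4 ≤ n := by omega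
        have hm3 : n < n / 4 * 4 + workSize := by unfold workSize; omega
        let K : Ctx := ⟨⟨n, N, B, A, P, n_pos, N_lt, head, table, total, first, last, mono, asc,
          range⟩, n / 4 * 4, τ.r .h, hm1, hm2, hm3, hlarge⟩
        have h3 : 3 * τ.r .h < 2 ^ (3 * τ.r .h) := Nat.lt_two_pow_self
        have h4 : 3 * τ.r .h + 3 < N := by
          have h5 : 3 * τ.r .h - 3 < 2 ^ (3 * τ.r .h - 3) := Nat.lt_two_pow_self
          have h6 : 2 ^ (3 * τ.r .h) = 8 * 2 ^ (3 * τ.r .h - 3) := by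
            rw [show (8 : ℕ) = 2 ^ 3 by norm_num, ← pow_add]
            congr 1
            omega
          omega
        simp
        repeat refine And.intro (by omega) ?_
        refine hQ K _ rfl ?_ ?_ ?_ ?_ ?_ ?_ ?_ ?_ ?_ ?_
        · intro v hv
          have := hr v hv
          simp at hv
          simp [hv, this]
        · simp [hs]
        · simp [hn, K]
        · simp [hτN, K]
        · simp [hm, K]
        · intro _
          simp [K, l]
          ring
        · simp [hmem', K]
        · simp [hwork]
        · simp [ho]
        · simp [K]
          omega
    · simp
      refine ⟨?_, by omega⟩
      intro v v1 v2 v3 v4 v5 v6 v7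
      simp [v1, v2, v3, v4, v5, v6]
  · intro hsmall
    have hm3 : n < 0 + workSize := by unfold workSize; omega
    let K : Ctx := ⟨⟨n, N, B, A, P, n_pos, N_lt, head, table, total, first, last, mono, asc,
      range⟩, 0, 0, rfl, Nat.zero_le _, hm3, fun h => absurd h (lt_irrefl 0)⟩
    refine hQ K _ rfl ?_ ?_ ?_ ?_ ?_ ?_ ?_ ?_ ?_ ?_
    · intro v hv
      simp at hv
      simp [hv]
    · simp
    · simp [K]
    · simp [K]
    · simp [K]
    · intro h
      simp [K] at h
    · simp [K]
    · simp
    · simp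
    · simp [K]
      omega

/-- The encoding of all groups takes linear time, as it takes time `O(1 + L X)` for the group `X`. -/
theorem encode_spec (K : Ctx) {Q : St → Prop} {σ : St} (hn : σ.r .n = K.n) (hN : σ.r .N = K.N)
    (hm : σ.r .m = K.m) (hhl : 0 < K.m → σ.r .h = K.h ∧ σ.r .l = K.l)
    (hmem : ∀ i < K.N, i ≠ K.n + 1 → σ.mem i = K.A i) (hmem' : σ.mem (K.n + 1) = K.N)
    (hw : ∀ i < workSize, σ.work i = 0)
    (hQ : ∀ σ' : St, K.Rep σ' (fun _ => 0) → σ'.r .s = σ.r .s → σ'.r .cur = σ.r .cur →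
      σ'.out = σ.out → σ'.time ≤ σ.time + 3000 * K.N → Q σ') :
    wp K.B K.N (forGroups encodeGroup) Q σ := by
  have hm4 := K.m_mod
  have hmn := K.m_le
  have hNB := K.N_lt
  have hnl := K.n_lt
  have hn1 := K.n_pos
  have hPl := K.le_P (v := K.n + 1) (by omega) le_rfl
  rw [K.last] at hPl
  have htab : ∀ v, 1 ≤ v → v ≤ K.n + 1 → σ.mem v = K.P v := by
    intro v h1 h2
    by_cases hv : v = K.n + 1
    · rw [hv, hmem', K.last]
    · rw [hmem v (by omega) hv, K.table v h1 (by omega)]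
  simp [forGroups]
  refine ⟨by omega, ?_⟩
  refine wp_loop (fun τ => τ.r .X % 4 = 1 ∧ τ.r .X ≤ K.m + 1 ∧
    (∀ v, v ∉ [Var.p, .p1, .p2, .p3, .e, .t, .q, .a, .z, .c, .X] → τ.r v = σ.r v) ∧
    (∀ Y, Y % 4 = 1 → Y < τ.r .X → K.GroupEnc τ.mem Y ∧ τ.mem (Y + 3) = K.slow Y) ∧
    (∀ i, τ.r .X ≤ i → i < K.n + 2 ∨ K.P (τ.r .X) ≤ i → τ.mem i = σ.mem i) ∧
    τ.mem 0 = σ.mem 0 ∧ τ.work = σ.work ∧ τ.out = σ.out ∧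
    τ.time + 1100 * (K.n + 2) ≤ σ.time + 10 + 1100 * (K.P (τ.r .X) + τ.r .X))
    (fun τ => K.m + 1 - τ.r .X) ?_ _ ?_
  · rintro τ ⟨hX4, hXm, hr, henc, hrest, h0, hwork, ho, ht⟩
    have hτm : τ.r .m = K.m := by rw [hr _ (by decide), hm]
    refine ⟨by simp, fun hc => ?_, fun hc => ?_⟩
    · simp [hτm] at hc
      obtain ⟨hh, hl⟩ := hhl (by omega)
      have hX : K.IsGroup (τ.r .X) := ⟨hX4, hc⟩
      have p0 := K.le_P (v := τ.r .X) (by omega) (by omega)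
      have p1 := K.P_le_N (v := τ.r .X + 4) (by omega) (by omega)
      have p2 := K.P_le (u := τ.r .X) (v := τ.r .X + 4) (by omega) (by omega) (by omega)
      generalize hI : (fun σ' : St => (_ : Prop)) = I
      rw [wp_seq]
      refine encodeGroup_spec K (X := τ.r .X) hX (by simp) (by simp [hr, hh]) (by simp [hr, hl])
        ?_ ?_ ?_
      · intro i hi
        simp
        rw [hrest _ (by omega) (by omega)]
        exact htab _ (by omega) (by omega)
      · intro i hi hi'
        simp
        rw [hrest _ (by omega) (by omega)]
        exact hmem _ (by omega) (by omega)
      intro σ' r' henc' hslow' hmem₁ w' o' t'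
      have hX' : σ'.r .X = τ.r .X := by rw [r' _ (by decide)]; simp
      simp [hX']
      repeat refine And.intro (by omega) ?_
      rw [← hI]
      have hL : K.L (τ.r .X) = K.P (τ.r .X + 4) - K.P (τ.r .X) := rfl
      refine ⟨⟨by simp; omega, by simp; omega, ?_, ?_, ?_, ?_, ?_, ?_, ?_⟩, ?_⟩
      · intro v hv
        simp at hv
        simp [hv, r', hr]
      · intro Y hY hYX
        simp at hYX ⊢
        by_cases hYX' : Y = τ.r .X
        · rw [hYX']
          exact ⟨henc', hslow'⟩
        · obtain ⟨e1, e2⟩ := henc Y hY (by omega)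
          have q1 := K.P_le (u := Y + 4) (v := τ.r .X) (by omega) (by omega) (by omega)
          refine ⟨e1.congr ⟨hY, by omega⟩ ?_ ?_ fun i hi hi' => ?_, ?_⟩
          · exact hmem₁ _ (by omega) (by omega) (by omega)
          · exact hmem₁ _ (by omega) (by omega) (by omega)
          · have := K.le_P (v := Y) (by omega) (by omega)
            exact hmem₁ _ (by omega) (by omega) (by omega)
          · rw [hmem₁ _ (by omega) (by omega) (by omega)]
            exact e2
      · intro i hi hi'
        simp at hi hi' ⊢
        rw [hmem₁ _ (by omega) (by omega) (by omega)]
        exact hrest i (by omega) (by omega)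
      · simp
        rw [hmem₁ _ (by omega) (by omega) (by omega)]
        exact h0
      · simp [w', hwork]
      · simp [o', ho]
      · have t'' : σ'.time ≤ τ.time + 5 + 1000 * (1 + K.L (τ.r .X)) := by simpa using t'
        simp only [Function.update_self]
        have hP : K.P (τ.r .X + 4) = K.P (τ.r .X) + K.L (τ.r .X) := by omega
        linarith
      · simp
        omega
    · simp [hτm] at hc
      have hX : τ.r .X = K.m + 1 := by omega
      rw [hX] at hrest henc ht
      have p1 := K.P_le_N (v := K.m + 1) (by omega) (by omega)
      have p2 := K.le_P (v := K.m + 1) (by omega) (by omega)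
      refine hQ _ ⟨?_, ?_, hτm, ?_, ?_, ?_, ?_, ?_, ?_, ?_, ?_, ?_⟩ (hr _ (by decide))
        (hr _ (by decide)) ho ?_
      · simp [hr, hn]
      · simp [hr, hN]
      · intro h
        simp [hr, (hhl h).1]
      · intro h
        simp [hr, (hhl h).2]
      · simp [h0]
        rw [hmem 0 (by omega) (by omega), K.head]
      · intro v h1 h2
        simp
        rw [hrest _ (by omega) (by omega), htab v (by omega) h2]
      · exact fun Y hY => (henc Y hY.1 (by have := hY.2; omega)).1
      · intro Y hY
        simp
        rw [(henc Y hY.1 (by have := hY.2; omega)).2]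
        simp [encCols]
      · intro i h1 h2
        simp
        rw [hrest _ (by omega) (by omega), hmem _ h2 (by omega)]
      · intro v h1 h2
        simp [hwork]
        exact hw _ (by omega)
      · simp
      · simp
        omega
  · refine ⟨by simp, by simp, ?_, ?_, fun _ _ _ => rfl, rfl, rfl, rfl, ?_⟩
    · intro v hv
      simp at hv
      simp [hv]
    · intro Y hY hY'
      simp at hY'
      omega
    · simp [K.first]
      omega

/-- The decoding of all groups restores the representation except for the cell `n + 1`. -/
theorem decode_spec (K : Ctx) {Q : St → Prop} {σ : St} {col : ℕ → ℕ} (hR : K.Rep σ col)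
    (hQ : ∀ σ' : St, σ'.r .n = K.n → σ'.r .N = K.N →
      (∀ i < K.N, i ≠ K.n + 1 → σ'.mem i = K.A i) →
      σ'.out = σ.out → σ'.time ≤ σ.time + 3000 * K.N → Q σ') :
    wp K.B K.N (forGroups decodeGroup) Q σ := by
  have hm4 := K.m_mod
  have hmn := K.m_le
  have hNB := K.N_lt
  have hn1 := K.n_pos
  have hPl := K.le_P (v := K.n + 1) (by omega) le_rfl
  rw [K.last] at hPl
  simp [forGroups]
  refine ⟨by omega, ?_⟩
  refine wp_loop (fun τ => τ.r .X % 4 = 1 ∧ τ.r .X ≤ K.m + 1 ∧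
    (∀ v, v ∉ [Var.i, .p, .p1, .p2, .p3, .t, .a, .c, .X] → τ.r v = σ.r v) ∧
    (∀ i, τ.r .X ≤ i → i < K.n + 2 ∨ K.P (τ.r .X) ≤ i → τ.mem i = σ.mem i) ∧
    (∀ i, 1 ≤ i → i < τ.r .X → τ.mem i = K.P i) ∧
    (∀ i, K.n + 2 ≤ i → i < K.P (τ.r .X) → τ.mem i = K.A i) ∧
    τ.mem 0 = σ.mem 0 ∧ τ.out = σ.out ∧
    τ.time + 1100 * (K.n + 2) ≤ σ.time + 10 + 1100 * (K.P (τ.r .X) + τ.r .X))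
    (fun τ => K.m + 1 - τ.r .X) ?_ _ ?_
  · rintro τ ⟨hX4, hXm, hr, hrest, htab, harr, h0, ho, ht⟩
    have hτm : τ.r .m = K.m := by rw [hr _ (by decide), hR.m]
    refine ⟨by simp, fun hc => ?_, fun hc => ?_⟩
    · simp [hτm] at hc
      have hX : K.IsGroup (τ.r .X) := ⟨hX4, hc⟩
      have p0 := K.le_P (v := τ.r .X) (by omega) (by omega)
      have p1 := K.P_le_N (v := τ.r .X + 4) (by omega) (by omega)
      have p2 := K.P_le (u := τ.r .X) (v := τ.r .X + 4) (by omega) (by omega) (by omega)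
      have hs := K.slow_lt (τ.r .X)
      have hN := K.big_N (by omega)
      have hlt := encCols_lt (X := τ.r .X) hs hR.col_lt
      have hc3 : τ.mem (τ.r .X + 3) = encCols (K.slow (τ.r .X)) col (τ.r .X) := by
        rw [hrest _ (by omega) (by omega), hR.cols _ hX]
      generalize hI : (fun σ' : St => (_ : Prop)) = I
      rw [wp_seq]
      refine decodeGroup_spec K (X := τ.r .X) hX (by simp) (by simp [hr, hR.h (by omega)])
        (by simp [hr, hR.l (by omega)]) ?_ (by simpa [hc3] using encCols_mod_two hs)
        (by simp [hc3]; omega) ?_ ?_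
      · refine (hR.group _ hX).congr hX ?_ ?_ fun i hi hi' => ?_
        · exact hrest _ (by omega) (by omega)
        · exact hrest _ (by omega) (by omega)
        · exact hrest _ (by omega) (by omega)
      · simp
        rw [hrest _ (by omega) (by omega)]
        exact hR.next hX
      intro σ' r' htab' harr' hmem₁ w' o' t'
      have hX' : σ'.r .X = τ.r .X := by rw [r' _ (by decide)]; simp
      simp [hX']
      repeat refine And.intro (by omega) ?_
      rw [← hI]
      have hL : K.L (τ.r .X) = K.P (τ.r .X + 4) - K.P (τ.r .X) := rfl
      refine ⟨⟨by simp; omega, by simp; omega, ?_, ?_, ?_, ?_, ?_, ?_, ?_⟩, ?_⟩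
      · intro v hv
        simp at hv
        simp [hv, r', hr]
      · intro i hi hi'
        simp at hi hi' ⊢
        rw [hmem₁ _ (by omega) (by omega)]
        exact hrest i (by omega) (by omega)
      · intro i hi hi'
        simp at hi' ⊢
        by_cases hiX : i < τ.r .X
        · rw [hmem₁ _ (by omega) (by omega)]
          exact htab i hi hiX
        · obtain ⟨j, rfl⟩ : ∃ j, i = τ.r .X + j := ⟨i - τ.r .X, by omega⟩
          exact htab' j (by omega)
      · intro i hi hi'
        simp at hi' ⊢
        by_cases hiX : i < K.P (τ.r .X)
        · rw [hmem₁ _ (by omega) (by omega)]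
          exact harr i hi hiX
        · exact harr' i (by omega) hi'
      · simp
        rw [hmem₁ _ (by omega) (by omega)]
        exact h0
      · simp [o', ho]
      · have t'' : σ'.time ≤ τ.time + 5 + 1000 * (1 + K.L (τ.r .X)) := by simpa using t'
        simp only [Function.update_self]
        have hP : K.P (τ.r .X + 4) = K.P (τ.r .X) + K.L (τ.r .X) := by omega
        linarith
      · simp
        omega
    · simp [hτm] at hc
      have hX : τ.r .X = K.m + 1 := by omega
      rw [hX] at hrest htab harr ht
      have p1 := K.P_le_N (v := K.m + 1) (by omega) (by omega)
      have p2 := K.le_P (v := K.m + 1) (by omega) (by omega)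
      refine hQ _ ?_ ?_ ?_ ho ?_
      · simp [hr, hR.n]
      · simp [hr, hR.N]
      · intro i hi hne
        simp
        by_cases hi0 : i = 0
        · rw [hi0, h0, hR.head, K.head]
        by_cases him : i < K.m + 1
        · rw [htab i (by omega) him, K.table i (by omega) (by omega)]
        by_cases hin : i < K.n + 2
        · rw [hrest i (by omega) (by omega), hR.table i (by omega) (by omega),
            K.table i (by omega) (by omega)]
        by_cases hiP : i < K.P (K.m + 1)
        · exact harr i (by omega) hiP
        · rw [hrest i (by omega) (by omega), hR.rest i (by omega) hi]
      · simp
        omega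
  · refine ⟨by simp, by simp, ?_, fun _ _ _ => rfl, ?_, ?_, rfl, rfl, ?_⟩
    · intro v hv
      simp at hv
      simp [hv]
    · intro i hi hi'
      simp at hi'
      omega
    · intro i hi hi'
      simp [K.first] at hi'
      omega
    · simp [K.first]
      omega

/-- The program performs a breadth-first search and restores the input memory. -/
theorem main_spec (I : Input) {s : ℕ} {σ : St} (hs : 1 ≤ s ∧ s ≤ I.n) (hσs : σ.work 0 = s)
    (hw : ∀ i < workSize, i ≠ 0 → σ.work i = 0) (hr : ∀ v, σ.r v = 0)
    (hmem : ∀ i < I.N, σ.mem i = I.A i) (ho : σ.out = []) :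
    wp I.B I.N main (fun σ' => ∃ l, IsBFS (I.graph.HasDist s) l ∧ σ'.out = outs l ∧
      (∀ i < I.N, σ'.mem i = I.A i) ∧ σ'.time ≤ σ.time + 30000 * I.N) σ := by
  simp only [main, wp_seq]
  refine setup_spec I hmem ?_
  rintro K σ₁ rfl r₁ s₁ n₁ N₁ m₁ hl₁ mem₁ w₁ o₁ t₁
  have hNB := K.N_lt
  have hn1 := K.n_pos
  have htot := K.total
  have hPl := K.le_P (v := K.n + 1) (by omega) le_rfl
  rw [K.last] at hPl
  refine encode_spec K n₁ N₁ m₁ hl₁ ?_ ?_ ?_ ?_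
  · intro i hi hne
    rw [mem₁, Function.update_of_ne hne, hmem i hi]
  · rw [mem₁, Function.update_self]
  · intro i hi
    rw [w₁]
    by_cases h : i = 0
    · rw [h, Function.update_self]
    · rw [Function.update_of_ne h, hw i hi h]
  intro σ₂ R₂ s₂ c₂ o₂ t₂
  refine search_spec K R₂ (by rw [s₂, s₁, hσs]) hs (by rw [o₂, o₁, ho])
    (by rw [c₂, r₁ _ (by decide), hr]) ?_
  intro σ₃ l col hl o₃ R₃ t₃
  refine decode_spec K R₃ ?_
  intro σ₄ n₄ N₄ mem₄ o₄ t₄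
  simp [n₄, N₄]
  repeat refine And.intro (by omega) ?_
  refine ⟨l, hl, by rw [o₄, o₃], ?_, by omega⟩
  intro i hi
  by_cases h : i = K.n + 1
  · rw [h, Function.update_self]
    omega
  · rw [Function.update_of_ne h]
    exact mem₄ i hi h

/-! ### The sorted standard representation as input of the program -/

section Representation

variable {n : ℕ} (adj : Fin n → Fin n → Prop) [DecidableRel adj]

/-- The concatenation of all adjacency arrays. -/
def flatArrays : List ℕ := (List.finRange n).flatMap (adjArray adj)

/-- The position of the adjacency array of the vertex called `v`, for `1 ≤ v ≤ n`, and the length of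
the representation for `v = n + 1`. -/
def startPos (v : ℕ) : ℕ := n + 2 + (((List.finRange n).take (v - 1)).flatMap (adjArray adj)).length

theorem length_take_flatMap (k : ℕ) (hk : k ≤ n) :
    (((List.finRange n).take k).flatMap (adjArray adj)).length =
      ∑ u : Fin n with u.val < k, (adjArray adj u).length := by
  induction k with
  | zero => simp
  | succ k ih =>
    have hf : (Finset.univ.filter fun u : Fin n => u.val < k + 1) =
        insert ⟨k, hk⟩ (Finset.univ.filter fun u : Fin n => u.val < k) := by
      ext u
      simp [Fin.ext_iff]
      omega
    rw [List.take_add_one, List.flatMap_append, List.length_append, ih (by omega), hf,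
      Finset.sum_insert (by simp)]
    rw [List.getElem?_eq_getElem (by simpa using hk)]
    simpa using add_comm _ _

theorem length_flatArrays : (flatArrays adj).length = ∑ v : Fin n, (adjArray adj v).length := by
  have := length_take_flatMap adj n le_rfl
  rw [List.take_of_length_le (by simp)] at this
  simpa [flatArrays] using this

theorem startPos_eq (v : Fin n) : startPos adj (v.val + 1) = arrayStart adj v := by
  unfold startPos arrayStart
  rw [Nat.add_sub_cancel, length_take_flatMap adj v v.2.le]
  rfl

theorem startPos_succ (v : Fin n) :
    startPos adj (v.val + 1 + 1) = startPos adj (v.val + 1) + (adjArray adj v).length := by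
  unfold startPos
  simp only [Nat.add_sub_cancel]
  rw [List.take_add_one, List.flatMap_append, List.length_append,
    List.getElem?_eq_getElem (by simp)]
  simp [add_assoc]

theorem startPos_last : startPos adj (n + 1) = n + 2 + (flatArrays adj).length := by
  unfold startPos flatArrays
  rw [List.take_of_length_le (by simp)]

theorem length_sortedRep : (sortedRep adj).length = n + 2 + (flatArrays adj).length := by
  unfold sortedRep flatArrays
  simp only [List.length_append, List.length_map, List.length_finRange, List.length_cons,
    List.length_nil]
  omega

/-- The content of the input memory. -/
def content (i : ℕ) : ℕ := (sortedRep adj).getD i 0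

theorem content_zero : content adj 0 = n := by
  simp [content, sortedRep]

theorem content_table (v : Fin n) : content adj (v.val + 1) = arrayStart adj v := by
  simp [content, sortedRep, List.getElem?_append]

theorem content_total : content adj (n + 1) = (flatArrays adj).length := by
  rw [length_flatArrays]
  simp [content, sortedRep]

theorem content_flat (i : ℕ) : content adj (n + 2 + i) = (flatArrays adj).getD i 0 := by
  unfold content sortedRep flatArrays
  rw [List.getD_append_right _ _ _ _ (by simp)]
  congr 1
  simp

theorem content_array (v : Fin n) (i : ℕ) (hi : i < (adjArray adj v).length) :
    content adj (startPos adj (v.val + 1) + i) = (adjArray adj v)[i] := by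
  unfold startPos
  rw [add_assoc, content_flat, Nat.add_sub_cancel]
  have hsplit : flatArrays adj = ((List.finRange n).take v).flatMap (adjArray adj) ++
      (adjArray adj v ++ ((List.finRange n).drop (v + 1)).flatMap (adjArray adj)) := by
    unfold flatArrays
    conv_lhs => rw [← List.take_append_drop v (List.finRange n)]
    rw [List.flatMap_append, List.drop_eq_getElem_cons (by simp)]
    simp
  rw [hsplit, List.getD_append_right _ _ _ _ (by omega), Nat.add_sub_cancel_left,
    List.getD_append _ _ _ _ hi, List.getD_eq_getElem _ _ hi]

theorem mem_adjArray {v : Fin n} {x : ℕ} :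
    x ∈ adjArray adj v ↔ ∃ u, adj v u ∧ u.val + 1 = x := by
  simp [adjArray]

theorem adjArray_sorted (v : Fin n) : (adjArray adj v).Pairwise (· < ·) := by
  unfold adjArray
  rw [List.pairwise_map]
  refine ((List.pairwise_lt_finRange n).filter _).imp ?_
  intro a b h
  simpa using h

/-- The representation as an input of the program. -/
def toInput (B : ℕ) (hn : 1 ≤ n) (hB : n + 2 + (flatArrays adj).length < B) : Input where
  n := n
  N := n + 2 + (flatArrays adj).length
  B := B
  A := content adj
  P := startPos adj
  n_pos := hn
  N_lt := hB
  head := content_zero adj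
  table v h1 h2 := by
    obtain ⟨k, rfl⟩ : ∃ k, v = k + 1 := ⟨v - 1, by omega⟩
    exact (content_table adj ⟨k, h2⟩).trans (startPos_eq adj ⟨k, h2⟩).symm
  total := by
    rw [content_total]
    omega
  first := by simp [startPos]
  last := startPos_last adj
  mono v h1 h2 := by
    obtain ⟨k, rfl⟩ : ∃ k, v = k + 1 := ⟨v - 1, by omega⟩
    have := startPos_succ adj ⟨k, h2⟩
    simp only at this
    omega
  asc v i h1 h2 hi hi' := by
    obtain ⟨k, rfl⟩ : ∃ k, v = k + 1 := ⟨v - 1, by omega⟩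
    obtain ⟨j, rfl⟩ := Nat.exists_eq_add_of_le hi
    have hs := startPos_succ adj ⟨k, h2⟩
    simp only at hs
    have e1 := content_array adj ⟨k, h2⟩ j (by omega)
    have e2 := content_array adj ⟨k, h2⟩ (j + 1) (by omega)
    simp only [← add_assoc] at e1 e2
    rw [e1, e2]
    exact List.pairwise_iff_getElem.1 (adjArray_sorted adj ⟨k, h2⟩) _ _ _ _ (by omega)
  range i h1 h2 := by
    obtain ⟨j, rfl⟩ := Nat.exists_eq_add_of_le h1
    rw [content_flat, List.getD_eq_getElem _ _ (by omega)]
    have hmem : (flatArrays adj)[j]'(by omega) ∈ flatArrays adj := List.getElem_mem _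
    obtain ⟨v, -, hv⟩ := List.mem_flatMap.1 hmem
    obtain ⟨u, -, hu⟩ := (mem_adjArray adj).1 hv
    have := u.2
    omega

variable {B : ℕ} {hn : 1 ≤ n} {hB : n + 2 + (flatArrays adj).length < B}

theorem toInput_adj {x y : ℕ} : (toInput adj B hn hB).graph.Adj x y ↔
    ∃ v u : Fin n, x = v.val + 1 ∧ y = u.val + 1 ∧ adj v u := by
  constructor
  · rintro ⟨⟨h1, h2⟩, i, hi, hi', rfl⟩
    simp only [toInput] at h2 hi hi' ⊢
    obtain ⟨k, rfl⟩ : ∃ k, x = k + 1 := ⟨x - 1, by omega⟩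
    obtain ⟨j, rfl⟩ := Nat.exists_eq_add_of_le hi
    have hs := startPos_succ adj ⟨k, h2⟩
    simp only at hs
    have e := content_array adj ⟨k, h2⟩ j (by omega)
    obtain ⟨u, hu, hu'⟩ := (mem_adjArray adj).1 (List.getElem_mem (l := adjArray adj ⟨k, h2⟩)
      (n := j) (by omega))
    exact ⟨⟨k, h2⟩, u, rfl, e.trans hu'.symm, hu⟩
  · rintro ⟨v, u, rfl, rfl, h⟩
    obtain ⟨j, hj, hj'⟩ := List.mem_iff_getElem.1 ((mem_adjArray adj).2 ⟨u, h, rfl⟩)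
    have hs := startPos_succ adj v
    refine ⟨⟨by omega, v.2⟩, startPos adj (v.val + 1) + j, Nat.le_add_right _ _, ?_, ?_⟩
    · change _ < startPos adj (v.val + 1 + 1)
      omega
    · exact (content_array adj v j hj).trans hj'

theorem toInput_hasWalk {s : Fin n} {x d : ℕ} :
    (toInput adj B hn hB).graph.HasWalk (s.val + 1) d x ↔
      ∃ v : Fin n, x = v.val + 1 ∧ (Digraph.mk adj).HasWalk s d v := by
  constructor
  · intro h
    induction h with
    | nil => exact ⟨s, rfl, .nil⟩
    | snoc _ hadj ih =>
      obtain ⟨v, rfl, hv⟩ := ih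
      obtain ⟨v', u, h1, rfl, h⟩ := (toInput_adj adj).1 hadj
      obtain rfl : v = v' := Fin.ext (by omega)
      exact ⟨u, rfl, .snoc hv h⟩
  · rintro ⟨v, rfl, h⟩
    induction h with
    | nil => exact .nil
    | snoc _ hadj ih => exact .snoc ih ((toInput_adj adj).2 ⟨_, _, rfl, rfl, hadj⟩)

theorem toInput_hasDist {s : Fin n} {x d : ℕ} :
    (toInput adj B hn hB).graph.HasDist (s.val + 1) x d ↔
      ∃ v : Fin n, x = v.val + 1 ∧ (Digraph.mk adj).HasDist s v d := by
  have key : ∀ v : Fin n, (toInput adj B hn hB).graph.HasDist (s.val + 1) (v.val + 1) d ↔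
      (Digraph.mk adj).HasDist s v d := by
    intro v
    unfold Digraph.HasDist
    have : {i | (toInput adj B hn hB).graph.HasWalk (s.val + 1) i (v.val + 1)} =
        {i | (Digraph.mk adj).HasWalk s i v} := by
      ext i
      simp only [Set.mem_ofPred_eq, toInput_hasWalk]
      constructor
      · rintro ⟨v', h1, h⟩
        obtain rfl : v = v' := Fin.ext (by omega)
        exact h
      · exact fun h => ⟨v, rfl, h⟩
    rw [this]
  constructor
  · intro h
    obtain ⟨v, rfl, -⟩ := (toInput_hasWalk adj).1 h.1
    exact ⟨v, rfl, (key v).1 h⟩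
  · rintro ⟨v, rfl, h⟩
    exact (key v).2 h

/-- The result of a breadth-first search with the names of the vertices in the representation. -/
theorem exists_isBFS {s : Fin n} {l : List (ℕ × ℕ)}
    (h : IsBFS ((toInput adj B hn hB).graph.HasDist (s.val + 1)) l) :
    ∃ l' : List (Fin n × ℕ), IsBFS ((Digraph.mk adj).HasDist s) l' ∧
      l = l'.map fun p => (p.1.val + 1, p.2) := by
  have hex : ∀ L : List (ℕ × ℕ), (∀ p ∈ L, p ∈ l) →
      ∃ l' : List (Fin n × ℕ), L = l'.map fun p => (p.1.val + 1, p.2) := by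
    intro L hL
    induction L with
    | nil => exact ⟨[], rfl⟩
    | cons p L ih =>
      obtain ⟨l', rfl⟩ := ih fun q hq => hL q (by simp [hq])
      obtain ⟨x, d⟩ := p
      obtain ⟨v, rfl, -⟩ := (toInput_hasDist adj).1 ((h.mem_iff x d).1 (hL _ (by simp)))
      exact ⟨(v, d) :: l', rfl⟩
  obtain ⟨l', rfl⟩ := hex l fun _ hp => hp
  refine ⟨l', ⟨?_, ?_, ?_⟩, rfl⟩
  · have := h.nodup
    rw [List.map_map] at this
    refine List.Nodup.of_map (fun v : Fin n => v.val + 1) ?_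
    rw [List.map_map]
    exact this
  · intro v d
    have h1 := h.mem_iff (v.val + 1) d
    rw [toInput_hasDist] at h1
    constructor
    · intro hv
      obtain ⟨v', hv', hd⟩ := h1.1 (List.mem_map.2 ⟨(v, d), hv, rfl⟩)
      obtain rfl : v = v' := Fin.ext (by omega)
      exact hd
    · intro hd
      obtain ⟨⟨v', d'⟩, hp, he⟩ := List.mem_map.1 (h1.2 ⟨v, rfl, hd⟩)
      simp only [Prod.mk.injEq] at he
      obtain ⟨he, rfl⟩ := he
      obtain rfl : v' = v := Fin.ext (by omega)
      exact hp
  · have := h.ascending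
    rw [List.pairwise_map] at this
    exact this

end Representation

/-! ### The machine program -/

/-- The program for the word RAM. Its working memory consists of an array of `workSize` words, which
initially contains the start vertex, and of the registers of the variables and of temporary values. -/
def program : Program lastReg := main.code 0 ++ [.halt]

theorem program_halts {n : ℕ} (adj : Fin n → Fin n → Prop) [DecidableRel adj] (s : Fin n) {w : ℕ}
    (hw : n + 2 + (flatArrays adj).length < 2 ^ w) :
    ∃ l : List (Fin n × ℕ), IsBFS ((Digraph.mk adj).HasDist s) l ∧
      program.HaltsRestoring (repWords w adj) (vertexWord w s) (outputWords w l)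
        (30000 * (n + 2 + (flatArrays adj).length)) := by
  have hn : 1 ≤ n := by have := s.2; omega
  have hs := s.2
  let I := toInput adj (2 ^ w) hn hw
  have hlen : (repWords w adj).length = I.N := by
    simp only [repWords, List.length_map, length_sortedRep]
    rfl
  have hA : ∀ i (hi : i < (sortedRep adj).length), (sortedRep adj)[i] = I.A i := fun i hi =>
    (List.getD_eq_getElem _ _ hi).symm
  have hAlt : ∀ i < I.N, I.A i < 2 ^ w := by
    intro i hi
    have hPN : ∀ v, 1 ≤ v → v ≤ I.n → I.P v ≤ I.N := by
      intro v h1 h2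
      have hle : ∀ k, v + k ≤ I.n + 1 → I.P v ≤ I.P (v + k) := by
        intro k
        induction k with
        | zero => exact fun _ => le_rfl
        | succ k ih =>
          exact fun hk => (ih (by omega)).trans (I.mono (v + k) (by omega) (by omega))
      have := hle (I.n + 1 - v) (by omega)
      rwa [show v + (I.n + 1 - v) = I.n + 1 by omega, I.last] at this
    have hB : I.N < 2 ^ w := I.N_lt
    have htot := I.total
    rcases Nat.lt_or_ge i (I.n + 2) with h | h
    · rcases Nat.lt_or_ge i (I.n + 1) with h' | h'
      · rcases Nat.eq_zero_or_pos i with rfl | h0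
        · rw [I.head]
          omega
        · rw [I.table i h0 (by omega)]
          exact (hPN i h0 (by omega)).trans_lt hB
      · obtain rfl : i = I.n + 1 := by omega
        omega
    · have := I.range i h hi
      omega
  let σ : St := ⟨fun _ => 0, I.A, fun j => if j = 0 then s.val + 1 else 0, [], 0⟩
  have hsw : s.val + 1 < 2 ^ w := by omega
  have hcell : ∀ (i : ℕ) (hi : i < lastReg + 1), (⟨i, hi⟩ : Fin (lastReg + 1)) = 0 ↔ i = 0 :=
    fun i hi => by rw [Fin.ext_iff]; rfl
  have hsim : Sim I.N σ (Program.init lastReg (repWords w adj) (vertexWord w s)) := by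
    refine ⟨?_, ?_, hlen, ?_, rfl⟩
    · intro x
      have : reg x ≠ 0 := by
        unfold reg
        rw [Ne, hcell]
        unfold workSize
        omega
      simp [Program.init, this, σ]
    · intro j hj
      by_cases h : j = 0
      · subst h
        have : cell 0 hj = 0 := rfl
        simp [Program.init, this, σ, vertexWord, Nat.mod_eq_of_lt hsw]
      · have : cell j hj ≠ 0 := by
          unfold cell
          rw [Ne, hcell]
          exact h
        simp [Program.init, this, σ, h]
    · intro i hi
      simp only [Program.init] at hi ⊢
      rw [hlen] at hi
      simp only [repWords, List.getElem_map, BitVec.toNat_ofNat, hA]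
      exact Nat.mod_eq_of_lt (hAlt i hi)
  have hwp := main_spec I (s := s.val + 1) (σ := σ) ⟨by omega, hs⟩ rfl
    (fun i _ hi => if_neg hi) (fun _ => rfl) (fun _ _ => rfl) rfl
  have hcode : CodeAt program 0 (main.code 0) :=
    CodeAt.left (b := [.halt]) fun i _ => by rw [Nat.zero_add, program]
  obtain ⟨t, c, σ', hreach, hsim', hpc, ⟨l, hl, hout, hmem, htime⟩, ht⟩ :=
    main.code_sound 0 _ σ _ depth_main hsim rfl hcode hwp
  obtain ⟨l', hl', rfl⟩ := exists_isBFS adj hl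
  refine ⟨l', hl', t, ?_, c, hreach, ?_, ?_, ?_⟩
  · have h0 : σ.time = 0 := rfl
    have hN : I.N = n + 2 + (flatArrays adj).length := rfl
    omega
  · rw [hpc, Nat.zero_add, ← Cmd.length_code main 0, program]
    simp
  · refine List.ext_getElem (hsim'.length.trans hlen.symm) fun i hi hi' => ?_
    rw [← BitVec.toNat_inj, hsim'.mem i hi, hmem i (by rwa [← hsim'.length])]
    simp only [repWords, List.getElem_map, BitVec.toNat_ofNat, hA]
    exact (Nat.mod_eq_of_lt (hAlt i (by rwa [← hsim'.length]))).symm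
  · rw [hsim'.out, hout]
    simp [Ctx.outs, outputWords, List.flatMap_map, List.map_flatMap, vertexWord]

/-! ### Counting edges -/

theorem length_adjArray {n : ℕ} (adj : Fin n → Fin n → Prop) [DecidableRel adj] (v : Fin n) :
    (adjArray adj v).length = (Finset.univ.filter fun u => adj v u).card := by
  unfold adjArray
  rw [List.length_map, ← List.toFinset_card_of_nodup ((List.nodup_finRange n).filter _)]
  congr 1
  ext u
  simp

theorem length_flatArrays_digraph {n : ℕ} (G : Digraph (Fin n)) [DecidableRel G.Adj] :
    (flatArrays G.Adj).length = G.numEdges := by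
  rw [length_flatArrays, Digraph.numEdges, Finset.card_filter, Fintype.sum_prod_type]
  exact Finset.sum_congr rfl fun v _ => by rw [length_adjArray, Finset.card_filter]

theorem length_flatArrays_simpleGraph {n : ℕ} (G : SimpleGraph (Fin n)) [DecidableRel G.Adj] :
    (flatArrays G.Adj).length = 2 * G.edgeFinset.card := by
  rw [length_flatArrays, ← G.sum_degrees_eq_twice_card_edges]
  refine Finset.sum_congr rfl fun v _ => ?_
  rw [length_adjArray, ← SimpleGraph.card_neighborFinset_eq_degree,
    SimpleGraph.neighborFinset_eq_filter]

theorem hasWalk_iff {V : Type*} (G : SimpleGraph V) {s v : V} {d : ℕ} :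
    (Digraph.mk G.Adj).HasWalk s d v ↔ ∃ p : G.Walk s v, p.length = d := by
  constructor
  · intro h
    induction h with
    | nil => exact ⟨.nil, rfl⟩
    | snoc _ hadj ih =>
      obtain ⟨p, rfl⟩ := ih
      exact ⟨p.concat hadj, p.length_concat hadj⟩
  · rintro ⟨p, rfl⟩
    induction p using SimpleGraph.Walk.concatRec with
    | Hnil => exact .nil
    | Hconcat p h ih =>
      rw [SimpleGraph.Walk.length_concat]
      exact .snoc ih h

theorem hasDist_iff {V : Type*} (G : SimpleGraph V) {s v : V} {d : ℕ} :
    (Digraph.mk G.Adj).HasDist s v d ↔ G.HasDist s v d := by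
  constructor
  · rintro ⟨hw, hmin⟩
    obtain ⟨p, hp⟩ := (hasWalk_iff G).1 hw
    obtain ⟨q, hq⟩ := p.reachable.exists_walk_length_eq_dist
    exact ⟨p.reachable, le_antisymm (hp ▸ SimpleGraph.dist_le p)
      (hmin ((hasWalk_iff G).2 ⟨q, hq⟩))⟩
  · rintro ⟨hr, rfl⟩
    refine ⟨(hasWalk_iff G).2 hr.exists_walk_length_eq_dist, fun i hi => ?_⟩
    obtain ⟨p, rfl⟩ := (hasWalk_iff G).1 hi
    exact SimpleGraph.dist_le p

end InPlaceBFS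

theorem mainTheorem2 :
    ∃ (k : ℕ) (prog : Program k) (C : ℕ),
      (∀ (n : ℕ) (G : Digraph (Fin n)) [DecidableRel G.Adj] (s : Fin n) (w : ℕ),
        n + G.numEdges + 2 < 2 ^ w →
          (repWords w G.Adj).length = n + G.numEdges + 2 ∧
          ∃ l : List (Fin n × ℕ), IsBFS (G.HasDist s) l ∧
            prog.HaltsRestoring (repWords w G.Adj) (vertexWord w s) (outputWords w l)
              (C * (n + G.numEdges))) ∧
      (∀ (n : ℕ) (G : SimpleGraph (Fin n)) [DecidableRel G.Adj] (s : Fin n) (w : ℕ),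
        n + 2 * G.edgeFinset.card + 2 < 2 ^ w →
          (repWords w G.Adj).length = n + 2 * G.edgeFinset.card + 2 ∧
          ∃ l : List (Fin n × ℕ), IsBFS (G.HasDist s) l ∧
            prog.HaltsRestoring (repWords w G.Adj) (vertexWord w s) (outputWords w l)
              (C * (n + G.edgeFinset.card))) := by
  refine ⟨InPlaceBFS.lastReg, InPlaceBFS.program, 180000, ?_, ?_⟩
  · intro n G _ s w hw
    have hM := InPlaceBFS.length_flatArrays_digraph G
    refine ⟨by rw [repWords, List.length_map, InPlaceBFS.length_sortedRep]; omega, ?_⟩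
    obtain ⟨l, hl, t, ht, h⟩ := InPlaceBFS.program_halts G.Adj s (w := w) (by omega)
    have hn := s.2
    exact ⟨l, hl, t, by omega, h⟩
  · intro n G _ s w hw
    have hM := InPlaceBFS.length_flatArrays_simpleGraph G
    refine ⟨by rw [repWords, List.length_map, InPlaceBFS.length_sortedRep]; omega, ?_⟩
    obtain ⟨l, hl, t, ht, h⟩ := InPlaceBFS.program_halts G.Adj s (w := w) (by omega)
    have hn := s.2
    have hd : (Digraph.mk G.Adj).HasDist s = G.HasDist s := by
      ext v d
      exact InPlaceBFS.hasDist_iff G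
    exact ⟨l, hd ▸ hl, t, by omega, h⟩
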